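/- Let $K\in\mathbb R$ and let $\mathbb X_K$ be the complete simply connected surface of constant curvature $K$ (round sphere of radius $1/\sqrt K$, Euclidean plane, or hyperbolic plane of curvature $K$). Put $\sin_K(x)=\frac{1}{\sqrt K}\sin(\sqrt K x)$, $x$, $\frac1{\sqrt{-K}}\sinh(\sqrt{-K}x)$ for $K>0$, $K=0$, $K<0$ respectively, and $\cos_K=\sin_K'$. Let $\mu_K$ be the isometry invariant measure on the set $\mathcal G^K$ of unoriented complete geodesics of $\mathbb X_K$, normalized by $d\mu_K=\sin\alpha\,dl\,d\alpha$ ($l$ = position of the intersection point on a fixed geodesic, $\alpha$ = angle of intersection); equivalently, $d\mu_K=\cos_K(w)\,dw\,d\eta$, where $w$ is the distance of the geodesic from a fixed point $o$ and $\eta$ the direction at $o$ of the perpendicular to it. Let $D\subset\mathbb X_K$ be a compact set with non-empty interior that is convex, meaning that any two distinct points of $D$ are joined by exactly one minimizing geodesic of $\mathbb X_K$ and that this geodesic lies in $D$. Suppose that $\partial D$ is a simple closed regular $C^1$ curve, of length $L_K(\partial D)$, and let $A(D)$ be the area of $D$. Let $\mathcal G^K_D$ be the set of geodesics meeting $D$.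 For $\gamma\in\mathcal G^K_D$ let $\rho_K(\gamma)$ be the length of the chord $\gamma\cap D$, and let $\alpha_1(\gamma),\alpha_2(\gamma)$ be the angles between the chord and $\partial D$ at its two end points, both measured on the same side of $\gamma$ (they are defined for $\mu_K$-almost every $\gamma\in\mathcal G^K_D$). Theorem. For every $f\in C^1(\mathbb R;\mathbb R)$ the functions $f\circ\rho_K$ and $(f'\circ\rho_K)\sin_K(\rho_K)\cot\alpha_1\cot\alpha_2$ are $\mu_K$-integrable on $\mathcal G^K_D$, and $$\int_{\mathcal G^K_D}(f\circ\rho_K)\,d\mu_K=\int_{\mathcal G^K_D}(f'\circ\rho_K)\sin_K(\rho_K)\cot\alpha_1\cot\alpha_2\,d\mu_K+f(0)\,L_K(\partial D)+\sum_a\int_0^{|a|}\bigl(f(x)-f(0)\bigr)\,dx,$$ where $a$ runs over the (at most countably many) maximal geodesic segments of positive length contained in $\partial D$, $|a|$ is the length of $a$, and the sum converges absolutely. In particular, if $\partial D$ contains no geodesic segment of positive length, then $$\int_{\mathcal G^K_D}(f\circ\rho_K)\,d\mu_K=\int_{\mathcal G^K_D}(f'\circ\rho_K)\sin_K(\rho_K)\cot\alpha_1\cot\alpha_2\,d\mu_K+f(0)\,L_K(\partial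 D).$$ Moreover (for every such $D$, with or without boundary segments) one has the Crofton formula $\mu_K(\mathcal G^K_D)=L_K(\partial D)$ and the isoperimetric inequality $L_K(\partial D)^2\ge 4\pi A(D)-K\,A(D)^2$. -/

import Mathlib

open MeasureTheory Set

namespace XK

noncomputable section

/-- The generalized sine `sin_K`. -/
def sinK (K x : ℝ) : ℝ :=
  if 0 < K then Real.sin (√K * x) / √K
  else if K < 0 then Real.sinh (√(-K) * x) / √(-K)
  else x

/-- The generalized cosine `cos_K`, the derivative of `sin_K`. -/
def cosK (K x : ℝ) : ℝ :=
  if 0 < K then Real.cos (√K * x)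
  else if K < 0 then Real.cosh (√(-K) * x)
  else 1

/-- The quadric form `x₀y₀ + K (x₁y₁ + x₂y₂)` on `ℝ³`. -/
def quad (K : ℝ) (x y : Fin 3 → ℝ) : ℝ := x 0 * y 0 + K * (x 1 * y 1 + x 2 * y 2)

/-- The underlying set of the model surface of curvature `K`: a round sphere of radius `1/√K` if
`K > 0`, the plane `x₀ = 1` if `K = 0`, one sheet of a hyperboloid if `K < 0`
(the coordinate `x₀` is rescaled so that the three cases have the same equation). -/
def IsPoint (K : ℝ) (x : Fin 3 → ℝ) : Prop := quad K x x = 1 ∧ (K ≤ 0 → 0 < x 0)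

/-- The simply connected complete surface `X_K` of constant curvature `K`, with the topology
of a subspace of `ℝ³`. -/
abbrev Space (K : ℝ) : Type := {x : Fin 3 → ℝ // IsPoint K x}

/-- The Riemannian metric of `X_K`, to be applied to tangent vectors at one point. It is the
restriction of `dx₀²/K + dx₁² + dx₂²`; for `K = 0` tangent vectors have `u₀ = 0`, and the first
term is `0`. -/
def metric (K : ℝ) (u v : Fin 3 → ℝ) : ℝ := u 0 * v 0 / K + u 1 * v 1 + u 2 * v 2

/-- Length of a tangent vector. -/
def vnorm (K : ℝ) (u : Fin 3 → ℝ) : ℝ := √(metric K u u)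

/-- The angle in `[0, π]` between two nonzero tangent vectors at the same point. -/
def angle (K : ℝ) (u v : Fin 3 → ℝ) : ℝ := Real.arccos (metric K u v / (vnorm K u * vnorm K v))

/-- The unit tangent bundle of `X_K`: pairs (point, unit tangent vector at this point);
`quad K x u = 0` says that `u` is tangent to `X_K` at `x`. -/
abbrev UnitTangent (K : ℝ) : Type :=
  {q : (Fin 3 → ℝ) × (Fin 3 → ℝ) // IsPoint K q.1 ∧ quad K q.1 q.2 = 0 ∧ metric K q.2 q.2 = 1}

/-- Base point of a unit tangent vector. -/
def UnitTangent.pt {K : ℝ} (q : UnitTangent K) : Space K := ⟨q.1.1, q.2.1⟩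

/-- The vector part of a unit tangent vector. -/
def UnitTangent.vec {K : ℝ} (q : UnitTangent K) : Fin 3 → ℝ := q.1.2

theorem cosK_sq_add (K x : ℝ) : cosK K x ^ 2 + K * sinK K x ^ 2 = 1 := by
  unfold cosK sinK
  split_ifs with h1 h2
  · have := Real.sin_sq_add_cos_sq (√K * x)
    rw [div_pow, Real.sq_sqrt h1.le]
    field_simp
    linarith
  · have := Real.cosh_sq (√(-K) * x)
    have hK : K ≠ 0 := h2.ne
    rw [div_pow, Real.sq_sqrt (by linarith), this]
    field_simp
    ring
  · have : K = 0 := by linarith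
    simp [this]

theorem cosK_pos {K : ℝ} (hK : K ≤ 0) (x : ℝ) : 0 < cosK K x := by
  unfold cosK
  rw [if_neg (not_lt.2 hK)]
  split_ifs
  · exact Real.cosh_pos _
  · exact one_pos

theorem quad_self {K : ℝ} (q : UnitTangent K) : quad K q.1.2 q.1.2 = K := by
  obtain ⟨⟨x, u⟩, ⟨h1, h2⟩, h3, h4⟩ := q
  unfold quad at *
  dsimp only at *
  by_cases hK : K = 0
  · subst hK
    have : x 0 ≠ 0 := (h2 le_rfl).ne'
    have : u 0 = 0 := by simpa [this] using h3
    simp [this]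
  · unfold metric at h4
    dsimp only at h4
    field_simp at h4
    linear_combination h4

theorem isPoint_geo {K : ℝ} (q : UnitTangent K) (t : ℝ) :
    IsPoint K (cosK K t • q.1.1 + sinK K t • q.1.2) := by
  have hq := quad_self q
  have hcs := cosK_sq_add K t
  obtain ⟨⟨x, u⟩, ⟨h1, h2⟩, h3, h4⟩ := q
  dsimp only at h1 h2 h3 h4 hq ⊢
  unfold quad at h1 h3 hq
  refine ⟨?_, fun hK => ?_⟩
  · simp only [quad, Pi.add_apply, Pi.smul_apply, smul_eq_mul]
    linear_combination (cosK K t) ^ 2 * h1 + 2 * cosK K t * sinK K t * h3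
      + (sinK K t) ^ 2 * hq + hcs
  · simp only [Pi.add_apply, Pi.smul_apply, smul_eq_mul]
    have hx := h2 hK
    have hc := cosK_pos hK t
    have hb : (u 0) ^ 2 ≤ -K * (x 0) ^ 2 + K := by
      have e : (x 0 * u 0) ^ 2 = K ^ 2 * (x 1 * u 1 + x 2 * u 2) ^ 2 := by
        have : x 0 * u 0 = -(K * (x 1 * u 1 + x 2 * u 2)) := by linarith
        rw [this]; ring
      have e2 : (K * (x 1 * x 1 + x 2 * x 2)) * (K * (u 1 * u 1 + u 2 * u 2))
          = (1 - x 0 * x 0) * (K - u 0 * u 0) := by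
        rw [eq_sub_of_add_eq' h1, eq_sub_of_add_eq' hq]
      nlinarith [mul_nonneg (sq_nonneg K) (sq_nonneg (x 1 * u 2 - x 2 * u 1))]
    have h5 : (sinK K t * u 0) ^ 2 < (cosK K t * x 0) ^ 2 := by
      have := mul_le_mul_of_nonneg_left hb (sq_nonneg (sinK K t))
      have hx2 : 0 < x 0 ^ 2 := by positivity
      have := mul_nonneg (neg_nonneg.2 hK) (sq_nonneg (sinK K t))
      nlinarith
    have := abs_lt.1 (abs_lt_of_sq_lt_sq h5 (by positivity))
    linarith [this.1]

/-- The unit speed geodesic with initial position and velocity `q`, at time `t`. -/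
def geo {K : ℝ} (q : UnitTangent K) (t : ℝ) : Space K :=
  ⟨cosK K t • q.1.1 + sinK K t • q.1.2, isPoint_geo q t⟩

/-- The velocity of the geodesic `geo q` at time `t` (see `hasDerivAt_geo`). -/
def geoVel {K : ℝ} (q : UnitTangent K) (t : ℝ) : Fin 3 → ℝ :=
  (-K * sinK K t) • q.1.1 + cosK K t • q.1.2

theorem hasDerivAt_sinK (K t : ℝ) : HasDerivAt (sinK K) (cosK K t) t := by
  unfold sinK cosK
  have h0 (a : ℝ) : HasDerivAt (fun x : ℝ => a * x) a t := by
    simpa using (hasDerivAt_id t).const_mul a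
  split_ifs with h1 h2
  · have : √K ≠ 0 := (Real.sqrt_pos.2 h1).ne'
    exact (((h0 (√K)).sin).div_const (√K)).congr_deriv
      (by rw [mul_div_assoc, div_self this, mul_one])
  · have : √(-K) ≠ 0 := (Real.sqrt_pos.2 (by linarith)).ne'
    exact (((h0 (√(-K))).sinh).div_const (√(-K))).congr_deriv
      (by rw [mul_div_assoc, div_self this, mul_one])
  · exact hasDerivAt_id t

theorem hasDerivAt_cosK (K t : ℝ) : HasDerivAt (cosK K) (-K * sinK K t) t := by
  unfold sinK cosK
  have h0 (a : ℝ) : HasDerivAt (fun x : ℝ => a * x) a t := by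
    simpa using (hasDerivAt_id t).const_mul a
  split_ifs with h1 h2
  · have h3 : √K ≠ 0 := (Real.sqrt_pos.2 h1).ne'
    refine (h0 (√K)).cos.congr_deriv ?_
    have := Real.mul_self_sqrt h1.le
    field_simp
    linear_combination -(Real.sin (√K * t)) * this
  · have h3 : √(-K) ≠ 0 := (Real.sqrt_pos.2 (by linarith)).ne'
    refine (h0 (√(-K))).cosh.congr_deriv ?_
    have := Real.mul_self_sqrt (show (0 : ℝ) ≤ -K by linarith)
    field_simp
    linear_combination (Real.sinh (√(-K) * t)) * this
  · have : K = 0 := by linarith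
    simpa [this] using hasDerivAt_const t (1 : ℝ)

theorem hasDerivAt_geo {K : ℝ} (q : UnitTangent K) (t : ℝ) :
    HasDerivAt (fun s => (geo q s : Fin 3 → ℝ)) (geoVel q t) t :=
  ((hasDerivAt_cosK K t).smul_const q.1.1).add ((hasDerivAt_sinK K t).smul_const q.1.2)

/-- The Riemannian distance of `X_K`: the smallest length of a geodesic from `x` to `y`. -/
def gdist {K : ℝ} (x y : Space K) : ℝ :=
  sInf {t : ℝ | 0 ≤ t ∧ ∃ q : UnitTangent K, q.pt = x ∧ geo q t = y}

/-- Geodesic convexity: any two distinct points of `D` are joined by exactly one minimizing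
geodesic of `X_K`, and it lies in `D`. -/
def GeodConvex {K : ℝ} (D : Set (Space K)) : Prop :=
  ∀ x ∈ D, ∀ y ∈ D, x ≠ y → ∃ q : UnitTangent K,
    (q.pt = x ∧ geo q (gdist x y) = y) ∧
    (∀ q' : UnitTangent K, q'.pt = x → geo q' (gdist x y) = y → q' = q) ∧
    ∀ s ∈ Icc 0 (gdist x y), geo q s ∈ D

/-- The (complete, unoriented) geodesic through `q`, as a set of points. -/
def line {K : ℝ} (q : UnitTangent K) : Set (Space K) := range (geo q)

/-- The set `𝒢^K` of unoriented complete geodesics of `X_K`. -/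
def Geodesic (K : ℝ) : Type := {g : Set (Space K) // ∃ q : UnitTangent K, line q = g}

/-- The geodesic generated by a unit tangent vector. -/
def toGeodesic {K : ℝ} (q : UnitTangent K) : Geodesic K := ⟨line q, q, rfl⟩

/-- The quotient measurable structure of `𝒢^K` as a quotient of the unit tangent bundle. -/
instance (K : ℝ) : MeasurableSpace (Geodesic K) :=
  MeasurableSpace.map (toGeodesic (K := K)) inferInstance

/-- The point with geodesic polar coordinates `(r, θ)` about the base point `(1, 0, 0)`. -/
def polarPoint (K r θ : ℝ) : Space K :=
  ⟨![cosK K r, sinK K r * Real.cos θ, sinK K r * Real.sin θ], by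
    refine ⟨?_, fun hK => by simpa using cosK_pos hK r⟩
    have h1 := cosK_sq_add K r
    have h2 := Real.sin_sq_add_cos_sq θ
    simp only [quad, Matrix.cons_val_zero, Matrix.cons_val_one, Matrix.cons_val]
    linear_combination h1 + K * sinK K r ^ 2 * h2⟩

/-- The unit tangent vector at `polarPoint K r θ` orthogonal to the radial direction. -/
def polarTangent (K r θ : ℝ) : UnitTangent K :=
  ⟨(polarPoint K r θ, ![0, -Real.sin θ, Real.cos θ]), (polarPoint K r θ).2, by
    simp [quad, polarPoint]; ring_nf; simp, by
    have := Real.sin_sq_add_cos_sq θ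
    simp [metric]; linarith⟩

instance (K : ℝ) : Nonempty (UnitTangent K) := ⟨polarTangent K 0 0⟩

/-- The geodesic with polar parameters `(w, η)`: it is at distance `w` from the base point, and `η`
is the direction, seen from the base point, of the perpendicular to the geodesic. -/
def polarGeodesic (K : ℝ) (z : ℝ × ℝ) : Geodesic K := toGeodesic (polarTangent K z.1 z.2)

/-- The invariant measure `μ_K` on `𝒢^K`, normalized by `dμ_K = sin α dl dα`; in polar parameters
it is `dμ_K = cos_K(w) dw dη`. -/
def liouville (K : ℝ) : Measure (Geodesic K) :=
  Measure.map (polarGeodesic K)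
    ((volume.restrict ({w : ℝ | 0 < w ∧ (0 < K → w < Real.pi / (2 * √K))} ×ˢ
      Ico (0 : ℝ) (2 * Real.pi))).withDensity fun z => ENNReal.ofReal (cosK K z.1))

/-- The Riemannian area measure of `X_K`; in polar coordinates it is `sin_K(r) dr dθ`. -/
def area (K : ℝ) : Measure (Space K) :=
  Measure.map (fun z : ℝ × ℝ => polarPoint K z.1 z.2)
    ((volume.restrict ({r : ℝ | 0 < r ∧ (0 < K → r < Real.pi / √K)} ×ˢ
      Ico (0 : ℝ) (2 * Real.pi))).withDensity fun z => ENNReal.ofReal (sinK K z.1))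

theorem continuous_polarPoint (K : ℝ) :
    Continuous fun z : ℝ × ℝ => polarPoint K z.1 z.2 := by
  have hs : Continuous (sinK K) :=
    continuous_iff_continuousAt.2 fun t => (hasDerivAt_sinK K t).continuousAt
  have hc : Continuous (cosK K) :=
    continuous_iff_continuousAt.2 fun t => (hasDerivAt_cosK K t).continuousAt
  refine Continuous.subtype_mk (continuous_pi fun i => ?_) _
  fin_cases i <;> simp <;> fun_prop

theorem measurable_polarGeodesic (K : ℝ) : Measurable (polarGeodesic K) := by
  have h1 : Measurable (toGeodesic (K := K)) := fun s hs => hs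
  refine h1.comp (Continuous.measurable ?_)
  refine Continuous.subtype_mk (Continuous.prodMk ?_ (continuous_pi fun i => ?_)) _
  · exact continuous_subtype_val.comp (continuous_polarPoint K)
  · fin_cases i <;> simp <;> fun_prop

/-- The set `𝒢_D` of geodesics that meet `D`. -/
def hitting {K : ℝ} (D : Set (Space K)) : Set (Geodesic K) := {g | (g.1 ∩ D).Nonempty}

/-- `ch = (q, l)` describes the chord `g ∩ D` as a segment of `g`: it starts at the point of `q` in
the direction of `q` and has length `l`. -/
def IsChord {K : ℝ} (D : Set (Space K)) (g : Geodesic K) (ch : UnitTangent K × ℝ) : Prop :=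
  toGeodesic ch.1 = g ∧ 0 ≤ ch.2 ∧ g.1 ∩ D = geo ch.1 '' Icc 0 ch.2

/-- The chord `g ∩ D` with one of its two orientations. -/
def chord {K : ℝ} (D : Set (Space K)) (g : Geodesic K) : UnitTangent K × ℝ :=
  Classical.epsilon (IsChord D g)

/-- The chord length `ρ_K(g)`. -/
def chordLength {K : ℝ} (D : Set (Space K)) (g : Geodesic K) : ℝ := (chord D g).2

/-- `c` is a regular `C¹` parametrization, of period `T`, of the boundary of `D` as a simple
closed curve. -/
structure IsC1Boundary {K : ℝ} (D : Set (Space K)) (c : ℝ → Space K) (T : ℝ) : Prop where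
  period_pos : 0 < T
  contDiff : ContDiff ℝ 1 fun t => (c t : Fin 3 → ℝ)
  regular : ∀ t, deriv (fun s => (c s : Fin 3 → ℝ)) t ≠ 0
  periodic : Function.Periodic c T
  injOn : InjOn c (Ico 0 T)
  range_eq : range c = frontier D

/-- Velocity of a curve in `X_K`. -/
def vel {K : ℝ} (c : ℝ → Space K) (t : ℝ) : Fin 3 → ℝ := deriv (fun s => (c s : Fin 3 → ℝ)) t

/-- Length of a closed curve of period `T`. -/
def curveLength {K : ℝ} (c : ℝ → Space K) (T : ℝ) : ℝ := ∫ t in (0 : ℝ)..T, vnorm K (vel c t)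

/-- The two sides of the geodesic `line q` in `X_K` are the sets where `side q` is positive,
respectively negative; a tangent vector `τ` at a point of `line q` points to the positive side
if `0 < side q τ`. -/
def side {K : ℝ} (q : UnitTangent K) (z : Fin 3 → ℝ) : ℝ :=
  (Matrix.of ![(q.pt : Fin 3 → ℝ), q.vec, z]).det

/-- The tangent vector at `x` of the curve `c`, of the two possible directions the one that points
to the positive side of `line q`. -/
def sideTangent {K : ℝ} (c : ℝ → Space K) (q : UnitTangent K) (x : Space K) : Fin 3 → ℝ :=
  Classical.epsilon fun τ => ∃ t, c t = x ∧ (τ = vel c t ∨ τ = -vel c t) ∧ 0 < side q τ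

/-- The angle `α₁` between the boundary and the chord at its initial point, on the positive
side of the geodesic. -/
def alphaOne {K : ℝ} (D : Set (Space K)) (c : ℝ → Space K) (g : Geodesic K) : ℝ :=
  angle K (sideTangent c (chord D g).1 (chord D g).1.pt) (chord D g).1.vec

/-- The angle `α₂` between the boundary and the chord at its final point, on the same (positive)
side of the geodesic. -/
def alphaTwo {K : ℝ} (D : Set (Space K)) (c : ℝ → Space K) (g : Geodesic K) : ℝ :=
  angle K (sideTangent c (chord D g).1 (geo (chord D g).1 (chordLength D g)))
    (-geoVel (chord D g).1 (chordLength D g))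

/-- The integrand `f'(ρ) sin_K(ρ) cot α₁ cot α₂`. -/
def pleijelIntegrand {K : ℝ} (D : Set (Space K)) (c : ℝ → Space K) (f : ℝ → ℝ)
    (g : Geodesic K) : ℝ :=
  deriv f (chordLength D g) * sinK K (chordLength D g) *
    Real.cot (alphaOne D c g) * Real.cot (alphaTwo D c g)

/-- The boundary of `D` contains no geodesic segment of positive length. -/
def NoBoundarySegment {K : ℝ} (D : Set (Space K)) : Prop :=
  ∀ (q : UnitTangent K) (t : ℝ), 0 < t → ∃ s ∈ Icc 0 t, geo q s ∉ frontier D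

/-- The supporting geodesics of `D`: those whose intersection with `D` is non-empty and contained in
the boundary. The maximal geodesic segments of positive length in the boundary of a convex `D` are
the chords of positive length of these geodesics. -/
def supporting {K : ℝ} (D : Set (Space K)) : Set (Geodesic K) :=
  {g | (g.1 ∩ D).Nonempty ∧ g.1 ∩ D ⊆ frontier D}

end

end XK

open XK

/-! The three geometries are treated at once inside ℝ³. A point is a vector with `quad K x x = 1`, a
geodesic is the trace of a plane through the origin, `quad K x y` is the generalized cosine of the
distance of two points and `√(gram K x y x y)` its generalized sine. Metric statements become
polynomial identities in `quad`, `gram` and the triple product `tri`, above all `gram_lagrange` and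
`gram_lagrange_mixed`, none of which divides by K.

Measures. The area of E is 3 times the volume of the truncated cone over E, and the invariant
measure of a set of geodesics is 3/2 times the volume of its short conormals. Two parametrizations
of the same measure are therefore compared through the volume of one set in ℝ³, by the single change
of variables `volume_cone_image`.

Chord formula. Almost every geodesic meeting D crosses the boundary transversally in exactly two
points c(s), c(t). Let ρ(s,t) be their distance. In these parameters the invariant measure is
∂²ρ/∂s∂t ds dt (`liouville_restrict`, `hasDerivAt_rhoD`). For fixed s, ∂/∂t (f(ρ) ∂ρ/∂s) = f(ρ)
∂²ρ/∂s∂t + f'(ρ) ∂ρ/∂s ∂ρ/∂t, and ∂ρ/∂s passes from −|c'(s)| to |c'(s)| while t runs from s to s +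
T. The left side thus integrates to 2 f(0) |c'(s)| (`integral_add_jac`); integration over s and the
symmetry in (s,t) produce f(0) L. On transversal pairs the first variation formula turns −∂ρ/∂s
∂ρ/∂t into sin_K ρ cot α₁ cot α₂ times the density (`cot_mul_cot`). Crofton's formula is the case f
= 1.

Boundary segments. Two points on a common boundary segment form a pair of density 0, yet ∂ρ/∂s ∂ρ/∂t
is there minus the product of the speeds. Such pairs on a segment of length l contribute the
integral of f'(|a − b|) over half of the square [0,l]², which is the integral of f(x) − f(0) over
[0,l] (`integral_touchingPairs`).

Isoperimetric inequality. Seen from an interior point x, let θ and r be the direction and the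
distance of the boundary points. Since dθ has total 2π and A is the integral of (1 − cos_K r)/K dθ,
the integral of (1 + cos_K r) dθ is 4π − K A (`lintegral_defect`). This is integrated over x in D
and the order of integration is exchanged. For a fixed boundary point c(t), the point x runs along
the chords from c(t), and a chord of length ρ contributes ∫₀^ρ (1 + cos_K r) dr = ρ + sin_K ρ
(`lintegral_chord`). Hence A (4π − K A) is the integral over all (s,t) of ρ + sin_K ρ times the
density. The identity above with f(x) = x replaces ρ times the density by −∂ρ/∂s ∂ρ/∂t, and what
remains is |c'(s)| |c'(t)| cos(α₁ − α₂), at most |c'(s)| |c'(t)|, whose integral is L²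
(`neg_rhoD_mul_add_le`). -/

namespace XK

noncomputable section

/-! ### Trigonometry -/

@[simp] theorem sinK_zero (K : ℝ) : sinK K 0 = 0 := by simp [sinK]
@[simp] theorem cosK_zero (K : ℝ) : cosK K 0 = 1 := by simp [cosK]
@[simp] theorem sinK_neg (K t : ℝ) : sinK K (-t) = -sinK K t := by
  unfold sinK; split_ifs <;> simp [neg_div]
@[simp] theorem cosK_neg (K t : ℝ) : cosK K (-t) = cosK K t := by
  unfold cosK; split_ifs <;> simp

theorem sinK_add (K a b : ℝ) :
    sinK K (a + b) = sinK K a * cosK K b + cosK K a * sinK K b := by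
  unfold sinK cosK
  split_ifs
  · rw [mul_add, Real.sin_add]; ring
  · rw [mul_add, Real.sinh_add]; ring
  · ring

theorem cosK_add (K a b : ℝ) :
    cosK K (a + b) = cosK K a * cosK K b - K * (sinK K a * sinK K b) := by
  unfold sinK cosK
  split_ifs with h1 h2
  · have := Real.mul_self_sqrt h1.le
    have h3 : √K ≠ 0 := (Real.sqrt_pos.2 h1).ne'
    rw [mul_add, Real.cos_add]; field_simp
    linear_combination (-Real.sin (√K * a) * Real.sin (√K * b)) * this
  · have := Real.mul_self_sqrt (show (0 : ℝ) ≤ -K by linarith)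
    have h3 : √(-K) ≠ 0 := (Real.sqrt_pos.2 (by linarith)).ne'
    rw [mul_add, Real.cosh_add]; field_simp
    linear_combination (Real.sinh (√(-K) * a) * Real.sinh (√(-K) * b)) * this
  · have : K = 0 := by linarith
    simp [this]

theorem sinK_sub (K a b : ℝ) :
    sinK K (a - b) = sinK K a * cosK K b - cosK K a * sinK K b := by
  rw [sub_eq_add_neg, sinK_add]; simp; ring

theorem cosK_sub (K a b : ℝ) :
    cosK K (a - b) = cosK K a * cosK K b + K * (sinK K a * sinK K b) := by
  rw [sub_eq_add_neg, cosK_add]; simp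

theorem sinK_pos {K t : ℝ} (ht : 0 < t) (hK : 0 < K → t < Real.pi / √K) : 0 < sinK K t := by
  unfold sinK
  split_ifs with h1 h2
  · have h3 := Real.sqrt_pos.2 h1
    refine div_pos (Real.sin_pos_of_pos_of_lt_pi (by positivity) ?_) h3
    have := (lt_div_iff₀ h3).1 (hK h1)
    linarith
  · have h3 := Real.sqrt_pos.2 (neg_pos.2 h2)
    exact div_pos (Real.sinh_pos_iff.2 (by positivity)) h3
  · exact ht

theorem sinK_pi {K : ℝ} (hK : 0 < K) : sinK K (Real.pi / √K) = 0 := by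
  have h3 := Real.sqrt_pos.2 hK
  simp [sinK, hK, mul_div_cancel₀ _ h3.ne']

theorem cosK_pi {K : ℝ} (hK : 0 < K) : cosK K (Real.pi / √K) = -1 := by
  have h3 := Real.sqrt_pos.2 hK
  simp [cosK, hK, mul_div_cancel₀ _ h3.ne']

theorem continuous_sinK (K : ℝ) : Continuous (sinK K) :=
  continuous_iff_continuousAt.2 fun t => (hasDerivAt_sinK K t).continuousAt

theorem continuous_cosK (K : ℝ) : Continuous (cosK K) :=
  continuous_iff_continuousAt.2 fun t => (hasDerivAt_cosK K t).continuousAt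

/-- The number `ρ ≥ 0` with `cos_K ρ = C` and `sin_K ρ = σ`. -/
def arcK (K C σ : ℝ) : ℝ :=
  if 0 < K then Real.arccos C / √K
  else if K < 0 then Real.arsinh (√(-K) * σ) / √(-K)
  else σ

theorem continuous_arcK (K : ℝ) : Continuous fun z : ℝ × ℝ => arcK K z.1 z.2 := by
  unfold arcK
  split_ifs
  · exact (Real.continuous_arccos.comp continuous_fst).div_const _
  · exact (Real.continuous_arsinh.comp (continuous_snd.const_mul _)).div_const _
  · exact continuous_snd

theorem arcK_nonneg (K C : ℝ) {σ : ℝ} (h : 0 ≤ σ) : 0 ≤ arcK K C σ := by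
  unfold arcK
  split_ifs
  · exact div_nonneg (Real.arccos_nonneg _) (Real.sqrt_nonneg _)
  · exact div_nonneg (Real.arsinh_nonneg_iff.2 (by positivity)) (Real.sqrt_nonneg _)
  · exact h

theorem arcK_le_pi {K : ℝ} (C σ : ℝ) (hK : 0 < K) : arcK K C σ ≤ Real.pi / √K := by
  unfold arcK
  rw [if_pos hK]
  have := Real.arccos_le_pi C
  gcongr

theorem arcK_cosK_sinK {K t : ℝ} (ht : 0 ≤ t) (hK : 0 < K → t ≤ Real.pi / √K) :
    arcK K (cosK K t) (sinK K t) = t := by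
  unfold arcK cosK sinK
  split_ifs with h1 h2
  · have h3 := Real.sqrt_pos.2 h1
    have := (le_div_iff₀ h3).1 (hK h1)
    rw [Real.arccos_cos (by positivity) (by linarith)]
    field_simp
  · have h3 := Real.sqrt_pos.2 (neg_pos.2 h2)
    rw [mul_div_cancel₀ _ h3.ne', Real.arsinh_sinh]
    field_simp
  · rfl

theorem cosK_sinK_arcK {K C σ : ℝ} (h : C ^ 2 + K * σ ^ 2 = 1) (hσ : 0 ≤ σ)
    (hC : K ≤ 0 → 0 < C) : cosK K (arcK K C σ) = C ∧ sinK K (arcK K C σ) = σ := by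
  unfold arcK cosK sinK
  split_ifs with h1 h2
  · have h3 := Real.sqrt_pos.2 h1
    have hc : |C| ≤ 1 := by
      apply abs_le_of_sq_le_sq _ zero_le_one
      nlinarith [mul_nonneg h1.le (sq_nonneg σ)]
    rw [mul_div_cancel₀ _ h3.ne', Real.cos_arccos (abs_le.1 hc).1 (abs_le.1 hc).2, Real.sin_arccos]
    refine ⟨rfl, ?_⟩
    rw [show 1 - C ^ 2 = K * σ ^ 2 by linarith, Real.sqrt_mul h1.le, Real.sqrt_sq hσ]
    field_simp
  · have h3 := Real.sqrt_pos.2 (neg_pos.2 h2)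
    have h4 := Real.sq_sqrt (neg_pos.2 h2).le
    rw [mul_div_cancel₀ _ h3.ne', Real.sinh_arsinh, Real.cosh_arsinh]
    refine ⟨?_, by field_simp⟩
    rw [mul_pow, h4, show 1 + -K * σ ^ 2 = C ^ 2 by linarith, Real.sqrt_sq (hC h2.le).le]
  · have h0 : K = 0 := by linarith
    have := hC h0.le
    refine ⟨?_, rfl⟩
    subst h0
    nlinarith

/-- The distance is differentiated through its cosine and sine together: the angle form `C dσ − σ
dC` is one expression for all K. `hd` is the differentiated constraint `h`. -/
theorem hasDerivAt_arcK {K t C' σ' : ℝ} {C σ : ℝ → ℝ} (hC : HasDerivAt C C' t)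
    (hσ : HasDerivAt σ σ' t) (h : C t ^ 2 + K * σ t ^ 2 = 1) (hpos : 0 < σ t)
    (hC0 : K ≤ 0 → 0 < C t) (hd : C t * C' + K * (σ t * σ') = 0) :
    HasDerivAt (fun s => arcK K (C s) (σ s)) (C t * σ' - σ t * C') t := by
  unfold arcK
  split_ifs with h1 h2
  · have h3 := Real.sqrt_pos.2 h1
    have hlt : C t ^ 2 < 1 := by nlinarith [mul_pos h1 (pow_pos hpos 2)]
    have hne1 : C t ≠ -1 := by rintro h; rw [h] at hlt; norm_num at hlt
    have hne2 : C t ≠ 1 := by rintro h; rw [h] at hlt; norm_num at hlt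
    refine (((Real.hasDerivAt_arccos hne1 hne2).comp t hC).div_const (√K)).congr_deriv ?_
    rw [show 1 - C t ^ 2 = K * σ t ^ 2 by linarith, Real.sqrt_mul h1.le, Real.sqrt_sq hpos.le]
    have h4 := Real.mul_self_sqrt h1.le
    have h5 : -C' = (C t * σ' - σ t * C') * (K * σ t) := by
      linear_combination (-C t) * hd + C' * h
    have h6 : -(1 / (√K * σ t)) * C' / √K = -C' / (K * σ t) := by
      field_simp
      linear_combination C' * h4
    rw [h6, h5]
    field_simp
  · have h3 := Real.sqrt_pos.2 (neg_pos.2 h2)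
    have h4 := Real.sq_sqrt (neg_pos.2 h2).le
    have h0 := hC0 h2.le
    refine (((hσ.const_mul (√(-K))).arsinh).div_const (√(-K))).congr_deriv ?_
    rw [mul_pow, h4, show 1 + -K * σ t ^ 2 = C t ^ 2 by linarith, Real.sqrt_sq h0.le]
    have h5 : σ' = C t * (C t * σ' - σ t * C') := by
      linear_combination (-σ') * h + σ t * hd
    simp only [smul_eq_mul]
    field_simp
    linear_combination h5
  · have h0 : K = 0 := by linarith
    have hc := hC0 h0.le
    subst h0
    have h6 : C t = 1 := by nlinarith
    have h7 : C' = 0 := by simpa [h6] using hd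
    simpa [h6, h7] using hσ

/-! ### Polynomial algebra in `ℝ³` -/

/-- The cross product. -/
def cr (a b : Fin 3 → ℝ) : Fin 3 → ℝ :=
  ![a 1 * b 2 - a 2 * b 1, a 2 * b 0 - a 0 * b 2, a 0 * b 1 - a 1 * b 0]

/-- The pairing of covectors and vectors. -/
def dot (n x : Fin 3 → ℝ) : ℝ := n 0 * x 0 + n 1 * x 1 + n 2 * x 2

/-- The triple product. -/
def tri (a b c : Fin 3 → ℝ) : ℝ :=
  a 0 * (b 1 * c 2 - b 2 * c 1) - a 1 * (b 0 * c 2 - b 2 * c 0) + a 2 * (b 0 * c 1 - b 1 * c 0)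

/-- The quadratic form on covectors which is dual to `quad` (up to the factor `K`). -/
def dual (K : ℝ) (m n : Fin 3 → ℝ) : ℝ := K * (m 0 * n 0) + m 1 * n 1 + m 2 * n 2

/-- The dual form on bivectors. -/
def gram (K : ℝ) (a b c d : Fin 3 → ℝ) : ℝ := dual K (cr a b) (cr c d)

theorem tri_eq_dot (a b z : Fin 3 → ℝ) : tri a b z = dot (cr a b) z := by
  simp [tri, dot, cr]; ring

theorem side_eq {K : ℝ} (q : UnitTangent K) (z : Fin 3 → ℝ) : side q z = tri q.1.1 q.1.2 z := by
  simp [side, tri, Matrix.det_fin_three, UnitTangent.pt, UnitTangent.vec]; ring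

/-- For K ≠ 0 this exhibits `gram` as a Gram determinant divided by K. At K = 0 it is vacuous, which
is why `gram` is built from cross products. -/
theorem K_mul_gram (K : ℝ) (a b c d : Fin 3 → ℝ) :
    K * gram K a b c d = quad K a c * quad K b d - quad K a d * quad K b c := by
  simp [gram, dual, cr, quad]; ring

/-- This is cos² + sin² = 1 for the angle at x between the directions of a and b, as a polynomial
identity. -/
theorem gram_lagrange (K : ℝ) (x a b : Fin 3 → ℝ) :
    gram K x a x b ^ 2 + quad K x x * tri x a b ^ 2 = gram K x a x a * gram K x b x b := by
  simp [gram, dual, cr, quad, tri]; ring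

/-- The left side is the numerator that appears when ∂ρ/∂s is differentiated in t; the right side is
the numerator of the density of the invariant measure. -/
theorem gram_lagrange_mixed (K : ℝ) (x y a b : Fin 3 → ℝ) :
    gram K x a x y * gram K x y x b - gram K x a x b * gram K x y x y =
      quad K x x * (tri x a y * tri x y b) := by
  simp [gram, dual, cr, quad, tri]; ring

/-- At K = 0 tangency forces the zeroth coordinates to vanish, so the division by zero in `metric`
does no harm; `gram` is its polynomial substitute. -/
theorem metric_eq_gram {K : ℝ} {x u v : Fin 3 → ℝ} (hx : IsPoint K x) (hu : quad K x u = 0)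
    (hv : quad K x v = 0) : metric K u v = gram K x u x v := by
  obtain ⟨h1, h2⟩ := hx
  by_cases hK : K = 0
  · subst hK
    have h3 := h2 le_rfl
    simp only [quad, zero_mul, add_zero] at h1 hu hv
    have hu0 : u 0 = 0 := by simpa [h3.ne'] using hu
    have hv0 : v 0 = 0 := by simpa [h3.ne'] using hv
    simp [metric, gram, dual, cr, hu0, hv0]
    linear_combination (-(u 1 * v 1 + u 2 * v 2)) * h1
  · apply mul_left_cancel₀ hK
    rw [K_mul_gram, h1, hv]
    simp only [metric, quad]
    field_simp
    ring

/-- For K < 0 this is the reversed Cauchy–Schwarz inequality on one sheet of a hyperboloid. -/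
theorem quad_pos {K : ℝ} {x y : Fin 3 → ℝ} (hx : IsPoint K x) (hy : IsPoint K y) (hK : K ≤ 0) :
    0 < quad K x y := by
  obtain ⟨h1, h2⟩ := hx
  obtain ⟨h3, h4⟩ := hy
  have hx0 := h2 hK
  have hy0 := h4 hK
  simp only [quad] at *
  have hcs : (K * (x 1 * y 1 + x 2 * y 2)) ^ 2 < (x 0 * y 0) ^ 2 := by
    have e : (K * (x 1 * x 1 + x 2 * x 2)) * (K * (y 1 * y 1 + y 2 * y 2))
        = (1 - x 0 * x 0) * (1 - y 0 * y 0) := by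
      rw [eq_sub_of_add_eq' h1, eq_sub_of_add_eq' h3]
    have hx1 : 1 ≤ x 0 * x 0 := by nlinarith [mul_nonneg (neg_nonneg.2 hK) (add_nonneg (mul_self_nonneg (x 1)) (mul_self_nonneg (x 2)))]
    have hy1 : 1 ≤ y 0 * y 0 := by nlinarith [mul_nonneg (neg_nonneg.2 hK) (add_nonneg (mul_self_nonneg (y 1)) (mul_self_nonneg (y 2)))]
    nlinarith [mul_nonneg (sq_nonneg K) (sq_nonneg (x 1 * y 2 - x 2 * y 1))]
  have := abs_lt.1 (abs_lt_of_sq_lt_sq hcs (by positivity))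
  linarith [this.1]

/-- For K < 0 the dual form is indefinite, but it is positive on the conormals of planes that meet
the model surface. -/
theorem dual_pos {K : ℝ} {x n : Fin 3 → ℝ} (hx : IsPoint K x) (hn : dot n x = 0) (hn0 : n ≠ 0) :
    0 < dual K n n := by
  obtain ⟨h1, h2⟩ := hx
  simp only [quad, dot, dual] at *
  rcases lt_or_ge 0 K with hK | hK
  · by_contra hcon
    have a1 := mul_self_nonneg (n 0); have a2 := mul_self_nonneg (n 1)
    have a3 := mul_self_nonneg (n 2)
    have a4 := mul_nonneg hK.le a1
    have b1 : n 0 * n 0 = 0 := by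
      have : K * (n 0 * n 0) = 0 := by linarith
      simpa [hK.ne'] using this
    apply hn0
    ext i
    fin_cases i
    · simpa using b1
    · have : n 1 * n 1 = 0 := by linarith
      simpa using this
    · have : n 2 * n 2 = 0 := by linarith
      simpa using this
  · have hx0 := h2 hK
    -- After multiplication by x₀² the relations `hn` and `h1` eliminate n₀; for K ≤ 0 every term on
    -- the right is nonnegative.
    have key : x 0 ^ 2 * (K * (n 0 * n 0) + n 1 * n 1 + n 2 * n 2)
        = n 1 ^ 2 + n 2 ^ 2 - K * (n 1 * x 2 - n 2 * x 1) ^ 2 := by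
      linear_combination K * (n 0 * x 0 - (n 1 * x 1 + n 2 * x 2)) * hn
        + (n 1 ^ 2 + n 2 ^ 2) * h1
    have h5 : 0 < n 1 ^ 2 + n 2 ^ 2 := by
      by_contra hcon
      have c1 : n 1 = 0 := by nlinarith [sq_nonneg (n 1), sq_nonneg (n 2)]
      have c2 : n 2 = 0 := by nlinarith [sq_nonneg (n 1), sq_nonneg (n 2)]
      have c0 : n 0 = 0 := by simpa [c1, c2, hx0.ne'] using hn
      apply hn0
      ext i
      fin_cases i <;> assumption
    have h6 := mul_nonneg (neg_nonneg.2 hK) (sq_nonneg (n 1 * x 2 - n 2 * x 1))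
    have h7 : 0 < x 0 ^ 2 * (K * (n 0 * n 0) + n 1 * n 1 + n 2 * n 2) := by rw [key]; linarith
    exact pos_of_mul_pos_right h7 (by positivity)

theorem gram_pos {K : ℝ} {x z : Fin 3 → ℝ} (hx : IsPoint K x) (h : cr x z ≠ 0) :
    0 < gram K x z x z :=
  dual_pos hx (by simp [dot, cr]; ring) h

theorem gram_nonneg {K : ℝ} {x : Fin 3 → ℝ} (hx : IsPoint K x) (z : Fin 3 → ℝ) :
    0 ≤ gram K x z x z := by
  by_cases h : cr x z = 0
  · simp [gram, h, dual]
  · exact (gram_pos hx h).le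

theorem quad_sq_add {K : ℝ} {x y : Fin 3 → ℝ} (hx : IsPoint K x) (hy : IsPoint K y) :
    quad K x y ^ 2 + K * √(gram K x y x y) ^ 2 = 1 := by
  rw [Real.sq_sqrt (gram_nonneg hx y), K_mul_gram, hx.1, hy.1]
  simp [quad]; ring

theorem metric_pos {K : ℝ} {x u : Fin 3 → ℝ} (hx : IsPoint K x) (hu : quad K x u = 0)
    (h : u ≠ 0) : 0 < metric K u u := by
  rw [metric_eq_gram hx hu hu]
  apply gram_pos hx
  intro h0
  apply h
  have h1 := congrFun h0 0
  have h2 := congrFun h0 1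
  have h3 := congrFun h0 2
  simp [cr] at h1 h2 h3
  have e := hx.1
  simp only [quad] at e hu
  ext i
  fin_cases i
  · simp; linear_combination (-u 0) * e + x 0 * hu - K * x 1 * h3 + K * x 2 * h2
  · simp; linear_combination (-u 1) * e + x 1 * hu + x 0 * h3 - K * x 2 * h1
  · simp; linear_combination (-u 2) * e + x 2 * hu - x 0 * h2 + K * x 1 * h1

/-- The distance of two points, computed from the embedding. -/
def dst (K : ℝ) (x y : Fin 3 → ℝ) : ℝ := arcK K (quad K x y) √(gram K x y x y)

theorem quad_comm (K : ℝ) (x y : Fin 3 → ℝ) : quad K x y = quad K y x := by simp [quad]; ring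

theorem gram_swap (K : ℝ) (x y : Fin 3 → ℝ) : gram K x y x y = gram K y x y x := by
  simp [gram, dual, cr]; ring

theorem dst_comm (K : ℝ) (x y : Fin 3 → ℝ) : dst K x y = dst K y x := by
  rw [dst, dst, quad_comm, gram_swap]

/-! ### Algebra along geodesics -/

theorem quad_comb (K a b c d : ℝ) (p u p' u' : Fin 3 → ℝ) :
    quad K (a • p + b • u) (c • p' + d • u') =
      a * c * quad K p p' + a * d * quad K p u' + b * c * quad K u p' + b * d * quad K u u' := by
  simp [quad]; ring

theorem cr_comb (a b c d : ℝ) (p u : Fin 3 → ℝ) :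
    cr (a • p + b • u) (c • p + d • u) = (a * d - b * c) • cr p u := by
  ext i; fin_cases i <;> simp [cr] <;> ring

theorem dot_comb (a b : ℝ) (n p u : Fin 3 → ℝ) :
    dot n (a • p + b • u) = a * dot n p + b * dot n u := by
  simp [dot]; ring

theorem dual_smul_smul (K a b : ℝ) (m n : Fin 3 → ℝ) :
    dual K (a • m) (b • n) = a * b * dual K m n := by
  simp [dual]; ring

theorem dot_smul (r : ℝ) (n z : Fin 3 → ℝ) : dot (r • n) z = r * dot n z := by
  simp [dot]; ring

theorem dot_smul_right (r : ℝ) (n z : Fin 3 → ℝ) : dot n (r • z) = r * dot n z := by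
  simp [dot]; ring

theorem quad_smul_smul (K a b : ℝ) (m n : Fin 3 → ℝ) :
    quad K (a • m) (b • n) = a * b * quad K m n := by
  simp [quad]; ring

theorem _root_.Continuous.quad {X : Type*} [TopologicalSpace X] {K : ℝ} {f g : X → Fin 3 → ℝ}
    (hf : Continuous f) (hg : Continuous g) : Continuous fun x => quad K (f x) (g x) := by
  unfold XK.quad; fun_prop

theorem _root_.Continuous.dot {X : Type*} [TopologicalSpace X] {f g : X → Fin 3 → ℝ}
    (hf : Continuous f) (hg : Continuous g) : Continuous fun x => dot (f x) (g x) := by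
  unfold XK.dot; fun_prop

theorem _root_.Continuous.tri {X : Type*} [TopologicalSpace X] {f g h : X → Fin 3 → ℝ}
    (hf : Continuous f) (hg : Continuous g) (hh : Continuous h) :
    Continuous fun x => tri (f x) (g x) (h x) := by
  unfold XK.tri; fun_prop

theorem _root_.Continuous.cr {X : Type*} [TopologicalSpace X] {f g : X → Fin 3 → ℝ}
    (hf : Continuous f) (hg : Continuous g) : Continuous fun x => cr (f x) (g x) := by
  refine continuous_pi fun i => ?_
  fin_cases i <;> simp [XK.cr] <;> fun_prop

theorem _root_.Continuous.dual {X : Type*} [TopologicalSpace X] {K : ℝ} {f g : X → Fin 3 → ℝ}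
    (hf : Continuous f) (hg : Continuous g) : Continuous fun x => dual K (f x) (g x) := by
  unfold XK.dual; fun_prop

theorem _root_.Continuous.gram {X : Type*} [TopologicalSpace X] {K : ℝ} {a b c d : X → Fin 3 → ℝ}
    (ha : Continuous a) (hb : Continuous b) (hc : Continuous c) (hd : Continuous d) :
    Continuous fun x => gram K (a x) (b x) (c x) (d x) :=
  (ha.cr hb).dual (hc.cr hd)

theorem gram_self_eq_one {K : ℝ} (q : UnitTangent K) : gram K q.1.1 q.1.2 q.1.1 q.1.2 = 1 := by
  rw [← metric_eq_gram q.2.1 q.2.2.1 q.2.2.1]; exact q.2.2.2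

theorem normal_ne_zero {K : ℝ} (q : UnitTangent K) : cr q.1.1 q.1.2 ≠ 0 := by
  intro h
  have := gram_self_eq_one q
  simp [gram, h, dual] at this

@[simp] theorem geo_zero {K : ℝ} (q : UnitTangent K) : geo q 0 = q.pt := by
  apply Subtype.ext; simp [geo, UnitTangent.pt]

theorem quad_geo_geo {K : ℝ} (q : UnitTangent K) (a b : ℝ) :
    quad K (geo q a).1 (geo q b).1 = cosK K (b - a) := by
  simp only [geo, quad_comb, q.2.1.1, q.2.2.1, quad_self q, quad_comm K q.1.2 q.1.1, cosK_sub]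
  ring

theorem cr_geo_geo {K : ℝ} (q : UnitTangent K) (a b : ℝ) :
    cr (geo q a).1 (geo q b).1 = sinK K (b - a) • cr q.1.1 q.1.2 := by
  simp only [geo, cr_comb, sinK_sub]
  congr 1; ring

theorem cr_geo_vel {K : ℝ} (q : UnitTangent K) (a : ℝ) :
    cr (geo q a).1 (geoVel q a) = cr q.1.1 q.1.2 := by
  simp only [geo, geoVel, cr_comb]
  rw [show cosK K a * cosK K a - sinK K a * (-K * sinK K a) = 1 by
    linear_combination cosK_sq_add K a, one_smul]

theorem gram_geo_geo {K : ℝ} (q : UnitTangent K) (a b : ℝ) :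
    gram K (geo q a).1 (geo q b).1 (geo q a).1 (geo q b).1 = sinK K (b - a) ^ 2 := by
  have := gram_self_eq_one q
  rw [gram] at this ⊢
  rw [cr_geo_geo, dual_smul_smul, this]; ring

theorem dst_geo_geo {K : ℝ} (q : UnitTangent K) {a b : ℝ} (hab : a ≤ b)
    (hK : 0 < K → b - a ≤ Real.pi / √K) : dst K (geo q a).1 (geo q b).1 = b - a := by
  have h0 : 0 ≤ b - a := by linarith
  have hs : 0 ≤ sinK K (b - a) := by
    rcases h0.eq_or_lt with h | h
    · simp [← h]
    · by_cases h1 : 0 < K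
      · rcases (hK h1).eq_or_lt with h2 | h2
        · rw [h2, sinK_pi h1]
        · exact (sinK_pos h fun _ => h2).le
      · exact (sinK_pos h fun h2 => absurd h2 h1).le
  rw [dst, quad_geo_geo, gram_geo_geo, Real.sqrt_sq hs, arcK_cosK_sinK h0 hK]

/-- The geodesic flow. -/
def UnitTangent.flow {K : ℝ} (q : UnitTangent K) (t : ℝ) : UnitTangent K :=
  ⟨((geo q t).1, geoVel q t), (geo q t).2, by
    have h1 := q.2.1.1
    have h2 := q.2.2.1
    have h3 := quad_self q
    simp only [geo, geoVel, quad_comb, h1, h2, h3, quad_comm K q.1.2 q.1.1]; ring, by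
    have h0 : quad K (geo q t).1 (geoVel q t) = 0 := by
      have h1 := q.2.1.1
      have h2 := q.2.2.1
      have h3 := quad_self q
      simp only [geo, geoVel, quad_comb, h1, h2, h3, quad_comm K q.1.2 q.1.1]; ring
    show metric K (geoVel q t) (geoVel q t) = 1
    rw [metric_eq_gram (geo q t).2 h0 h0, gram, cr_geo_vel]
    exact gram_self_eq_one q⟩

theorem geo_flow {K : ℝ} (q : UnitTangent K) (t s : ℝ) : geo (q.flow t) s = geo q (t + s) := by
  apply Subtype.ext
  ext i
  simp [geo, geoVel, UnitTangent.flow, cosK_add, sinK_add]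
  ring

theorem toGeodesic_flow {K : ℝ} (q : UnitTangent K) (t : ℝ) :
    toGeodesic (q.flow t) = toGeodesic q := by
  apply Subtype.ext
  ext x
  constructor
  · rintro ⟨s, rfl⟩; exact ⟨t + s, (geo_flow q t s).symm⟩
  · rintro ⟨s, rfl⟩; exact ⟨s - t, by rw [geo_flow]; congr 1; ring⟩

theorem geo_inj {K : ℝ} (q : UnitTangent K) {a b : ℝ} (hK : 0 < K → |b - a| < Real.pi / √K)
    (h : geo q a = geo q b) : a = b := by
  wlog hab : a ≤ b generalizing a b
  · exact (this (fun h => by rw [abs_sub_comm]; exact hK h) h.symm (le_of_not_ge hab)).symm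
  by_contra hne
  have hlt : 0 < b - a := sub_pos.2 (lt_of_le_of_ne hab hne)
  have h1 := cr_geo_geo q a b
  rw [h] at h1
  have h2 := sinK_pos hlt fun h => by simpa [abs_of_pos hlt] using hK h
  have h3 : cr (geo q b).1 (geo q b).1 = 0 := by
    ext i; fin_cases i <;> simp [cr] <;> ring
  rw [h3] at h1
  exact (smul_ne_zero h2.ne' (normal_ne_zero q)) h1.symm

/-- Intermediate points are positive combinations. -/
theorem geo_between {K : ℝ} (q : UnitTangent K) (a m b : ℝ) :
    sinK K (b - a) • (geo q m).1 = sinK K (b - m) • (geo q a).1 + sinK K (m - a) • (geo q b).1 := by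
  have h1 := cosK_sq_add K a
  have h2 := cosK_sq_add K b
  have h3 := cosK_sq_add K m
  ext i
  simp only [geo, sinK_sub, Pi.add_apply, Pi.smul_apply, smul_eq_mul]
  ring

theorem tri_geo {K : ℝ} (q : UnitTangent K) (t : ℝ) : tri q.1.1 q.1.2 (geo q t).1 = 0 := by
  simp [tri, geo]; ring

theorem exists_geo_eq {K : ℝ} (q : UnitTangent K) {x : Space K} (h : tri q.1.1 q.1.2 x.1 = 0) :
    ∃ t, geo q t = x ∧ (0 < K → |t| ≤ Real.pi / √K) := by
  have hn := gram_self_eq_one q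
  set p := q.1.1
  set u := q.1.2
  -- `e` is the conormal turned into a vector. Its triple product with `p` and `u` is the dual
  -- square of the conormal, hence 1, and Cramer's rule expands `x` in the basis `p`, `u`, `e` with
  -- vanishing third coefficient.
  set e : Fin 3 → ℝ := ![K * cr p u 0, cr p u 1, cr p u 2] with he
  have hx : x.1 = tri x.1 u e • p + tri p x.1 e • u := by
    have h1 : tri p u e = 1 := by
      rw [← hn]; simp [tri, he, gram, dual, cr]; ring
    have key : tri p u e • x.1 = tri x.1 u e • p + tri p x.1 e • u + tri p u x.1 • e := by
      ext i
      fin_cases i <;> simp [tri] <;> ring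
    rw [h1, h] at key
    simpa using key
  set α := tri x.1 u e
  set β := tri p x.1 e
  have hq : α ^ 2 + K * β ^ 2 = 1 := by
    have := x.2.1
    rw [hx, quad_comb, q.2.1.1, q.2.2.1, quad_self q, quad_comm K q.1.2 q.1.1, q.2.2.1] at this
    linarith
  have hα : K ≤ 0 → 0 < α := by
    intro hK
    have h1 := quad_pos q.2.1 x.2 hK
    rw [hx, show quad K q.1.1 (α • p + β • u) = α * quad K q.1.1 q.1.1 + β * quad K q.1.1 q.1.2 by
      simp [quad, p, u]; ring, q.2.1.1, q.2.2.1] at h1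
    simpa using h1
  rcases le_total 0 β with hβ | hβ
  · obtain ⟨h1, h2⟩ := cosK_sinK_arcK hq hβ hα
    refine ⟨arcK K α β, Subtype.ext ?_, fun h => ?_⟩
    · rw [hx]; simp only [geo, h1, h2]; rfl
    · rw [abs_of_nonneg (arcK_nonneg _ _ hβ)]; exact arcK_le_pi _ _ h
  · have hβ' : 0 ≤ -β := by linarith
    obtain ⟨h1, h2⟩ := cosK_sinK_arcK (by rw [neg_sq]; exact hq) hβ' hα
    refine ⟨-arcK K α (-β), Subtype.ext ?_, fun h => ?_⟩
    · rw [hx]; simp only [geo, cosK_neg, sinK_neg, h1, h2, neg_neg]; rfl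
    · rw [abs_neg, abs_of_nonneg (arcK_nonneg _ _ hβ')]; exact arcK_le_pi _ _ h

theorem mem_line_iff {K : ℝ} (q : UnitTangent K) (x : Space K) :
    x ∈ line q ↔ tri q.1.1 q.1.2 x.1 = 0 := by
  constructor
  · rintro ⟨t, rfl⟩; exact tri_geo q t
  · intro h
    obtain ⟨t, ht, -⟩ := exists_geo_eq q h
    exact ⟨t, ht⟩

theorem le_sinK {K l : ℝ} (hK : K ≤ 0) (hl : 0 ≤ l) : l ≤ sinK K l := by
  unfold sinK
  rw [if_neg (not_lt.2 hK)]
  split_ifs with h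
  · have h3 := Real.sqrt_pos.2 (neg_pos.2 h)
    rw [le_div_iff₀ h3, mul_comm]
    exact Real.self_le_sinh_iff.2 (by positivity)
  · exact le_rfl

theorem continuous_geo {K : ℝ} (q : UnitTangent K) : Continuous (geo q) := by
  refine Continuous.subtype_mk ?_ _
  exact ((continuous_cosK K).smul continuous_const).add ((continuous_sinK K).smul continuous_const)

/-! ### Geodesic convexity -/

/-- The form in which convexity is used. For K > 0 the reversed velocity reaches the same point at
time π/√K, so uniqueness of the minimizing geodesic excludes that length, and with it antipodal
pairs in D. -/
theorem exists_segment {K : ℝ} {D : Set (Space K)} (hconv : GeodConvex D) {x y : Space K}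
    (hx : x ∈ D) (hy : y ∈ D) (hxy : x ≠ y) :
    ∃ (q : UnitTangent K) (d : ℝ), 0 < d ∧ (0 < K → d < Real.pi / √K) ∧ q.pt = x ∧
      geo q d = y ∧ ∀ s ∈ Icc 0 d, geo q s ∈ D := by
  obtain ⟨q, ⟨h1, h2⟩, h3, h4⟩ := hconv x hx y hy hxy
  have hbdd : BddBelow {t : ℝ | 0 ≤ t ∧ ∃ q : UnitTangent K, q.pt = x ∧ geo q t = y} :=
    ⟨0, fun t ht => ht.1⟩
  have hd0 : 0 ≤ gdist x y := Real.sInf_nonneg fun t ht => ht.1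
  set d := gdist x y with hd
  let q' : UnitTangent K := ⟨(q.1.1, -q.1.2), q.2.1, by
    have := q.2.2.1; simp [quad] at this ⊢; linarith, by
    have := q.2.2.2; simpa [metric] using this⟩
  have hpos : 0 < d := by
    refine lt_of_le_of_ne hd0 fun h => hxy ?_
    rw [← h, geo_zero, h1] at h2
    exact h2
  refine ⟨q, d, hpos, fun hK => ?_, h1, h2, h4⟩
  have hle : d ≤ Real.pi / √K := by
    have hc := cosK_sq_add K d
    rcases le_total 0 (sinK K d) with hs | hs
    · obtain ⟨e1, e2⟩ := cosK_sinK_arcK hc hs fun h => absurd hK (not_lt.2 h)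
      refine (csInf_le hbdd ⟨arcK_nonneg K (cosK K d) hs, q, h1, ?_⟩).trans (arcK_le_pi _ _ hK)
      rw [← h2]; apply Subtype.ext; simp [geo, e1, e2]
    -- When the sine of d is negative, the geodesic run backwards arrives at y within π/√K.
    · have hs' : 0 ≤ -sinK K d := by linarith
      obtain ⟨e1, e2⟩ := cosK_sinK_arcK (C := cosK K d) (by rw [neg_sq]; exact hc) hs'
        fun h => absurd hK (not_lt.2 h)
      refine (csInf_le hbdd ⟨arcK_nonneg K (cosK K d) hs', q', h1, ?_⟩).trans (arcK_le_pi _ _ hK)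
      rw [← h2]; apply Subtype.ext; simp [geo, e1, e2, q']
  refine lt_of_le_of_ne hle fun h => ?_
  have h5 : q' = q := h3 q' h1 (by
    rw [← h2]; apply Subtype.ext; simp [geo, q', h, sinK_pi hK])
  have h6 : q.1.2 = 0 := by
    have h7 : -q.1.2 = q.1.2 := congrArg (fun r : UnitTangent K => r.1.2) h5
    ext i
    have := congrFun h7 i
    simp at this ⊢
    linarith
  have := q.2.2.2
  simp [metric, h6] at this

theorem gram_pos_of_ne {K : ℝ} {D : Set (Space K)} (hconv : GeodConvex D) {x y : Space K}
    (hx : x ∈ D) (hy : y ∈ D) (hxy : x ≠ y) : 0 < gram K x.1 y.1 x.1 y.1 := by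
  obtain ⟨q, d, h1, h2, h3, h4, -⟩ := exists_segment hconv hx hy hxy
  rw [← h3, ← geo_zero, ← h4, gram_geo_geo, sub_zero]
  exact pow_pos (sinK_pos h1 h2) 2

theorem quad_gt_neg_one {K : ℝ} {D : Set (Space K)} (hconv : GeodConvex D) {x y : Space K}
    (hx : x ∈ D) (hy : y ∈ D) : -1 < quad K x.1 y.1 := by
  by_cases hxy : x = y
  · rw [hxy, y.2.1]; norm_num
  rcases lt_or_ge 0 K with hK | hK
  · have h1 := quad_sq_add x.2 y.2
    have h2 := Real.sqrt_pos.2 (gram_pos_of_ne hconv hx hy hxy)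
    have : quad K x.1 y.1 ^ 2 < 1 := by nlinarith [mul_pos hK (pow_pos h2 2)]
    nlinarith
  · linarith [quad_pos x.2 y.2 hK]

/-- The passage from geodesic segments to nonnegative linear combinations, on which the linear
convexity of the cone over D rests. -/
theorem comb_mem {K : ℝ} {D : Set (Space K)} (hconv : GeodConvex D) {x y z : Space K}
    (hx : x ∈ D) (hy : y ∈ D) {α β : ℝ} (hα : 0 ≤ α) (hβ : 0 ≤ β)
    (hz : z.1 = α • x.1 + β • y.1) : z ∈ D := by
  by_cases hxy : x = y
  · subst hxy
    have h1 : z.1 = (α + β) • x.1 := by rw [hz, add_smul]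
    have h2 := z.2.1
    rw [h1, quad_smul_smul, x.2.1] at h2
    have h3 : α + β = 1 := by nlinarith
    rw [h3, one_smul] at h1
    rwa [Subtype.ext h1]
  obtain ⟨q, d, hd, hdK, h3, h4, h5⟩ := exists_segment hconv hx hy hxy
  have hs := sinK_pos hd hdK
  have hxq : x.1 = q.1.1 := by rw [← h3]; rfl
  have hz' : z.1 = (α + β * cosK K d) • q.1.1 + (β * sinK K d) • q.1.2 := by
    rw [hz, hxq, ← h4]; simp [geo]; module
  have hq : (α + β * cosK K d) ^ 2 + K * (β * sinK K d) ^ 2 = 1 := by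
    have := z.2.1
    rw [hz', quad_comb, q.2.1.1, q.2.2.1, quad_self q, quad_comm K q.1.2 q.1.1, q.2.2.1] at this
    linarith
  have hC : K ≤ 0 → 0 < α + β * cosK K d := by
    intro hK
    have h1 := quad_pos q.2.1 z.2 hK
    rw [hz', show ∀ a b : ℝ, quad K q.1.1 (a • q.1.1 + b • q.1.2) =
      a * quad K q.1.1 q.1.1 + b * quad K q.1.1 q.1.2 by intro a b; simp [quad]; ring,
      q.2.1.1, q.2.2.1] at h1
    simpa using h1
  have hσ : 0 ≤ β * sinK K d := by positivity
  obtain ⟨e1, e2⟩ := cosK_sinK_arcK hq hσ hC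
  set m := arcK K (α + β * cosK K d) (β * sinK K d)
  have hm0 : 0 ≤ m := arcK_nonneg _ _ hσ
  -- If m > d, then sin_K(m − d) would be positive, but it equals −α sin_K d.
  have hmd : m ≤ d := by
    by_contra hcon
    have h6 : 0 < sinK K (m - d) := sinK_pos (by linarith) fun hK => by
      have : m ≤ Real.pi / √K := arcK_le_pi _ _ hK
      linarith
    rw [sinK_sub, e1, e2] at h6
    nlinarith
  have : z = geo q m := by
    apply Subtype.ext
    rw [hz']; simp [geo, e1, e2]
  rw [this]
  exact h5 m ⟨hm0, hmd⟩

theorem geo_mem_of_between {K : ℝ} {D : Set (Space K)} (hconv : GeodConvex D)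
    (q : UnitTangent K) {a b m : ℝ} (ha : geo q a ∈ D) (hb : geo q b ∈ D)
    (hK : 0 < K → b - a < Real.pi / √K) (hm : m ∈ Icc a b) : geo q m ∈ D := by
  rcases (hm.1.trans hm.2).eq_or_lt with h | h
  · have : m = a := le_antisymm (hm.2.trans h.ge) hm.1
    rwa [this]
  have hs : 0 < sinK K (b - a) := sinK_pos (by linarith) hK
  have h1 : 0 ≤ sinK K (b - m) := by
    rcases hm.2.eq_or_lt with h | h
    · simp [h]
    · exact (sinK_pos (by linarith) fun h => by have := hK h; linarith [hm.1]).le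
  have h2 : 0 ≤ sinK K (m - a) := by
    rcases hm.1.eq_or_lt with h | h
    · simp [h]
    · exact (sinK_pos (by linarith) fun h => by have := hK h; linarith [hm.2]).le
  refine comb_mem hconv ha hb (div_nonneg h1 hs.le) (div_nonneg h2 hs.le) ?_
  have := geo_between q a m b
  rw [div_eq_inv_mul, div_eq_inv_mul, mul_smul, mul_smul, ← smul_add, ← this, smul_smul,
    inv_mul_cancel₀ hs.ne', one_smul]

/-! ### Chords of a convex set -/

theorem not_antipodal {K : ℝ} {D : Set (Space K)} (hconv : GeodConvex D) {x y : Space K}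
    (hx : x ∈ D) (hy : y ∈ D) (h : y.1 = -x.1) : False := by
  have h1 := quad_gt_neg_one hconv hx hy
  rw [h] at h1
  have := x.2.1
  simp [quad] at h1 this
  linarith

theorem geo_add_pi {K : ℝ} (hK : 0 < K) (q : UnitTangent K) (a : ℝ) :
    (geo q (a + Real.pi / √K)).1 = -(geo q a).1 := by
  simp [geo, cosK_add, sinK_add, sinK_pi hK, cosK_pi hK]
  abel

/-- Inside a suitable window, the parameters at which the geodesic is in D form a compact set.
Convexity makes this set an interval, and its extreme elements are the ends of the chord. -/
theorem exists_isChord {K : ℝ} {D : Set (Space K)} (hD : IsCompact D) (hconv : GeodConvex D)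
    {g : Geodesic K} (hg : g ∈ hitting D) : ∃ ch, IsChord D g ch := by
  obtain ⟨⟨-, q0, rfl⟩, x0, ⟨t0, rfl⟩, hx0⟩ : ∃ g' : Geodesic K, ∃ x, x ∈ g'.1 ∧ x ∈ D ∧ g' = g := by
    obtain ⟨x, h1, h2⟩ := hg; exact ⟨g, x, h1, h2, rfl⟩
  obtain ⟨hx0, rfl⟩ := hx0
  set q := q0.flow t0 with hq
  have hq0 : geo q 0 ∈ D := by rw [geo_zero]; exact hx0
  have hline : toGeodesic q = toGeodesic q0 := toGeodesic_flow q0 t0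
  -- For K > 0 the window |l| ≤ π/√K covers the whole great circle; for K ≤ 0 compactness of D
  -- bounds `sinK K l`, which dominates |l|.
  have hbound : ∃ B : ℝ, 0 ≤ B ∧ (0 < K → B = Real.pi / √K) ∧
      ∀ p ∈ line q, p ∈ D → ∃ l, |l| ≤ B ∧ geo q l = p := by
    rcases lt_or_ge 0 K with hK | hK
    · refine ⟨Real.pi / √K, by positivity, fun _ => rfl, fun p hp _ => ?_⟩
      obtain ⟨t, h1, h2⟩ := exists_geo_eq q ((mem_line_iff q p).1 hp)
      exact ⟨t, h2 hK, h1⟩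
    · have hcont : Continuous fun p : Space K => gram K q.1.1 p.1 q.1.1 p.1 := by
        exact continuous_const.gram continuous_subtype_val continuous_const continuous_subtype_val
      obtain ⟨B, hB⟩ := (hD.image hcont).bddAbove
      refine ⟨max B 1, by positivity, fun h => absurd h (not_lt.2 hK), ?_⟩
      rintro p ⟨l, rfl⟩ hp
      refine ⟨l, ?_, rfl⟩
      have h1 := hB ⟨_, hp, rfl⟩
      have h2 := gram_geo_geo q 0 l
      have h0 : (geo q 0).1 = q.1.1 := by rw [geo_zero]; rfl
      rw [h0, sub_zero] at h2
      simp only [h2] at h1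
      have h3 : |l| ≤ |sinK K l| := by
        rcases le_total 0 l with hl | hl
        · rw [abs_of_nonneg hl]; exact (le_sinK hK hl).trans (le_abs_self _)
        · rw [abs_of_nonpos hl, ← abs_neg, ← sinK_neg]
          exact (le_sinK hK (by linarith)).trans (le_abs_self _)
      have h4 : 1 ≤ max B 1 := le_max_right _ _
      have h5 : B ≤ max B 1 := le_max_left _ _
      have h6 : |sinK K l| ^ 2 ≤ (max B 1) ^ 2 := by rw [sq_abs]; nlinarith
      exact h3.trans (abs_le_of_sq_le_sq (by simpa using h6) (by positivity) |> fun h => by simpa using h)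
  obtain ⟨B, hB0, hBK, hB⟩ := hbound
  set A : Set ℝ := Icc (-B) B ∩ geo q ⁻¹' D with hA
  have hAc : IsCompact A := isCompact_Icc.inter_right (hD.isClosed.preimage (continuous_geo q))
  have h0A : (0 : ℝ) ∈ A := ⟨⟨by linarith, hB0⟩, hq0⟩
  have hsegm : ∀ a ∈ A, ∀ b ∈ A, ∀ m ∈ Icc a b, m ∈ A := by
    intro a ha b hb m hm
    refine ⟨⟨ha.1.1.trans hm.1, hm.2.trans hb.1.2⟩, ?_⟩
    by_cases hs : 0 < K → b - a < Real.pi / √K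
    · exact geo_mem_of_between hconv q ha.2 hb.2 hs hm
    push Not at hs
    obtain ⟨hK, hs⟩ := hs
    have hpi : 0 < Real.pi / √K := div_pos Real.pi_pos (Real.sqrt_pos.2 hK)
    -- Parameters at least π/√K apart cannot be joined directly, so the segment is split at 0. The
    -- ends ±π/√K of the window are excluded, being antipodal to the point at 0.
    have hane : -B < a := by
      refine lt_of_le_of_ne ha.1.1 fun h => ?_
      refine not_antipodal hconv ha.2 hq0 ?_
      have := geo_add_pi hK q a
      rwa [← h, hBK hK, neg_add_cancel, ← hBK hK, h] at this
    have hbne : b < B := by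
      refine lt_of_le_of_ne hb.1.2 fun h => ?_
      refine not_antipodal hconv hq0 hb.2 ?_
      have := geo_add_pi hK q 0
      rwa [zero_add, ← hBK hK, ← h] at this
    rw [hBK hK] at hane hbne
    rcases le_total m 0 with h | h
    · exact geo_mem_of_between hconv q ha.2 hq0 (fun _ => by linarith) ⟨hm.1, h⟩
    · exact geo_mem_of_between hconv q hq0 hb.2 (fun _ => by linarith) ⟨h, hm.2⟩
  have ha := hAc.sInf_mem ⟨0, h0A⟩
  have hb := hAc.sSup_mem ⟨0, h0A⟩
  set a := sInf A
  set b := sSup A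
  have hab : a ≤ b := (csInf_le hAc.bddBelow h0A).trans (le_csSup hAc.bddAbove h0A)
  refine ⟨(q.flow a, b - a), ?_, by simpa using hab, ?_⟩
  · rw [toGeodesic_flow, hline]; rfl
  · rw [show (⟨line q0, q0, rfl⟩ : Geodesic K) = toGeodesic q0 from rfl, ← hline]
    ext p
    constructor
    · rintro ⟨h1, h2⟩
      obtain ⟨l, hl, rfl⟩ := hB p h1 h2
      have hlA : l ∈ A := ⟨abs_le.1 hl, h2⟩
      refine ⟨l - a, ⟨?_, ?_⟩, ?_⟩
      · linarith [csInf_le hAc.bddBelow hlA]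
      · show l - a ≤ b - a
        linarith [le_csSup hAc.bddAbove hlA]
      · rw [geo_flow]; congr 1; ring
    · rintro ⟨l, ⟨h1, h2⟩, rfl⟩
      dsimp only at h1 h2 ⊢
      rw [geo_flow]
      exact ⟨⟨_, rfl⟩, (hsegm a ha b hb (a + l) ⟨by linarith, by linarith⟩).2⟩

theorem chord_spec {K : ℝ} {D : Set (Space K)} (hD : IsCompact D) (hconv : GeodConvex D)
    {g : Geodesic K} (hg : g ∈ hitting D) : IsChord D g (chord D g) :=
  Classical.epsilon_spec (exists_isChord hD hconv hg)

theorem IsChord.geo_mem {K : ℝ} {D : Set (Space K)} {g : Geodesic K} {ch : UnitTangent K × ℝ}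
    (h : IsChord D g ch) {s : ℝ} (hs : s ∈ Icc 0 ch.2) : geo ch.1 s ∈ D ∧ geo ch.1 s ∈ g.1 := by
  have : geo ch.1 s ∈ g.1 ∩ D := by rw [h.2.2]; exact ⟨s, hs, rfl⟩
  exact ⟨this.2, this.1⟩

theorem IsChord.lt_pi {K : ℝ} {D : Set (Space K)} (hconv : GeodConvex D) {g : Geodesic K}
    {ch : UnitTangent K × ℝ} (h : IsChord D g ch) (hK : 0 < K) : ch.2 < Real.pi / √K := by
  by_contra hcon
  push Not at hcon
  have hpi : 0 < Real.pi / √K := div_pos Real.pi_pos (Real.sqrt_pos.2 hK)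
  refine not_antipodal hconv (h.geo_mem ⟨le_rfl, h.2.1⟩).1
    (h.geo_mem (s := 0 + Real.pi / √K) ⟨by linarith, by linarith⟩).1 (geo_add_pi hK _ _)

/-- Keeping `ch.2 + δ` below π/√K prevents a point just beyond one end from being a chord point
reached around the great circle. -/
theorem IsChord.exists_outside {K : ℝ} {D : Set (Space K)} (hconv : GeodConvex D) {g : Geodesic K}
    {ch : UnitTangent K × ℝ} (h : IsChord D g ch) :
    ∃ δ > 0, ∀ s ∈ Ioo 0 δ, geo ch.1 (-s) ∉ D ∧ geo ch.1 (ch.2 + s) ∉ D := by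
  obtain ⟨δ, hδ, hδK⟩ : ∃ δ > 0, 0 < K → ch.2 + δ < Real.pi / √K := by
    by_cases hK : 0 < K
    · have := h.lt_pi hconv hK
      exact ⟨(Real.pi / √K - ch.2) / 2, by linarith, fun _ => by linarith⟩
    · exact ⟨1, one_pos, fun h => absurd h hK⟩
  have h0 := h.2.1
  have key : ∀ t, geo ch.1 t ∈ D → ∃ s ∈ Icc 0 ch.2, geo ch.1 s = geo ch.1 t := by
    intro t ht
    have : geo ch.1 t ∈ g.1 ∩ D := ⟨by rw [← h.1]; exact ⟨t, rfl⟩, ht⟩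
    rw [h.2.2] at this
    obtain ⟨s, hs, e⟩ := this
    exact ⟨s, hs, e⟩
  refine ⟨δ, hδ, fun s hs => ⟨fun hm => ?_, fun hm => ?_⟩⟩
  · obtain ⟨r, hr, e⟩ := key _ hm
    have := geo_inj ch.1 (fun hK => by
      have := hδK hK
      rw [abs_lt]; constructor <;> linarith [hr.1, hr.2, hs.1, hs.2]) e
    linarith [hr.1, hs.1]
  · obtain ⟨r, hr, e⟩ := key _ hm
    have := geo_inj ch.1 (fun hK => by
      have := hδK hK
      rw [abs_lt]; constructor <;> linarith [hr.1, hr.2, hs.1, hs.2]) e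
    linarith [hr.2, hs.1]

theorem IsChord.ends_mem_frontier {K : ℝ} {D : Set (Space K)} (hD : IsCompact D)
    (hconv : GeodConvex D) {g : Geodesic K} {ch : UnitTangent K × ℝ} (h : IsChord D g ch) :
    geo ch.1 0 ∈ frontier D ∧ geo ch.1 ch.2 ∈ frontier D := by
  obtain ⟨δ, hδ, hout⟩ := h.exists_outside hconv
  rw [hD.isClosed.frontier_eq]
  have hev : ∀ᶠ s in nhdsWithin (0 : ℝ) (Ioi 0), s ∈ Ioo 0 δ := Ioo_mem_nhdsGT hδ
  refine ⟨⟨(h.geo_mem ⟨le_rfl, h.2.1⟩).1, fun hi => ?_⟩,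
    ⟨(h.geo_mem ⟨h.2.1, le_rfl⟩).1, fun hi => ?_⟩⟩
  · have hc : Filter.Tendsto (fun s => geo ch.1 (-s)) (nhdsWithin 0 (Ioi 0)) (nhds (geo ch.1 0)) := by
      have : Continuous fun s => geo ch.1 (-s) := (continuous_geo ch.1).comp continuous_neg
      have := this.tendsto 0
      rw [neg_zero] at this
      exact this.mono_left nhdsWithin_le_nhds
    obtain ⟨s, h1, h2⟩ := ((hc.eventually (isOpen_interior.mem_nhds hi)).and hev).exists
    exact (hout s h2).1 (interior_subset h1)
  · have hc : Filter.Tendsto (fun s => geo ch.1 (ch.2 + s)) (nhdsWithin 0 (Ioi 0))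
        (nhds (geo ch.1 ch.2)) := by
      have : Continuous fun s => geo ch.1 (ch.2 + s) :=
        (continuous_geo ch.1).comp (continuous_const.add continuous_id)
      have := this.tendsto 0
      rw [add_zero] at this
      exact this.mono_left nhdsWithin_le_nhds
    obtain ⟨s, h1, h2⟩ := ((hc.eventually (isOpen_interior.mem_nhds hi)).and hev).exists
    exact (hout s h2).2 (interior_subset h1)

/-! ### The cone over a set -/

/-- The open cone over `X_K`. -/
def InCone (K : ℝ) (z : Fin 3 → ℝ) : Prop := 0 < quad K z z ∧ (K ≤ 0 → 0 < z 0)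

theorem InCone.isPoint {K : ℝ} {z : Fin 3 → ℝ} (h : InCone K z) :
    IsPoint K ((√(quad K z z))⁻¹ • z) := by
  have h1 := Real.sqrt_pos.2 h.1
  have h2 := Real.mul_self_sqrt h.1.le
  refine ⟨?_, fun hK => ?_⟩
  · rw [quad_smul_smul, ← h2, Real.sqrt_mul_self h1.le]; field_simp
  · have := h.2 hK
    simp only [Pi.smul_apply, smul_eq_mul]; positivity

open Classical in
/-- The central projection to `X_K`. -/
def proj (K : ℝ) (z : Fin 3 → ℝ) : Space K :=
  if h : InCone K z then ⟨(√(quad K z z))⁻¹ • z, h.isPoint⟩ else polarPoint K 0 0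

theorem InCone.proj_eq {K : ℝ} {z : Fin 3 → ℝ} (h : InCone K z) :
    (proj K z).1 = (√(quad K z z))⁻¹ • z := by
  rw [proj, dif_pos h]

theorem InCone.eq_smul_proj {K : ℝ} {z : Fin 3 → ℝ} (h : InCone K z) :
    z = √(quad K z z) • (proj K z).1 := by
  have := Real.sqrt_pos.2 h.1
  rw [h.proj_eq, smul_smul, mul_inv_cancel₀ this.ne', one_smul]

theorem inCone_smul {K r : ℝ} (hr : 0 < r) (x : Space K) : InCone K (r • x.1) := by
  refine ⟨?_, fun hK => ?_⟩
  · rw [quad_smul_smul, x.2.1]; positivity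
  · have := x.2.2 hK
    simp only [Pi.smul_apply, smul_eq_mul]; positivity

theorem proj_smul {K r : ℝ} (hr : 0 < r) (x : Space K) : proj K (r • x.1) = x := by
  apply Subtype.ext
  rw [(inCone_smul hr x).proj_eq, quad_smul_smul, x.2.1, mul_one, Real.sqrt_mul_self hr.le,
    smul_smul, inv_mul_cancel₀ hr.ne', one_smul]

theorem inCone_point {K : ℝ} (x : Space K) : InCone K x.1 := by
  simpa using inCone_smul one_pos x

theorem proj_point {K : ℝ} (x : Space K) : proj K x.1 = x := by
  simpa using proj_smul one_pos x

theorem isOpen_inCone (K : ℝ) : IsOpen {z | InCone K z} := by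
  have h1 : IsOpen {z : Fin 3 → ℝ | 0 < quad K z z} :=
    isOpen_lt continuous_const (continuous_id.quad continuous_id)
  by_cases hK : K ≤ 0
  · have h2 : IsOpen {z : Fin 3 → ℝ | 0 < z 0} := isOpen_lt continuous_const (continuous_apply 0)
    convert h1.inter h2 using 1
    ext z; simp [InCone, hK]
  · convert h1 using 1
    ext z; simp [InCone, hK]

theorem continuousOn_proj (K : ℝ) : ContinuousOn (proj K) {z | InCone K z} := by
  rw [continuousOn_iff_continuous_domRestrict]
  have : {z | InCone K z}.domRestrict (proj K) = fun z : {z | InCone K z} =>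
      (⟨(√(quad K z.1 z.1))⁻¹ • z.1, z.2.isPoint⟩ : Space K) := by
    funext z; apply Subtype.ext; exact InCone.proj_eq z.2
  rw [this]
  refine Continuous.subtype_mk ?_ _
  refine Continuous.smul (Continuous.inv₀ ?_ fun z => (Real.sqrt_pos.2 z.2.1).ne')
    continuous_subtype_val
  exact (continuous_subtype_val.quad continuous_subtype_val).sqrt

/-- The cone over `D`. -/
def cone {K : ℝ} (D : Set (Space K)) : Set (Fin 3 → ℝ) := {z | InCone K z ∧ proj K z ∈ D}

theorem smul_mem_cone {K r : ℝ} {D : Set (Space K)} (hr : 0 < r) {x : Space K} :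
    r • x.1 ∈ cone D ↔ x ∈ D := by
  simp [cone, inCone_smul hr x, proj_smul hr x]

/-- Central projection and dilation are continuous, so interior points can be moved between D and
the cone, where linear convexity is available. -/
theorem mem_interior_cone {K : ℝ} {D : Set (Space K)} {z : Fin 3 → ℝ} :
    z ∈ interior (cone D) ↔ InCone K z ∧ proj K z ∈ interior D := by
  constructor
  · intro hz
    have h1 : InCone K z := (interior_subset hz).1
    have hr := Real.sqrt_pos.2 h1.1
    refine ⟨h1, ?_⟩
    have hcont : Continuous fun x : Space K => √(quad K z z) • x.1 :=
      by fun_prop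
    refine interior_maximal ?_ ((isOpen_interior (s := cone D)).preimage hcont) ?_
    · intro x hx
      exact (smul_mem_cone hr).1 (interior_subset hx)
    · show √(quad K z z) • (proj K z).1 ∈ interior (cone D)
      rwa [← h1.eq_smul_proj]
  · intro hz
    have ho := (continuousOn_proj K).isOpen_inter_preimage (isOpen_inCone K)
      (isOpen_interior (s := D))
    have hsub : {z | InCone K z} ∩ proj K ⁻¹' interior D ⊆ cone D :=
      fun w hw => ⟨hw.1, interior_subset hw.2⟩
    exact interior_maximal hsub ho hz

theorem inCone_comb {K : ℝ} {D : Set (Space K)} (hconv : GeodConvex D) {x y : Space K}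
    (hx : x ∈ D) (hy : y ∈ D) {α β : ℝ} (hα : 0 ≤ α) (hβ : 0 ≤ β) (h : 0 < α + β) :
    InCone K (α • x.1 + β • y.1) := by
  refine ⟨?_, fun hK => ?_⟩
  · have h1 := quad_gt_neg_one hconv hx hy
    rw [quad_comb, x.2.1, y.2.1, quad_comm K y.1 x.1]
    rcases hα.eq_or_lt with h2 | h2
    · rw [← h2] at h ⊢; nlinarith
    rcases hβ.eq_or_lt with h3 | h3
    · rw [← h3] at h ⊢; nlinarith
    nlinarith [mul_pos h2 h3, sq_nonneg (α - β)]
  · have h1 := x.2.2 hK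
    have h2 := y.2.2 hK
    simp only [Pi.add_apply, Pi.smul_apply, smul_eq_mul]
    rcases hα.eq_or_lt with h3 | h3
    · have : 0 < β := by linarith
      rw [← h3]; simp; positivity
    · positivity

theorem comb_mem_cone {K : ℝ} {D : Set (Space K)} (hconv : GeodConvex D) {x y : Space K}
    (hx : x ∈ D) (hy : y ∈ D) {α β : ℝ} (hα : 0 ≤ α) (hβ : 0 ≤ β) (h : 0 < α + β) :
    α • x.1 + β • y.1 ∈ cone D := by
  have h1 := inCone_comb hconv hx hy hα hβ h
  have h2 := Real.sqrt_pos.2 h1.1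
  refine ⟨h1, comb_mem hconv hx hy (mul_nonneg (inv_nonneg.2 h2.le) hα)
    (mul_nonneg (inv_nonneg.2 h2.le) hβ) ?_⟩
  rw [h1.proj_eq, smul_add, smul_smul, smul_smul]

/-- Geodesic convexity becomes linear convexity one dimension higher; this gives access to
Hahn–Banach and to the nullity of frontiers of convex sets. -/
theorem convex_cone {K : ℝ} {D : Set (Space K)} (hconv : GeodConvex D) : Convex ℝ (cone D) := by
  intro z hz w hw a b ha hb hab
  have h1 := Real.sqrt_pos.2 hz.1.1
  have h2 := Real.sqrt_pos.2 hw.1.1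
  rw [hz.1.eq_smul_proj, hw.1.eq_smul_proj, smul_smul, smul_smul]
  refine comb_mem_cone hconv hz.2 hw.2 (by positivity) (by positivity) ?_
  rcases ha.eq_or_lt with h | h
  · have : b = 1 := by linarith
    subst this; positivity
  · positivity

/-- The segment from y to z is prolonged beyond z until it leaves D at w. As β > 0, the exit point
lies in the plane of y and z; α = 0 means that z itself is w. -/
theorem exists_exit {K : ℝ} {D : Set (Space K)} (hD : IsCompact D) (hconv : GeodConvex D)
    {y z : Space K} (hy : y ∈ D) (hz : z ∈ D) (hyz : y ≠ z) :
    ∃ w ∈ frontier D, ∃ α β : ℝ, 0 ≤ α ∧ 0 < β ∧ z.1 = α • y.1 + β • w.1 := by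
  obtain ⟨q, d, h1, h2, h3, h4, h5⟩ := exists_segment hconv hy hz hyz
  have hg : toGeodesic q ∈ hitting D := ⟨y, ⟨0, by rw [geo_zero, h3]⟩, hy⟩
  obtain ⟨⟨q', l⟩, hch⟩ := exists_isChord hD hconv hg
  have hya : y ∈ (toGeodesic q).1 ∩ D := ⟨⟨0, by rw [geo_zero, h3]⟩, hy⟩
  have hza : z ∈ (toGeodesic q).1 ∩ D := ⟨⟨d, h4⟩, hz⟩
  have hl := hch.2.1
  have hlp : 0 < K → l < Real.pi / √K := hch.lt_pi hconv
  have hfr := hch.ends_mem_frontier hD hconv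
  rw [hch.2.2] at hya hza
  obtain ⟨a, ha, rfl⟩ := hya
  obtain ⟨b, hb, rfl⟩ := hza
  dsimp only at *
  have hs : ∀ t, 0 ≤ t → t ≤ l → 0 ≤ sinK K t := by
    intro t h0 ht
    rcases h0.eq_or_lt with h | h
    · simp [← h]
    · exact (sinK_pos h fun hK => ht.trans_lt (hlp hK)).le
  have hs' : ∀ t, 0 < t → t ≤ l → 0 < sinK K t := fun t h0 ht =>
    sinK_pos h0 fun hK => ht.trans_lt (hlp hK)
  have hne : a ≠ b := fun h => hyz (by rw [h])
  rcases hne.lt_or_gt with hab | hab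
  · have p1 := hs' (l - a) (by linarith [hb.2]) (by linarith [ha.1])
    have p2 := hs (l - b) (by linarith [hb.2]) (by linarith [hb.1])
    have p3 := hs' (b - a) (by linarith) (by linarith [ha.1, hb.2])
    refine ⟨geo q' l, hfr.2, sinK K (l - b) / sinK K (l - a), sinK K (b - a) / sinK K (l - a),
      by positivity, by positivity, ?_⟩
    rw [div_eq_inv_mul, div_eq_inv_mul, mul_smul, mul_smul, ← smul_add, ← geo_between, smul_smul,
      inv_mul_cancel₀ p1.ne', one_smul]
  · have p1 := hs' (a - 0) (by linarith [hb.1]) (by linarith [ha.2])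
    have p2 := hs (b - 0) (by linarith [hb.1]) (by linarith [hb.2])
    have p3 := hs' (a - b) (by linarith) (by linarith [ha.2, hb.1])
    refine ⟨geo q' 0, hfr.1, sinK K (b - 0) / sinK K (a - 0), sinK K (a - b) / sinK K (a - 0),
      by positivity, by positivity, ?_⟩
    rw [add_comm, div_eq_inv_mul, div_eq_inv_mul, mul_smul, mul_smul, ← smul_add, ← geo_between,
      smul_smul, inv_mul_cancel₀ p1.ne', one_smul]

/-! ### Supporting functionals -/

/-- Hahn–Banach separates x from the interior of the cone over D, and invariance of the cone under
dilations forces the separating functional to vanish at x. -/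
theorem exists_support {K : ℝ} {D : Set (Space K)} (hD : IsCompact D) (hconv : GeodConvex D)
    (hint : (interior D).Nonempty) {x : Space K} (hx : x ∈ frontier D) :
    ∃ n : Fin 3 → ℝ, dot n x.1 = 0 ∧ (∀ z ∈ D, 0 ≤ dot n z.1) ∧ ∀ z ∈ interior D, 0 < dot n z.1 := by
  rw [hD.isClosed.frontier_eq] at hx
  have hx1 : x.1 ∉ interior (cone D) := fun h => hx.2 (by
    have := (mem_interior_cone.1 h).2; rwa [proj_point] at this)
  obtain ⟨f, hf⟩ := geometric_hahn_banach_open_point (convex_cone hconv).interior isOpen_interior hx1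
  have hfd : ∀ z, f z = -dot (fun i => -f (Pi.single i 1)) z := by
    intro z
    have : z = z 0 • Pi.single (0 : Fin 3) (1 : ℝ) + z 1 • Pi.single (1 : Fin 3) (1 : ℝ)
        + z 2 • Pi.single (2 : Fin 3) (1 : ℝ) := by
      ext i; fin_cases i <;> simp
    conv_lhs => rw [this]
    simp only [map_add, map_smul, smul_eq_mul, dot]
    ring
  have hcomb : ∀ w ∈ D, ∀ z ∈ interior D, ∀ r : ℝ, 0 < r → ∀ t : ℝ, 0 < t →
      r * f w.1 + t * f z.1 < f x.1 := by
    intro w hw z hz r hr t ht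
    have h1 : (r + t) • z.1 ∈ interior (cone D) := by
      rw [mem_interior_cone]
      exact ⟨inCone_smul (by positivity) z, by rwa [proj_smul (by positivity)]⟩
    have h2 : (r + t) • w.1 ∈ closure (cone D) :=
      subset_closure ((smul_mem_cone (by positivity)).2 hw)
    have h3 := (convex_cone hconv).combo_closure_interior_mem_interior h2 h1
      (show 0 ≤ r / (r + t) by positivity) (show 0 < t / (r + t) by positivity)
      (by field_simp)
    have h4 := hf _ h3
    rw [smul_smul, smul_smul, div_mul_cancel₀ _ (by positivity), div_mul_cancel₀ _ (by positivity),
      map_add, map_smul, map_smul] at h4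
    simpa using h4
  obtain ⟨z0, hz0⟩ := hint
  have hneg : ∀ z ∈ interior D, f z.1 < 0 := by
    intro z hz
    have := hcomb x hx.1 z hz 1 one_pos 1 one_pos
    linarith
  have hlim : ∀ w ∈ D, ∀ r : ℝ, 0 < r → r * f w.1 ≤ f x.1 := by
    intro w hw r hr
    by_contra hcon
    push Not at hcon
    have h1 := hneg z0 hz0
    -- This value of t makes the left side of `hcomb` equal to f(x), contradicting the strict
    -- inequality.
    have := hcomb w hw z0 hz0 r hr ((r * f w.1 - f x.1) / (-f z0.1))
      (div_pos (by linarith) (by linarith))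
    have h3 : (r * f w.1 - f x.1) / (-f z0.1) * f z0.1 = -(r * f w.1 - f x.1) := by
      have := h1.ne
      field_simp
    linarith
  -- Dilation by 2 and by 1/2 gives the two opposite inequalities.
  have hx0 : f x.1 = 0 := by
    have h1 := hlim x hx.1 2 two_pos
    have h2 := hlim x hx.1 (1 / 2) (by norm_num)
    linarith
  refine ⟨fun i => -f (Pi.single i 1), ?_, fun z hz => ?_, fun z hz => ?_⟩
  · have := hfd x.1; linarith
  · have := hfd z.1; have := hlim z hz 1 one_pos; linarith
  · have := hfd z.1; have := hneg z hz; linarith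

theorem eq_smul_cr {n a b : Fin 3 → ℝ} (h : cr a b ≠ 0) (ha : dot n a = 0) (hb : dot n b = 0) :
    ∃ κ : ℝ, n = κ • cr a b := by
  have hm : 0 < dot (cr a b) (cr a b) := by
    by_contra hcon
    apply h
    have h0 := mul_self_nonneg (cr a b 0)
    have h1 := mul_self_nonneg (cr a b 1)
    have h2 := mul_self_nonneg (cr a b 2)
    simp only [dot] at hcon
    ext i
    have k0 : cr a b 0 = 0 := mul_self_eq_zero.1 (by linarith)
    have k1 : cr a b 1 = 0 := mul_self_eq_zero.1 (by linarith)
    have k2 : cr a b 2 = 0 := mul_self_eq_zero.1 (by linarith)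
    fin_cases i
    · exact k0
    · exact k1
    · exact k2
  refine ⟨dot n (cr a b) / dot (cr a b) (cr a b), ?_⟩
  have key : dot (cr a b) (cr a b) • n = dot n (cr a b) • cr a b := by
    have e : ∀ i, cr n (cr a b) i = 0 := by
      intro i
      fin_cases i
      · simp [cr, dot] at *; linear_combination a 0 * hb - b 0 * ha
      · simp [cr, dot] at *; linear_combination a 1 * hb - b 1 * ha
      · simp [cr, dot] at *; linear_combination a 2 * hb - b 2 * ha
    set m := cr a b
    have e0 := e 0; have e1 := e 1; have e2 := e 2
    simp only [cr, Matrix.cons_val_zero, Matrix.cons_val_one, Matrix.cons_val] at e0 e1 e2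
    ext i
    fin_cases i
    · simp [dot]; linear_combination m 1 * e2 - m 2 * e1
    · simp [dot]; linear_combination m 2 * e0 - m 0 * e2
    · simp [dot]; linear_combination m 0 * e1 - m 1 * e0
  rw [div_eq_inv_mul, mul_smul, ← key, smul_smul, inv_mul_cancel₀ hm.ne', one_smul]

theorem geodesic_eq_of_smul {K κ : ℝ} {q q' : UnitTangent K}
    (h : cr q.1.1 q.1.2 = κ • cr q'.1.1 q'.1.2) : toGeodesic q = toGeodesic q' := by
  have hκ : κ ≠ 0 := by
    rintro rfl
    exact normal_ne_zero q (by simpa using h)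
  apply Subtype.ext
  ext x
  show x ∈ line q ↔ x ∈ line q'
  rw [mem_line_iff, mem_line_iff, tri_eq_dot, tri_eq_dot, h, dot_smul]
  simp [hκ]

theorem geodesic_normal {K : ℝ} (q : UnitTangent K) (x : Space K) :
    x ∈ (toGeodesic q).1 ↔ dot (cr q.1.1 q.1.2) x.1 = 0 := by
  rw [← tri_eq_dot]; exact mem_line_iff q x

theorem dot_geo_eq_zero {K : ℝ} {q : UnitTangent K} {n : Fin 3 → ℝ} {a b : ℝ}
    (hs : sinK K (b - a) ≠ 0) (ha : dot n (geo q a).1 = 0) (hb : dot n (geo q b).1 = 0) (t : ℝ) :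
    dot n (geo q t).1 = 0 := by
  have h := congrArg (dot n) (geo_between q a t b)
  rw [dot_smul_right, dot_comb, ha, hb] at h
  simpa [hs] using h

/-! ### Convex domains with `C¹` boundary -/

/-- The standing assumptions on `D`. -/
structure Domain {K : ℝ} (D : Set (Space K)) (c : ℝ → Space K) (T : ℝ) : Prop where
  compact : IsCompact D
  int_nonempty : (interior D).Nonempty
  convex : GeodConvex D
  bd : IsC1Boundary D c T

namespace Domain

variable {K : ℝ} {D : Set (Space K)} {c : ℝ → Space K} {T : ℝ}

theorem hasDerivAt (h : Domain D c T) (t : ℝ) :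
    HasDerivAt (fun s => (c s : Fin 3 → ℝ)) (vel c t) t :=
  (h.bd.contDiff.differentiable one_ne_zero t).hasDerivAt

theorem continuous_coe (h : Domain D c T) : Continuous fun s => (c s : Fin 3 → ℝ) :=
  h.bd.contDiff.continuous

theorem continuous_vel (h : Domain D c T) : Continuous (vel c) :=
  h.bd.contDiff.continuous_deriv le_rfl

theorem quad_vel (h : Domain D c T) (t : ℝ) : quad K (c t).1 (vel c t) = 0 := by
  have hd := h.hasDerivAt t
  have h1 := fun i => (hasDerivAt_pi.1 hd i)
  have h2 : HasDerivAt (fun s => quad K (c s).1 (c s).1) (2 * quad K (c t).1 (vel c t)) t := by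
    have := ((h1 0).mul (h1 0)).add ((((h1 1).mul (h1 1)).add ((h1 2).mul (h1 2))).const_mul K)
    refine this.congr_deriv ?_
    simp [quad]; ring
  have h3 : (fun s => quad K (c s).1 (c s).1) = fun _ => (1 : ℝ) := by
    ext s; exact (c s).2.1
  rw [h3] at h2
  have := h2.unique (hasDerivAt_const t (1 : ℝ))
  linarith

theorem mem_frontier (h : Domain D c T) (t : ℝ) : c t ∈ frontier D := by
  rw [← h.bd.range_eq]; exact ⟨t, rfl⟩

theorem mem (h : Domain D c T) (t : ℝ) : c t ∈ D :=
  h.compact.isClosed.frontier_subset (h.mem_frontier t)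

theorem not_mem_interior (h : Domain D c T) (t : ℝ) : c t ∉ interior D := by
  have := h.mem_frontier t
  rw [h.compact.isClosed.frontier_eq] at this
  exact this.2

theorem exists_param (h : Domain D c T) {x : Space K} (hx : x ∈ frontier D) :
    ∃ t ∈ Ico 0 T, c t = x := by
  rw [← h.bd.range_eq] at hx
  obtain ⟨s, rfl⟩ := hx
  obtain ⟨t, ht, e⟩ := h.bd.periodic.exists_mem_Ico₀ h.bd.period_pos s
  exact ⟨t, ht, e.symm⟩

theorem metric_vel (h : Domain D c T) (t : ℝ) :
    metric K (vel c t) (vel c t) = gram K (c t).1 (vel c t) (c t).1 (vel c t) :=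
  metric_eq_gram (c t).2 (h.quad_vel t) (h.quad_vel t)

theorem metric_vel_pos (h : Domain D c T) (t : ℝ) : 0 < metric K (vel c t) (vel c t) :=
  metric_pos (c t).2 (h.quad_vel t) (h.bd.regular t)

theorem cr_ne_zero (h : Domain D c T) (t : ℝ) : cr (c t).1 (vel c t) ≠ 0 := by
  intro h0
  have := h.metric_vel_pos t
  rw [h.metric_vel, gram, h0] at this
  simp [dual] at this

theorem dot_vel_eq_zero (h : Domain D c T) {n : Fin 3 → ℝ} {t : ℝ} (h0 : dot n (c t).1 = 0)
    (hn : ∀ z ∈ D, 0 ≤ dot n z.1) : dot n (vel c t) = 0 := by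
  have h1 := fun i => (hasDerivAt_pi.1 (h.hasDerivAt t) i)
  have h2 : HasDerivAt (fun s => dot n (c s).1) (dot n (vel c t)) t :=
    (((h1 0).const_mul (n 0)).add ((h1 1).const_mul (n 1))).add ((h1 2).const_mul (n 2))
  refine IsLocalMin.hasDerivAt_eq_zero (Filter.Eventually.of_forall fun s => ?_) h2
  rw [h0]; exact hn _ (h.mem s)

/-- Here the regularity of the boundary enters: a supporting functional at c t annihilates both c t
and its velocity, so it is determined up to a factor. -/
theorem support_unique (h : Domain D c T) {n : Fin 3 → ℝ} {t : ℝ} (h0 : dot n (c t).1 = 0)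
    (hn : ∀ z ∈ D, 0 ≤ dot n z.1) : ∃ κ : ℝ, n = κ • cr (c t).1 (vel c t) :=
  eq_smul_cr (h.cr_ne_zero t) h0 (h.dot_vel_eq_zero h0 hn)

/-- Every supporting functional at c t is a multiple of `tri (c t) (vel c t)`. At one fixed interior
point this triple product never vanishes, and by continuity in t it keeps its sign. -/
theorem exists_orientation (h : Domain D c T) : ∃ ε : ℝ, (ε = 1 ∨ ε = -1) ∧
    ∀ t, (∀ z ∈ D, 0 ≤ ε * tri (c t).1 (vel c t) z.1) ∧
      ∀ z ∈ interior D, 0 < ε * tri (c t).1 (vel c t) z.1 := by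
  obtain ⟨z0, hz0⟩ := h.int_nonempty
  have key : ∀ t, ∃ κ : ℝ, (∀ z ∈ D, 0 ≤ κ * tri (c t).1 (vel c t) z.1) ∧
      ∀ z ∈ interior D, 0 < κ * tri (c t).1 (vel c t) z.1 := by
    intro t
    obtain ⟨n, h1, h2, h3⟩ := exists_support h.compact h.convex h.int_nonempty (h.mem_frontier t)
    obtain ⟨κ, rfl⟩ := h.support_unique h1 h2
    refine ⟨κ, fun z hz => ?_, fun z hz => ?_⟩
    · have := h2 z hz; rwa [dot_smul, ← tri_eq_dot] at this
    · have := h3 z hz; rwa [dot_smul, ← tri_eq_dot] at this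
  have hcont : Continuous fun t => tri (c t).1 (vel c t) z0.1 :=
    h.continuous_coe.tri h.continuous_vel continuous_const
  have hne : ∀ t, tri (c t).1 (vel c t) z0.1 ≠ 0 := by
    intro t h0
    obtain ⟨κ, -, h2⟩ := key t
    have := h2 z0 hz0
    simp [h0] at this
  have hsign : (∀ t, 0 < tri (c t).1 (vel c t) z0.1) ∨ ∀ t, tri (c t).1 (vel c t) z0.1 < 0 := by
    by_contra hcon
    push Not at hcon
    obtain ⟨⟨a, ha⟩, b, hb⟩ := hcon
    obtain ⟨s, hs⟩ := mem_range_of_exists_le_of_exists_ge hcont ⟨a, ha⟩ ⟨b, hb⟩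
    exact hne s hs
  rcases hsign with hs | hs
  · refine ⟨1, Or.inl rfl, fun t => ?_⟩
    obtain ⟨κ, h1, h2⟩ := key t
    have hκ : 0 < κ := pos_of_mul_pos_left (h2 z0 hz0) (hs t).le
    exact ⟨fun z hz => by rw [one_mul]; exact nonneg_of_mul_nonneg_right (h1 z hz) hκ,
      fun z hz => by rw [one_mul]; exact pos_of_mul_pos_right (h2 z hz) hκ.le⟩
  · refine ⟨-1, Or.inr rfl, fun t => ?_⟩
    obtain ⟨κ, h1, h2⟩ := key t
    have hκ : κ < 0 := by
      by_contra hcon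
      have := mul_nonpos_of_nonneg_of_nonpos (not_lt.1 hcon) (hs t).le
      linarith [h2 z0 hz0]
    exact ⟨fun z hz => by have := h1 z hz; nlinarith, fun z hz => by have := h2 z hz; nlinarith⟩

theorem c_ne (h : Domain D c T) {s t : ℝ} (hs : s ∈ Ico 0 T) (ht : t ∈ Ico 0 T) (hst : s ≠ t) :
    c s ≠ c t := fun e => hst (h.bd.injOn hs ht e)

theorem gram_pos (h : Domain D c T) {s t : ℝ} (hs : s ∈ Ico 0 T) (ht : t ∈ Ico 0 T) (hst : s ≠ t) :
    0 < gram K (c s).1 (c t).1 (c s).1 (c t).1 :=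
  gram_pos_of_ne h.convex (h.mem s) (h.mem t) (h.c_ne hs ht hst)

theorem cr_ne (h : Domain D c T) {s t : ℝ} (hs : s ∈ Ico 0 T) (ht : t ∈ Ico 0 T) (hst : s ≠ t) :
    cr (c s).1 (c t).1 ≠ 0 := by
  intro h0
  have := h.gram_pos hs ht hst
  simp [gram, h0, dual] at this

/-- Both factors have the sign ε of the orientation. This makes the density `jac` nonnegative. -/
theorem tri_mul_nonneg (h : Domain D c T) (s t : ℝ) :
    0 ≤ tri (c s).1 (vel c s) (c t).1 * tri (c s).1 (c t).1 (vel c t) := by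
  obtain ⟨ε, hε, ho⟩ := h.exists_orientation
  have h1 := (ho s).1 _ (h.mem t)
  have h2 := (ho t).1 _ (h.mem s)
  rw [show tri (c t).1 (vel c t) (c s).1 = tri (c s).1 (c t).1 (vel c t) by
    simp only [tri]; ring] at h2
  have := mul_nonneg h1 h2
  rcases hε with rfl | rfl <;> nlinarith

/-- If the tangent geodesic at c s passes through c t, its functional also supports D at c t, and by
uniqueness the two tangent geodesics coincide. -/
theorem tri_eq_zero_symm (h : Domain D c T) {s t : ℝ}
    (h0 : tri (c s).1 (vel c s) (c t).1 = 0) : tri (c t).1 (vel c t) (c s).1 = 0 := by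
  obtain ⟨ε, hε, ho⟩ := h.exists_orientation
  have hε0 : ε ≠ 0 := by rcases hε with rfl | rfl <;> norm_num
  obtain ⟨κ, hκ⟩ := h.support_unique (n := ε • cr (c s).1 (vel c s)) (t := t)
    (by rw [dot_smul, ← tri_eq_dot, h0, mul_zero])
    (fun z hz => by rw [dot_smul, ← tri_eq_dot]; exact (ho s).1 z hz)
  have hκ0 : κ ≠ 0 := by
    rintro rfl
    rw [zero_smul] at hκ
    exact (smul_ne_zero hε0 (h.cr_ne_zero s)) hκ
  have h1 := congrArg (fun n => dot n (c s).1) hκ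
  simp only [dot_smul, ← tri_eq_dot] at h1
  have h2 : tri (c s).1 (vel c s) (c s).1 = 0 := by simp only [tri]; ring
  rw [h2, mul_zero] at h1
  simpa [hκ0] using h1.symm

/-- A chord which meets the boundary transversally meets it in its end points only. -/
theorem eq_end_of_mem (h : Domain D c T) {s t w : ℝ} (h0 : tri (c s).1 (vel c s) (c t).1 ≠ 0)
    {g : Geodesic K} {ch : UnitTangent K × ℝ} (hch : IsChord D g ch) (hs : c s ∈ g.1)
    (ht : c t ∈ g.1) (hw : c w ∈ g.1) : c w = geo ch.1 0 ∨ c w = geo ch.1 ch.2 := by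
  obtain ⟨ε, hε, ho⟩ := h.exists_orientation
  have hwD : c w ∈ g.1 ∩ D := ⟨hw, h.mem w⟩
  rw [hch.2.2] at hwD
  obtain ⟨e, he, hew⟩ := hwD
  by_contra hcon
  push Not at hcon
  rw [← hew] at hcon
  have he0 : 0 < e := lt_of_le_of_ne he.1 fun h => hcon.1 (by rw [← h])
  have hel : e < ch.2 := lt_of_le_of_ne he.2 fun h => hcon.2 (by rw [h])
  have hlp : 0 < K → ch.2 < Real.pi / √K := hch.lt_pi h.convex
  have p1 : 0 < sinK K (ch.2 - 0) := sinK_pos (by linarith) fun hK => by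
    have := hlp hK; linarith
  have p2 : 0 < sinK K (ch.2 - e) := sinK_pos (by linarith) fun hK => by
    have := hlp hK; linarith
  have p3 : 0 < sinK K (e - 0) := sinK_pos (by linarith) fun hK => by
    have := hlp hK; linarith
  set n := ε • cr (c w).1 (vel c w) with hn
  have hnD : ∀ z ∈ D, 0 ≤ dot n z.1 := fun z hz => by
    rw [hn, dot_smul, ← tri_eq_dot]; exact (ho w).1 z hz
  have h1 := hnD _ (hch.geo_mem ⟨le_rfl, hch.2.1⟩).1
  have h2 := hnD _ (hch.geo_mem ⟨hch.2.1, le_rfl⟩).1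
  have h3 : dot n (geo ch.1 e).1 = 0 := by
    rw [hew, hn, dot_smul, ← tri_eq_dot]
    simp only [tri]; ring
  -- The supporting functional at the inner point c w is nonnegative at both ends of the chord and
  -- zero in between, so it vanishes on the whole geodesic. It is then also the supporting
  -- functional at c s, and its vanishing at c t contradicts `h0`.
  have h4 := congrArg (dot n) (geo_between ch.1 0 e ch.2)
  rw [dot_smul_right, dot_comb, h3, mul_zero] at h4
  have h5 : dot n (geo ch.1 0).1 = 0 := by nlinarith [mul_nonneg p2.le h1, mul_nonneg p3.le h2]
  have h6 : dot n (geo ch.1 ch.2).1 = 0 := by nlinarith [mul_nonneg p2.le h1, mul_nonneg p3.le h2]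
  have h7 := dot_geo_eq_zero p1.ne' h5 h6
  have hg : g.1 = line ch.1 := by rw [← hch.1]; rfl
  rw [hg] at hs ht
  obtain ⟨a, ha⟩ := hs
  obtain ⟨b, hb⟩ := ht
  have hs0 : dot n (c s).1 = 0 := by rw [← ha]; exact h7 a
  have ht0 : dot n (c t).1 = 0 := by rw [← hb]; exact h7 b
  obtain ⟨κ, hκ⟩ := h.support_unique hs0 hnD
  rw [hκ, dot_smul, ← tri_eq_dot] at ht0
  have hκ0 : κ = 0 := by simpa [h0] using ht0
  obtain ⟨z0, hz0⟩ := h.int_nonempty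
  have h8 := (ho w).2 z0 hz0
  rw [tri_eq_dot, ← dot_smul, ← hn, hκ, hκ0, zero_smul] at h8
  simp [dot] at h8

/-- Otherwise the midpoint between c s and c t would be a further boundary point on a transversal
chord, strictly between its ends. -/
theorem tri_eq_zero_of_supporting (h : Domain D c T) {g : Geodesic K} (hg : g ∈ supporting D)
    {s t : ℝ} (hst : c s ≠ c t) (hs : c s ∈ g.1) (ht : c t ∈ g.1) :
    tri (c s).1 (vel c s) (c t).1 = 0 := by
  by_contra h0
  obtain ⟨ch, hch⟩ := exists_isChord h.compact h.convex (g := g) hg.1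
  have hsD : c s ∈ g.1 ∩ D := ⟨hs, h.mem s⟩
  have htD : c t ∈ g.1 ∩ D := ⟨ht, h.mem t⟩
  rw [hch.2.2] at hsD htD
  obtain ⟨a, ha, ea⟩ := hsD
  obtain ⟨b, hb, eb⟩ := htD
  have hab : a ≠ b := fun e => hst (by rw [← ea, ← eb, e])
  have hm : (a + b) / 2 ∈ Icc 0 ch.2 := ⟨by linarith [ha.1, hb.1], by linarith [ha.2, hb.2]⟩
  obtain ⟨w, -, hw⟩ := h.exists_param (hg.2 ⟨(hch.geo_mem hm).2, (hch.geo_mem hm).1⟩)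
  have hwg : c w ∈ g.1 := by rw [hw]; exact (hch.geo_mem hm).2
  have hinj : ∀ r ∈ Icc 0 ch.2, geo ch.1 ((a + b) / 2) = geo ch.1 r → (a + b) / 2 = r := by
    intro r hr e
    refine geo_inj ch.1 (fun hK => ?_) e
    have := hch.lt_pi h.convex hK
    rw [abs_lt]; constructor <;> linarith [hr.1, hr.2, hm.1, hm.2]
  rcases h.eq_end_of_mem h0 hch hs ht hwg with e | e
  · rw [hw] at e
    have := hinj 0 ⟨le_rfl, hch.2.1⟩ e
    exact hab (by linarith [ha.1, hb.1])
  · rw [hw] at e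
    have := hinj ch.2 ⟨hch.2.1, le_rfl⟩ e
    exact hab (by linarith [ha.2, hb.2])

/-- The geodesic is the tangent one at c s, and the supporting functional at c s, zero on it, is
positive on the interior. -/
theorem supporting_of_tri_eq_zero (h : Domain D c T) {g : Geodesic K} {s t : ℝ}
    (hst : cr (c s).1 (c t).1 ≠ 0) (hs : c s ∈ g.1) (ht : c t ∈ g.1)
    (h0 : tri (c s).1 (vel c s) (c t).1 = 0) : g ∈ supporting D := by
  obtain ⟨ε, hε, ho⟩ := h.exists_orientation
  obtain ⟨-, q, rfl⟩ := g
  refine ⟨⟨c s, hs, h.mem s⟩, fun z hz => ?_⟩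
  rw [h.compact.isClosed.frontier_eq]
  refine ⟨hz.2, fun hzi => ?_⟩
  obtain ⟨κ, hκ⟩ := eq_smul_cr hst ((geodesic_normal q _).1 hs) ((geodesic_normal q _).1 ht)
  have hκ0 : κ ≠ 0 := by
    rintro rfl
    exact normal_ne_zero q (by simpa using hκ)
  obtain ⟨μ, hμ⟩ := eq_smul_cr hst (n := cr (c s).1 (vel c s))
    (by simp only [dot, cr, Matrix.cons_val_zero, Matrix.cons_val_one, Matrix.cons_val]; ring)
    (by rw [← tri_eq_dot]; exact h0)
  have h1 := (ho s).2 z hzi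
  have h2 := (geodesic_normal q z).1 hz.1
  rw [hκ, dot_smul] at h2
  have h3 : dot (cr (c s).1 (c t).1) z.1 = 0 := by simpa [hκ0] using h2
  rw [tri_eq_dot, hμ, dot_smul, h3] at h1
  simp at h1

theorem geodesic_unique {q q' : UnitTangent K} {x y : Space K} (hxy : cr x.1 y.1 ≠ 0)
    (hx : x ∈ line q) (hy : y ∈ line q) (hx' : x ∈ line q') (hy' : y ∈ line q') :
    toGeodesic q = toGeodesic q' := by
  obtain ⟨κ, hκ⟩ := eq_smul_cr hxy ((geodesic_normal q _).1 hx) ((geodesic_normal q _).1 hy)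
  obtain ⟨μ, hμ⟩ := eq_smul_cr hxy ((geodesic_normal q' _).1 hx') ((geodesic_normal q' _).1 hy')
  have hμ0 : μ ≠ 0 := by
    rintro rfl
    exact normal_ne_zero q' (by simpa using hμ)
  refine geodesic_eq_of_smul (κ := κ / μ) ?_
  rw [hκ, hμ, smul_smul, div_mul_cancel₀ _ hμ0]

end Domain

/-! ### Volumes of cones over parametrized surfaces -/

/-- The coordinates `(x₀, (x₁, x₂))` of `ℝ³`. -/
def coords : (Fin 3 → ℝ) ≃ᵐ ℝ × ℝ × ℝ :=
  (MeasurableEquiv.piFinSuccAbove (fun _ : Fin 3 => ℝ) 0).trans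
    (MeasurableEquiv.prodCongr (MeasurableEquiv.refl ℝ) MeasurableEquiv.finTwoArrow)

theorem measurePreserving_coords : MeasurePreserving coords volume volume := by
  have h1 := volume_preserving_piFinSuccAbove (fun _ : Fin 3 => ℝ) 0
  have h2 := (MeasurePreserving.id (volume : Measure ℝ)).prod (volume_preserving_finTwoArrow ℝ)
  exact h2.comp h1

/-- The derivative of `v ↦ v₀ Ψ(v₁, v₂)`. -/
def coneDeriv (r : ℝ) (P P1 P2 : Fin 3 → ℝ) : (Fin 3 → ℝ) →L[ℝ] (Fin 3 → ℝ) :=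
  LinearMap.toContinuousLinearMap (Matrix.toLin' (Matrix.of fun i j => ![P i, r * P1 i, r * P2 i] j))

theorem det_coneDeriv (r : ℝ) (P P1 P2 : Fin 3 → ℝ) :
    (coneDeriv r P P1 P2).det = r ^ 2 * tri P P1 P2 := by
  rw [coneDeriv, ContinuousLinearMap.det, LinearMap.coe_toContinuousLinearMap, LinearMap.det_toLin',
    Matrix.det_fin_three]
  simp [tri]; ring

theorem hasFDerivAt_cone {Ψ : ℝ × ℝ → Fin 3 → ℝ} {P1 P2 : Fin 3 → ℝ} {v : Fin 3 → ℝ}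
    (h : HasFDerivAt Ψ ((ContinuousLinearMap.fst ℝ ℝ ℝ).smulRight P1 +
      (ContinuousLinearMap.snd ℝ ℝ ℝ).smulRight P2) (v 1, v 2)) :
    HasFDerivAt (fun v : Fin 3 → ℝ => v 0 • Ψ (v 1, v 2))
      (coneDeriv (v 0) (Ψ (v 1, v 2)) P1 P2) v := by
  have h0 : HasFDerivAt (fun v : Fin 3 → ℝ => v 0) (ContinuousLinearMap.proj (R := ℝ) (φ := fun _ : Fin 3 => ℝ) 0) v :=
    hasFDerivAt_apply 0 v
  have h1 : HasFDerivAt (fun v : Fin 3 → ℝ => v 1) (ContinuousLinearMap.proj (R := ℝ) (φ := fun _ : Fin 3 => ℝ) 1) v :=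
    hasFDerivAt_apply 1 v
  have h2 : HasFDerivAt (fun v : Fin 3 → ℝ => v 2) (ContinuousLinearMap.proj (R := ℝ) (φ := fun _ : Fin 3 => ℝ) 2) v :=
    hasFDerivAt_apply 2 v
  have h3 := h0.smul (HasFDerivAt.comp v h (h1.prodMk h2))
  refine h3.congr_fderiv ?_
  ext w i
  simp [coneDeriv, Matrix.toLin'_apply, Matrix.mulVec, dotProduct, Fin.sum_univ_three]
  ring

theorem lintegral_coords {U : Set (ℝ × ℝ)} (hU : MeasurableSet U) {N : ℝ × ℝ → ℝ}
    (hN : Measurable N) {S : Set ℝ} (hS : MeasurableSet S) {F : ℝ × ℝ → ℝ} (hF : Measurable F)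
    {k : ℝ} (Npos : ∀ u ∈ U, 0 < N u)
    (hk : ∀ N : ℝ, 0 < N → ∫⁻ R in {R | R * N ∈ S}, ENNReal.ofReal (R ^ 2) =
      ENNReal.ofReal (k / N ^ 3)) :
    ∫⁻ v in {v : Fin 3 → ℝ | (v 1, v 2) ∈ U ∧ v 0 * N (v 1, v 2) ∈ S},
      ENNReal.ofReal |v 0 ^ 2 * F (v 1, v 2)| =
    ∫⁻ u in U, ENNReal.ofReal (k * |F u| / N u ^ 3) := by
  set W : Set (ℝ × ℝ × ℝ) := {w | w.2 ∈ U ∧ w.1 * N w.2 ∈ S} with hW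
  have hWm : MeasurableSet W :=
    (measurable_snd hU).inter ((measurable_fst.mul (hN.comp measurable_snd)) hS)
  have e1 : {v : Fin 3 → ℝ | (v 1, v 2) ∈ U ∧ v 0 * N (v 1, v 2) ∈ S} = coords ⁻¹' W := rfl
  have hGm : Measurable fun w : ℝ × ℝ × ℝ => ENNReal.ofReal |w.1 ^ 2 * F w.2| :=
    (((measurable_fst.pow_const 2).mul (hF.comp measurable_snd)).abs).ennreal_ofReal
  have e2 := measurePreserving_coords.setLIntegral_comp_preimage hWm hGm
  rw [e1]
  refine Eq.trans e2 ?_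
  rw [← lintegral_indicator hWm, Measure.volume_eq_prod, lintegral_prod_symm' _ (hGm.indicator hWm),
    ← lintegral_indicator hU]
  refine lintegral_congr fun u => ?_
  by_cases hu : u ∈ U
  · rw [indicator_of_mem hu]
    have hSm : MeasurableSet {R : ℝ | R * N u ∈ S} := (measurable_id.mul_const _) hS
    have : ∀ R : ℝ, W.indicator (fun w : ℝ × ℝ × ℝ => ENNReal.ofReal |w.1 ^ 2 * F w.2|) (R, u) =
        {R : ℝ | R * N u ∈ S}.indicator (fun R => ENNReal.ofReal |F u| * ENNReal.ofReal (R ^ 2)) R := by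
      intro R
      by_cases hR : R * N u ∈ S
      · rw [indicator_of_mem (show (R, u) ∈ W from ⟨hu, hR⟩),
          indicator_of_mem (show R ∈ {R : ℝ | R * N u ∈ S} from hR),
          ← ENNReal.ofReal_mul (abs_nonneg _), abs_mul, abs_of_nonneg (sq_nonneg R), mul_comm]
      · rw [indicator_of_notMem (show (R, u) ∉ W from fun h => hR h.2),
          indicator_of_notMem (show R ∉ {R : ℝ | R * N u ∈ S} from hR)]
    simp_rw [this]
    rw [lintegral_indicator hSm, lintegral_const_mul _ (by fun_prop), hk _ (Npos u hu),
      ← ENNReal.ofReal_mul (abs_nonneg _)]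
    congr 1; ring
  · rw [indicator_of_notMem hu]
    have : ∀ R : ℝ, W.indicator (fun w : ℝ × ℝ × ℝ => ENNReal.ofReal |w.1 ^ 2 * F w.2|) (R, u) = 0 := by
      intro R
      exact indicator_of_notMem (fun h => hu h.1) _
    simp_rw [this, lintegral_zero]

/-- Every change of measure goes through this lemma: a measure on a family of rays is read off from
the volume of the cone they fill, so two parametrizations of the same rays can be compared. `N u`
plays the role of the length of `Ψ u`, `S` is the set of admissible lengths, and `hk` is the radial
integral of the Jacobian factor R². -/
theorem volume_cone_image {U : Set (ℝ × ℝ)} (hU : MeasurableSet U) {Ψ Ψ1 Ψ2 : ℝ × ℝ → Fin 3 → ℝ}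
    (hd : ∀ u ∈ U, HasFDerivAt Ψ ((ContinuousLinearMap.fst ℝ ℝ ℝ).smulRight (Ψ1 u) +
      (ContinuousLinearMap.snd ℝ ℝ ℝ).smulRight (Ψ2 u)) u)
    {N : ℝ × ℝ → ℝ} (hN : Measurable N) {S : Set ℝ} (hS : MeasurableSet S)
    (hF : Measurable fun u => tri (Ψ u) (Ψ1 u) (Ψ2 u))
    {k : ℝ} (Npos : ∀ u ∈ U, 0 < N u)
    (hk : ∀ N : ℝ, 0 < N → ∫⁻ R in {R | R * N ∈ S}, ENNReal.ofReal (R ^ 2) =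
      ENNReal.ofReal (k / N ^ 3))
    (inj : ∀ u ∈ U, ∀ u' ∈ U, ∀ R R' : ℝ, R * N u ∈ S → R' * N u' ∈ S → R • Ψ u = R' • Ψ u' →
      R = R' ∧ u = u') :
    volume {z | ∃ u ∈ U, ∃ R : ℝ, R * N u ∈ S ∧ z = R • Ψ u} =
      ∫⁻ u in U, ENNReal.ofReal (k * |tri (Ψ u) (Ψ1 u) (Ψ2 u)| / N u ^ 3) := by
  rw [← lintegral_coords hU hN hS hF Npos hk]
  set W := {v : Fin 3 → ℝ | (v 1, v 2) ∈ U ∧ v 0 * N (v 1, v 2) ∈ S} with hW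
  have hm : Measurable fun v : Fin 3 → ℝ => (v 1, v 2) := by fun_prop
  have hWm : MeasurableSet W :=
    (hm hU).inter (((measurable_pi_apply 0).mul (hN.comp hm)) hS)
  have key := lintegral_abs_det_fderiv_eq_addHaar_image volume hWm
    (f := fun v : Fin 3 → ℝ => v 0 • Ψ (v 1, v 2))
    (f' := fun v => coneDeriv (v 0) (Ψ (v 1, v 2)) (Ψ1 (v 1, v 2)) (Ψ2 (v 1, v 2)))
    (fun v hv => (hasFDerivAt_cone (hd _ hv.1)).hasFDerivWithinAt) ?_
  · simp only [det_coneDeriv] at key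
    rw [key]
    congr 1
    ext z
    constructor
    · rintro ⟨u, hu, R, hR, rfl⟩
      exact ⟨![R, u.1, u.2], ⟨by simpa using hu, by simpa using hR⟩, by simp⟩
    · rintro ⟨v, hv, rfl⟩
      exact ⟨(v 1, v 2), hv.1, v 0, hv.2, rfl⟩
  · intro v hv w hw e
    obtain ⟨h1, h2⟩ := inj _ hv.1 _ hw.1 _ _ hv.2 hw.2 e
    simp only [Prod.mk.injEq] at h2
    ext i; fin_cases i
    · exact h1
    · exact h2.1
    · exact h2.2

theorem lintegral_sq_Ioo {a b : ℝ} (hab : a ≤ b) :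
    ∫⁻ R in Ioo a b, ENNReal.ofReal (R ^ 2) = ENNReal.ofReal ((b ^ 3 - a ^ 3) / 3) := by
  rw [← ofReal_integral_eq_lintegral_ofReal]
  · rw [← integral_Ioc_eq_integral_Ioo, ← intervalIntegral.integral_of_le hab, integral_pow]
    norm_num
  · exact ((continuous_pow 2).integrableOn_Icc).mono_set Ioo_subset_Icc_self
  · exact Filter.Eventually.of_forall fun x => sq_nonneg x

theorem lintegral_sq_unit (N : ℝ) (hN : 0 < N) :
    ∫⁻ R in {R | R * N ∈ Ioo (0 : ℝ) 1}, ENNReal.ofReal (R ^ 2) =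
      ENNReal.ofReal (1 / 3 / N ^ 3) := by
  have : {R | R * N ∈ Ioo (0 : ℝ) 1} = Ioo 0 (1 / N) := by
    ext R
    simp only [mem_ofPred_eq, mem_Ioo, lt_div_iff₀ hN]
    constructor
    · exact fun h => ⟨pos_of_mul_pos_left h.1 hN.le, h.2⟩
    · exact fun h => ⟨mul_pos h.1 hN, h.2⟩
  rw [this, lintegral_sq_Ioo (by positivity)]
  congr 1; field_simp; ring

/-- For conormals negative R are admitted as well, since n and −n define the same geodesic; this
doubles the constant. -/
theorem lintegral_sq_punctured (N : ℝ) (hN : 0 < N) :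
    ∫⁻ R in {R | R * N ∈ {r : ℝ | 0 < |r| ∧ |r| < 1}}, ENNReal.ofReal (R ^ 2) =
      ENNReal.ofReal (2 / 3 / N ^ 3) := by
  have : {R | R * N ∈ {r : ℝ | 0 < |r| ∧ |r| < 1}} = Ioo (-(1 / N)) (1 / N) \ {0} := by
    ext R
    simp only [mem_ofPred_eq, mem_sdiff, mem_Ioo, mem_singleton_iff, abs_pos, abs_lt, ← neg_div,
      div_lt_iff₀ hN, lt_div_iff₀ hN]
    constructor
    · exact fun h => ⟨h.2, fun h0 => h.1 (by simp [h0])⟩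
    · exact fun h => ⟨mul_ne_zero h.2 hN.ne', h.1⟩
  rw [this, setLIntegral_congr (sdiff_null_ae_eq_self (by simp)), lintegral_sq_Ioo (by
    have : 0 < 1 / N := by positivity
    linarith)]
  congr 1; field_simp; ring

/-! ### Null sets -/

theorem volume_plane {n : Fin 3 → ℝ} (hn : n ≠ 0) : volume {z : Fin 3 → ℝ | dot n z = 0} = 0 := by
  let f : (Fin 3 → ℝ) →ₗ[ℝ] ℝ :=
    { toFun := dot n
      map_add' := fun x y => by simp [dot]; ring
      map_smul' := fun r x => by simp [dot]; ring }
  have h := Measure.addHaar_submodule volume (LinearMap.ker f) (fun htop => hn ?_)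
  · exact h
  · have h1 : ∀ z, dot n z = 0 := fun z => by
      have : z ∈ LinearMap.ker f := by rw [htop]; trivial
      exact this
    ext i
    have := h1 (Pi.single i 1)
    fin_cases i <;> simpa [dot] using this

theorem volume_line {a : Fin 3 → ℝ} (ha : a ≠ 0) : volume {z : Fin 3 → ℝ | cr a z = 0} = 0 := by
  have : ∃ i, a i ≠ 0 := by
    by_contra hcon
    push Not at hcon
    exact ha (funext hcon)
  obtain ⟨i, hi⟩ := this
  have hb : ∃ n : Fin 3 → ℝ, n ≠ 0 ∧ {z : Fin 3 → ℝ | cr a z = 0} ⊆ {z | dot n z = 0} := by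
    have key : ∀ z : Fin 3 → ℝ, cr a z = 0 → a 1 * z 2 - a 2 * z 1 = 0 ∧ a 2 * z 0 - a 0 * z 2 = 0 := by
      intro z hz
      exact ⟨by simpa [cr] using congrFun hz 0, by simpa [cr] using congrFun hz 1⟩
    by_cases h2 : a 1 = 0 ∧ a 2 = 0
    · refine ⟨![a 2, 0, -a 0], fun h => ?_, fun z hz => ?_⟩
      · have h0 : a 0 = 0 := by simpa using congrFun h 2
        fin_cases i
        · exact hi h0
        · exact hi h2.1
        · exact hi h2.2
      · have := (key z hz).2
        simp [dot]; linarith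
    · refine ⟨![0, -a 2, a 1], fun h => h2 ⟨by simpa using congrFun h 2, ?_⟩, fun z hz => ?_⟩
      · simpa using congrFun h 1
      · have := (key z hz).1
        simp [dot]; linarith
  obtain ⟨n, hn, hsub⟩ := hb
  exact measure_mono_null hsub (volume_plane hn)

/-! ### Polar coordinates -/

theorem exists_angle {a b : ℝ} (h : a ^ 2 + b ^ 2 = 1) :
    ∃ θ ∈ Ico (0 : ℝ) (2 * Real.pi), Real.cos θ = a ∧ Real.sin θ = b := by
  set z : ℂ := ⟨a, b⟩ with hz
  have hn : ‖z‖ = 1 := by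
    rw [Complex.norm_eq_sqrt_sq_add_sq, hz, h, Real.sqrt_one]
  have hz0 : z ≠ 0 := by
    intro h0
    rw [h0, norm_zero] at hn
    exact zero_ne_one hn
  have h1 : Real.cos z.arg = a := by rw [Complex.cos_arg hz0, hn, div_one]
  have h2 : Real.sin z.arg = b := by rw [Complex.sin_arg, hn, div_one]
  by_cases h3 : 0 ≤ z.arg
  · exact ⟨z.arg, ⟨h3, by linarith [Complex.arg_le_pi z, Real.pi_pos]⟩, h1, h2⟩
  · refine ⟨z.arg + 2 * Real.pi, ⟨by linarith [Complex.neg_pi_lt_arg z, Real.pi_pos], ?_⟩, ?_, ?_⟩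
    · linarith
    · rw [Real.cos_add_two_pi, h1]
    · rw [Real.sin_add_two_pi, h2]

theorem angle_inj {θ θ' : ℝ} (h : θ ∈ Ico (0 : ℝ) (2 * Real.pi)) (h' : θ' ∈ Ico (0 : ℝ) (2 * Real.pi))
    (hc : Real.cos θ = Real.cos θ') (hs : Real.sin θ = Real.sin θ') : θ = θ' := by
  have h1 : Real.cos (θ - θ') = 1 := by
    rw [Real.cos_sub, hc, hs]; nlinarith [Real.sin_sq_add_cos_sq θ']
  have := (Real.cos_eq_one_iff_of_lt_of_lt (by linarith [h.1, h'.2]) (by linarith [h.2, h'.1])).1 h1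
  linarith

theorem hasFDerivAt_of_coord {Ψ : ℝ × ℝ → Fin 3 → ℝ} {P1 P2 : Fin 3 → ℝ} {u : ℝ × ℝ}
    (h : ∀ i, HasFDerivAt (fun v => Ψ v i) ((P1 i) • ContinuousLinearMap.fst ℝ ℝ ℝ +
      (P2 i) • ContinuousLinearMap.snd ℝ ℝ ℝ) u) :
    HasFDerivAt Ψ ((ContinuousLinearMap.fst ℝ ℝ ℝ).smulRight P1 +
      (ContinuousLinearMap.snd ℝ ℝ ℝ).smulRight P2) u := by
  rw [hasFDerivAt_pi']
  intro i
  refine (h i).congr_fderiv ?_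
  ext <;> simp

theorem hasFDerivAt_fst_mul_snd {f g : ℝ → ℝ} {f' g' : ℝ} {u : ℝ × ℝ} (hf : HasDerivAt f f' u.1)
    (hg : HasDerivAt g g' u.2) : HasFDerivAt (fun v : ℝ × ℝ => f v.1 * g v.2)
      ((f' * g u.2) • ContinuousLinearMap.fst ℝ ℝ ℝ +
        (f u.1 * g') • ContinuousLinearMap.snd ℝ ℝ ℝ) u := by
  have h1 : HasFDerivAt (fun v : ℝ × ℝ => f v.1) (f' • ContinuousLinearMap.fst ℝ ℝ ℝ) u :=
    HasDerivAt.comp_hasFDerivAt (f := fun v : ℝ × ℝ => v.1) u hf hasFDerivAt_fst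
  have h2 : HasFDerivAt (fun v : ℝ × ℝ => g v.2) (g' • ContinuousLinearMap.snd ℝ ℝ ℝ) u :=
    HasDerivAt.comp_hasFDerivAt (f := fun v : ℝ × ℝ => v.2) u hg hasFDerivAt_snd
  refine (h1.mul h2).congr_fderiv ?_
  ext <;> simp [mul_comm]

theorem measurable_proj (K : ℝ) : Measurable (proj K) := by
  classical
  have h1 : MeasurableSet {z | InCone K z} := (isOpen_inCone K).measurableSet
  have h2 : Measurable fun z : Fin 3 → ℝ => (√(quad K z z))⁻¹ • z :=
    ((continuous_id.quad continuous_id).sqrt.measurable.inv).smul measurable_id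
  have h3 : Measurable fun z : Fin 3 → ℝ =>
      if InCone K z then (√(quad K z z))⁻¹ • z else (polarPoint K 0 0).1 :=
    Measurable.ite h1 h2 measurable_const
  have h4 : ∀ z, (proj K z).1 = if InCone K z then (√(quad K z z))⁻¹ • z else (polarPoint K 0 0).1 := by
    intro z
    rw [proj]; split_ifs <;> rfl
  have h5 : proj K = fun z => (⟨if InCone K z then (√(quad K z z))⁻¹ • z else (polarPoint K 0 0).1,
      by rw [← h4]; exact (proj K z).2⟩ : Space K) := funext fun z => Subtype.ext (h4 z)
  rw [h5]
  exact h3.subtype_mk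

/-- The part of the cone over `E` inside the unit ball of `quad`. -/
def unitCone {K : ℝ} (E : Set (Space K)) : Set (Fin 3 → ℝ) :=
  {z | InCone K z ∧ quad K z z < 1 ∧ proj K z ∈ E}

theorem InCone.smul {K r : ℝ} {z : Fin 3 → ℝ} (h : InCone K z) (hr : 0 < r) : InCone K (r • z) := by
  rw [h.eq_smul_proj, smul_smul]
  exact inCone_smul (mul_pos hr (Real.sqrt_pos.2 h.1)) _

theorem InCone.proj_smul {K r : ℝ} {z : Fin 3 → ℝ} (h : InCone K z) (hr : 0 < r) :
    proj K (r • z) = proj K z := by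
  conv_lhs => rw [h.eq_smul_proj, smul_smul]
  exact XK.proj_smul (mul_pos hr (Real.sqrt_pos.2 h.1)) _

theorem smul_mem_unitCone {K r : ℝ} {E : Set (Space K)} {z : Fin 3 → ℝ} (hz : InCone K z)
    (hr : r * √(quad K z z) ∈ Ioo (0 : ℝ) 1) (hE : proj K z ∈ E) : r • z ∈ unitCone E := by
  have h1 := Real.sqrt_pos.2 hz.1
  have h2 : 0 < r := pos_of_mul_pos_left hr.1 h1.le
  refine ⟨hz.smul h2, ?_, by rwa [hz.proj_smul h2]⟩
  have h3 := Real.mul_self_sqrt hz.1.le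
  rw [quad_smul_smul, ← h3]
  nlinarith [hr.1, hr.2]

theorem measurableSet_bounded (K a : ℝ) : MeasurableSet {r : ℝ | 0 < r ∧ (0 < K → r < a)} := by
  have h2 : MeasurableSet {r : ℝ | 0 < K → r < a} := by
    by_cases hK : 0 < K
    · have : {r : ℝ | 0 < K → r < a} = Iio a := by ext; simp [hK]
      rw [this]; exact measurableSet_Iio
    · have : {r : ℝ | 0 < K → r < a} = univ := by ext; simp [hK]
      rw [this]; exact MeasurableSet.univ
  exact measurableSet_Ioi.inter h2

theorem volume_congr_of_sub {A B N : Set (Fin 3 → ℝ)} (h1 : A ⊆ B) (h2 : B ⊆ A ∪ N)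
    (h3 : volume N = 0) : volume A = volume B := by
  refine le_antisymm (measure_mono h1) ?_
  calc volume B ≤ volume (A ∪ N) := measure_mono h2
    _ ≤ volume A + volume N := measure_union_le _ _
    _ = volume A := by rw [h3, add_zero]

/-- Polar coordinates miss only the axis through the base point, and the triple product of the polar
point with its two derivatives is sin_K r. -/
theorem volume_unitCone {K : ℝ} {E : Set (Space K)} (hE : MeasurableSet E) :
    volume (unitCone E) = ENNReal.ofReal (1 / 3) * area K E := by
  set P : Set (ℝ × ℝ) := {r : ℝ | 0 < r ∧ (0 < K → r < Real.pi / √K)} ×ˢ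
      Ico (0 : ℝ) (2 * Real.pi) with hP
  have hm : Measurable fun z : ℝ × ℝ => polarPoint K z.1 z.2 := (continuous_polarPoint K).measurable
  have hPm : MeasurableSet P := by
    exact (measurableSet_bounded K _).prod measurableSet_Ico
  set U := P ∩ (fun z : ℝ × ℝ => polarPoint K z.1 z.2) ⁻¹' E with hU
  have hUm : MeasurableSet U := hPm.inter (hm hE)
  have hsin : ∀ u ∈ U, 0 < sinK K u.1 := fun u hu => sinK_pos hu.1.1.1 hu.1.1.2
  have harea : area K E = ∫⁻ u in U, ENNReal.ofReal (sinK K u.1) := by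
    rw [area, Measure.map_apply hm hE, withDensity_apply _ (hm hE),
      Measure.restrict_restrict (hm hE), inter_comm]
  have key := volume_cone_image hUm (Ψ := fun u => (polarPoint K u.1 u.2).1)
    (Ψ1 := fun u => ![-K * sinK K u.1, cosK K u.1 * Real.cos u.2, cosK K u.1 * Real.sin u.2])
    (Ψ2 := fun u => ![0, sinK K u.1 * -Real.sin u.2, sinK K u.1 * Real.cos u.2])
    (N := fun _ => 1) (S := Ioo 0 1) (k := 1 / 3) ?_ measurable_const measurableSet_Ioo ?_
    (fun _ _ => one_pos) lintegral_sq_unit ?_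
  · have htri : ∀ u : ℝ × ℝ, tri (polarPoint K u.1 u.2).1
        ![-K * sinK K u.1, cosK K u.1 * Real.cos u.2, cosK K u.1 * Real.sin u.2]
        ![0, sinK K u.1 * -Real.sin u.2, sinK K u.1 * Real.cos u.2] = sinK K u.1 := by
      intro u
      have h1 := cosK_sq_add K u.1
      have h2 := Real.sin_sq_add_cos_sq u.2
      simp only [tri, polarPoint, Matrix.cons_val_zero, Matrix.cons_val_one, Matrix.cons_val]
      linear_combination (sinK K u.1 * (cosK K u.1 ^ 2 + K * sinK K u.1 ^ 2)) * h2 + sinK K u.1 * h1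
    rw [harea, ← lintegral_const_mul' _ _ ENNReal.ofReal_ne_top]
    have e : ∫⁻ u in U, ENNReal.ofReal (1 / 3) * ENNReal.ofReal (sinK K u.1) =
        ∫⁻ u in U, ENNReal.ofReal (1 / 3 * |tri (polarPoint K u.1 u.2).1
        ![-K * sinK K u.1, cosK K u.1 * Real.cos u.2, cosK K u.1 * Real.sin u.2]
        ![0, sinK K u.1 * -Real.sin u.2, sinK K u.1 * Real.cos u.2]| / 1 ^ 3) := by
      refine setLIntegral_congr_fun hUm fun u hu => ?_
      rw [htri, abs_of_pos (hsin u hu), ← ENNReal.ofReal_mul (by norm_num)]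
      congr 1; ring
    rw [e, ← key]
    symm
    refine volume_congr_of_sub (N := {z | cr ![1, 0, 0] z = 0}) ?_ ?_
      (volume_line fun h => by simpa using congrFun h 0)
    · rintro _ ⟨u, hu, R, hR, rfl⟩
      refine smul_mem_unitCone (inCone_point _) ?_ ?_
      · rw [(polarPoint K u.1 u.2).2.1, Real.sqrt_one]; exact hR
      · rw [proj_point]; exact hu.2
    · intro z hz
      by_cases hcr : cr ![1, 0, 0] z = 0
      · exact Or.inr hcr
      left
      have hr := Real.sqrt_pos.2 hz.1.1
      set x := proj K z with hx
      have hxz : z = √(quad K z z) • x.1 := hz.1.eq_smul_proj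
      set σ := √(x.1 1 ^ 2 + x.1 2 ^ 2) with hσ
      have hσ2 : σ ^ 2 = x.1 1 ^ 2 + x.1 2 ^ 2 := Real.sq_sqrt (by positivity)
      have hσ0 : 0 < σ := by
        refine Real.sqrt_pos.2 (lt_of_le_of_ne (by positivity) fun h => hcr ?_)
        have h1 : x.1 1 = 0 := by nlinarith [sq_nonneg (x.1 1), sq_nonneg (x.1 2)]
        have h2 : x.1 2 = 0 := by nlinarith [sq_nonneg (x.1 1), sq_nonneg (x.1 2)]
        rw [hxz]
        ext i; fin_cases i <;> simp [cr, h1, h2]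
      have hq : x.1 0 ^ 2 + K * σ ^ 2 = 1 := by
        rw [hσ2]; have := x.2.1; simp only [quad] at this; linarith
      obtain ⟨e1, e2⟩ := cosK_sinK_arcK hq hσ0.le fun hK => x.2.2 hK
      obtain ⟨θ, hθ, t1, t2⟩ := exists_angle (a := x.1 1 / σ) (b := x.1 2 / σ) (by
        field_simp; linarith)
      set r := arcK K (x.1 0) σ
      have hxp : x = polarPoint K r θ := by
        apply Subtype.ext
        ext i
        fin_cases i
        · simp [polarPoint, e1]
        · simp [polarPoint, e2, t1]; field_simp
        · simp [polarPoint, e2, t2]; field_simp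
      refine ⟨(r, θ), ⟨⟨⟨?_, fun hK => ?_⟩, hθ⟩, ?_⟩, √(quad K z z), ⟨by simpa using hr, ?_⟩, ?_⟩
      · refine lt_of_le_of_ne (arcK_nonneg _ _ hσ0.le) fun h => ?_
        rw [show r = 0 from h.symm, sinK_zero] at e2
        exact hσ0.ne e2
      · refine lt_of_le_of_ne (arcK_le_pi _ _ hK) fun h => ?_
        rw [show r = Real.pi / √K from h, sinK_pi hK] at e2
        exact hσ0.ne e2
      · show polarPoint K r θ ∈ E
        rw [← hxp]; exact hz.2.2
      · rw [mul_one, Real.sqrt_lt' one_pos]; simpa using hz.2.1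
      · show z = _ • (polarPoint K r θ).1
        rw [← hxp]; exact hxz
  · intro u _
    refine hasFDerivAt_of_coord fun i => ?_
    have hc := hasDerivAt_cosK K u.1
    have hs := hasDerivAt_sinK K u.1
    fin_cases i
    · simpa [polarPoint] using hasFDerivAt_fst_mul_snd hc (hasDerivAt_const u.2 (1 : ℝ))
    · simpa [polarPoint] using hasFDerivAt_fst_mul_snd hs (Real.hasDerivAt_cos u.2)
    · simpa [polarPoint] using hasFDerivAt_fst_mul_snd hs (Real.hasDerivAt_sin u.2)
  · have h1 := (continuous_sinK K)
    have h2 := (continuous_cosK K)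
    apply Continuous.measurable
    refine Continuous.tri (continuous_subtype_val.comp (continuous_polarPoint K)) ?_ ?_ <;>
    · refine continuous_pi fun i => ?_
      fin_cases i <;> simp <;> fun_prop
  · intro u hu u' hu' R R' hR hR' e
    have hR0 : 0 < R := by simpa using hR.1
    have hR0' : 0 < R' := by simpa using hR'.1
    have hRR : R = R' := by
      have := congrArg (fun z => quad K z z) e
      simp only [quad_smul_smul, (polarPoint K _ _).2.1] at this
      nlinarith
    subst hRR
    have e' := smul_right_injective _ hR0.ne' e
    have c0 : cosK K u.1 = cosK K u'.1 := by simpa [polarPoint] using congrFun e' 0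
    have c1 : sinK K u.1 * Real.cos u.2 = sinK K u'.1 * Real.cos u'.2 := by
      simpa [polarPoint] using congrFun e' 1
    have c2 : sinK K u.1 * Real.sin u.2 = sinK K u'.1 * Real.sin u'.2 := by
      simpa [polarPoint] using congrFun e' 2
    have hs := hsin u hu
    have hs' := hsin u' hu'
    have hss : sinK K u.1 = sinK K u'.1 := by
      have h1 : sinK K u.1 ^ 2 = sinK K u'.1 ^ 2 := by
        have a1 := Real.sin_sq_add_cos_sq u.2
        have a2 := Real.sin_sq_add_cos_sq u'.2
        calc sinK K u.1 ^ 2 = (sinK K u.1 * Real.cos u.2) ^ 2 + (sinK K u.1 * Real.sin u.2) ^ 2 := by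
              linear_combination (-sinK K u.1 ^ 2) * a1
          _ = (sinK K u'.1 * Real.cos u'.2) ^ 2 + (sinK K u'.1 * Real.sin u'.2) ^ 2 := by rw [c1, c2]
          _ = sinK K u'.1 ^ 2 := by linear_combination (sinK K u'.1 ^ 2) * a2
      nlinarith
    refine ⟨rfl, Prod.ext ?_ ?_⟩
    · rw [← arcK_cosK_sinK (K := K) hu.1.1.1.le fun hK => (hu.1.1.2 hK).le, c0, hss,
        arcK_cosK_sinK hu'.1.1.1.le fun hK => (hu'.1.1.2 hK).le]
    · rw [hss] at c1 c2
      exact angle_inj hu.1.2 hu'.1.2 (mul_left_cancel₀ hs'.ne' c1) (mul_left_cancel₀ hs'.ne' c2)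

/-! ### Polar coordinates about a point of a convex domain -/

namespace Domain

variable {K : ℝ} {D : Set (Space K)} {c : ℝ → Space K} {T : ℝ}

theorem volume_frontier_cone (h : Domain D c T) : volume (frontier (cone D)) = 0 :=
  (convex_cone h.convex).addHaar_frontier volume

theorem tri_interior_ne (h : Domain D c T) {z : Space K} (hz : z ∈ interior D) (t : ℝ) :
    tri (c t).1 (vel c t) z.1 ≠ 0 := by
  obtain ⟨ε, hε, ho⟩ := h.exists_orientation
  intro h0
  have := (ho t).2 z hz
  simp [h0] at this

theorem eq_of_smul {a b : ℝ} {x y : Space K} (ha : 0 < a) (hb : 0 < b) (e : a • x.1 = b • y.1) :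
    a = b ∧ x = y := by
  have h1 := congrArg (fun z => quad K z z) e
  simp only [quad_smul_smul, x.2.1, y.2.1] at h1
  have h2 : a = b := by nlinarith
  subst h2
  exact ⟨rfl, Subtype.ext (smul_right_injective _ ha.ne' e)⟩

/-- The supporting functional at c t vanishes at c t, is positive at y and nonnegative at c t',
which gives R ≥ R'. Exchanging the roles gives equality, and y cancels. -/
theorem ray_inj (h : Domain D c T) {y : Space K} (hy : y ∈ D) {R R' b b' t t' : ℝ}
    (hR : 0 < R) (hR' : 0 < R') (hb : 0 < b) (hb' : 0 < b') (ht : t ∈ Ico 0 T) (ht' : t' ∈ Ico 0 T)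
    (h0 : tri (c t).1 (vel c t) y.1 ≠ 0) (h0' : tri (c t').1 (vel c t') y.1 ≠ 0)
    (e : R • (y.1 + b • (c t).1) = R' • (y.1 + b' • (c t').1)) : R = R' ∧ b = b' ∧ t = t' := by
  obtain ⟨ε, hε, ho⟩ := h.exists_orientation
  have key : ∀ R R' b b' t t' : ℝ, 0 < R' → 0 < b' → tri (c t).1 (vel c t) y.1 ≠ 0 →
      R • (y.1 + b • (c t).1) = R' • (y.1 + b' • (c t').1) → R' ≤ R := by
    intro R R' b b' t t' hR' hb' h0 e
    have h1 := congrArg (fun z => ε * tri (c t).1 (vel c t) z) e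
    have h2 : ∀ (r β : ℝ) (z : Fin 3 → ℝ), tri (c t).1 (vel c t) (r • (y.1 + β • z)) =
        r * (tri (c t).1 (vel c t) y.1 + β * tri (c t).1 (vel c t) z) := by
      intro r β z; simp [tri]; ring
    have h3 : tri (c t).1 (vel c t) (c t).1 = 0 := by simp only [tri]; ring
    simp only [h2, h3] at h1
    have h4 : 0 < ε * tri (c t).1 (vel c t) y.1 := by
      refine lt_of_le_of_ne ((ho t).1 y hy) (Ne.symm (mul_ne_zero ?_ h0))
      rcases hε with rfl | rfl <;> norm_num
    have h5 := (ho t).1 _ (h.mem t')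
    have h6 := mul_nonneg (mul_pos hR' hb').le h5
    by_contra hcon
    push Not at hcon
    nlinarith [mul_pos (sub_pos.2 hcon) h4]
  have hRR : R = R' := le_antisymm (key R' R b' b t' t hR hb h0' e.symm) (key R R' b b' t t' hR' hb' h0 e)
  subst hRR
  have e1 := add_left_cancel (smul_right_injective _ hR.ne' e)
  obtain ⟨h1, h2⟩ := eq_of_smul hb hb' e1
  exact ⟨rfl, h1, h.bd.injOn ht ht' h2⟩

/-- Coordinates on D adapted to a point y: (b,t) names the projection of y + b c(t), a point of the
chord from y to c(t). The choice of y in the interior serves the defect identity; y on the boundary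
serves the exchange of integrals. -/
theorem area_restrict (h : Domain D c T) {y : Space K} (hy : y ∈ D) :
    (area K).restrict D = Measure.map (fun u : ℝ × ℝ => proj K (y.1 + u.1 • (c u.2).1))
      ((volume.restrict (Ioi 0 ×ˢ Ico 0 T)).withDensity fun u => ENNReal.ofReal
        (u.1 * |tri (c u.2).1 (vel c u.2) y.1| /
          √(quad K (y.1 + u.1 • (c u.2).1) (y.1 + u.1 • (c u.2).1)) ^ 3)) := by
  have hcc := h.continuous_coe
  have hcv := h.continuous_vel
  have hΨc : Continuous fun u : ℝ × ℝ => y.1 + u.1 • (c u.2).1 :=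
    continuous_const.add (continuous_fst.smul (hcc.comp continuous_snd))
  have hm : Measurable fun u : ℝ × ℝ => proj K (y.1 + u.1 • (c u.2).1) :=
    (measurable_proj K).comp hΨc.measurable
  have hNm : Measurable fun u : ℝ × ℝ =>
      √(quad K (y.1 + u.1 • (c u.2).1) (y.1 + u.1 • (c u.2).1)) := (hΨc.quad hΨc).sqrt.measurable
  have htm : Measurable fun u : ℝ × ℝ => tri (c u.2).1 (vel c u.2) y.1 :=
    ((hcc.comp continuous_snd).tri (hcv.comp continuous_snd) continuous_const).measurable
  ext E hE
  rw [Measure.restrict_apply hE, Measure.map_apply hm hE, withDensity_apply _ (hm hE),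
    Measure.restrict_restrict (hm hE)]
  have h3 : area K (E ∩ D) = 3 * volume (unitCone (E ∩ D)) := by
    rw [volume_unitCone (hE.inter h.compact.measurableSet), ← mul_assoc]
    have : (3 : ENNReal) * ENNReal.ofReal (1 / 3) = 1 := by
      rw [show (3 : ENNReal) = ENNReal.ofReal 3 by norm_num, ← ENNReal.ofReal_mul (by norm_num)]
      norm_num
    rw [this, one_mul]
  have hInC : ∀ u : ℝ × ℝ, 0 < u.1 → y.1 + u.1 • (c u.2).1 ∈ cone D := by
    intro u hu
    have := comb_mem_cone h.convex hy (h.mem u.2) zero_le_one hu.le (by linarith)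
    simpa using this
  set Q := (fun u : ℝ × ℝ => proj K (y.1 + u.1 • (c u.2).1)) ⁻¹' E ∩ Ioi 0 ×ˢ Ico 0 T with hQ
  have hQm : MeasurableSet Q := (hm hE).inter (measurableSet_Ioi.prod measurableSet_Ico)
  -- Where the tangent geodesic at c(t) passes through y injectivity may fail; these parameters have
  -- density 0 and are removed.
  set U := Q ∩ {u | tri (c u.2).1 (vel c u.2) y.1 ≠ 0} with hU
  have hUm : MeasurableSet U := hQm.inter (htm (measurableSet_singleton 0).compl)
  have htri : ∀ u : ℝ × ℝ, tri (y.1 + u.1 • (c u.2).1) (c u.2).1 (u.1 • vel c u.2) =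
      u.1 * tri (c u.2).1 (vel c u.2) y.1 := by
    intro u; simp [tri]; ring
  have key := volume_cone_image hUm (Ψ := fun u => y.1 + u.1 • (c u.2).1)
    (Ψ1 := fun u => (c u.2).1) (Ψ2 := fun u => u.1 • vel c u.2)
    (N := fun u => √(quad K (y.1 + u.1 • (c u.2).1) (y.1 + u.1 • (c u.2).1)))
    (S := Ioo 0 1) (k := 1 / 3) ?_ hNm measurableSet_Ioo ?_
    (fun u hu => Real.sqrt_pos.2 (hInC u hu.1.2.1).1.1) lintegral_sq_unit ?_
  · have hvol : volume {z | ∃ u ∈ U, ∃ R : ℝ,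
        R * √(quad K (y.1 + u.1 • (c u.2).1) (y.1 + u.1 • (c u.2).1)) ∈ Ioo (0 : ℝ) 1 ∧
          z = R • (y.1 + u.1 • (c u.2).1)} = volume (unitCone (E ∩ D)) := by
      refine volume_congr_of_sub (N := frontier (cone D) ∪ {z | cr y.1 z = 0}) ?_ ?_ ?_
      · rintro _ ⟨u, hu, R, hR, rfl⟩
        have hc := hInC u hu.1.2.1
        exact smul_mem_unitCone hc.1 hR ⟨hu.1.1, hc.2⟩
      · intro z hz
        by_cases hcr : cr y.1 z = 0
        · exact Or.inr (Or.inr hcr)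
        by_cases hzi : z ∈ interior (cone D)
        swap
        · exact Or.inr (Or.inl ⟨subset_closure ⟨hz.1, hz.2.2.2⟩, hzi⟩)
        left
        have hr := Real.sqrt_pos.2 hz.1.1
        have hxi := (mem_interior_cone.1 hzi).2
        set x := proj K z with hx
        have hxz : z = √(quad K z z) • x.1 := hz.1.eq_smul_proj
        have hyx : y ≠ x := by
          rintro rfl
          apply hcr
          rw [hxz]
          ext i; fin_cases i <;> simp [cr] <;> ring
        obtain ⟨w, hw, α, β, hα, hβ, e⟩ := exists_exit h.compact h.convex hy hz.2.2.2 hyx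
        obtain ⟨t, ht, rfl⟩ := h.exists_param hw
        have hα0 : 0 < α := by
          refine lt_of_le_of_ne hα fun h0 => h.not_mem_interior t ?_
          rw [← h0, zero_smul, zero_add] at e
          have := (eq_of_smul one_pos hβ (by rw [one_smul]; exact e)).2
          rwa [← this]
        have hz' : z = (√(quad K z z) * α) • (y.1 + (β / α) • (c t).1) := by
          rw [mul_smul, smul_add, smul_smul α (β / α), mul_div_cancel₀ _ hα0.ne', ← e]
          exact hxz
        have hRpos : 0 < √(quad K z z) * α := mul_pos hr hα0
        have hc := hInC (β / α, t) (div_pos hβ hα0)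
        have hpr : proj K (y.1 + (β / α) • (c t).1) = x := by
          rw [← hc.1.proj_smul hRpos, ← hz']
        refine ⟨(β / α, t), ⟨⟨?_, div_pos hβ hα0, ht⟩, ?_⟩, √(quad K z z) * α, ?_, hz'⟩
        · show proj K (y.1 + (β / α) • (c t).1) ∈ E
          rw [hpr]; exact hz.2.2.1
        · show tri (c t).1 (vel c t) y.1 ≠ 0
          intro h0
          apply h.tri_interior_ne hxi t
          rw [e, show tri (c t).1 (vel c t) (α • y.1 + β • (c t).1) =
            α * tri (c t).1 (vel c t) y.1 by simp [tri]; ring, h0, mul_zero]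
        · have e2 : √(quad K z z) = √(quad K z z) * α *
              √(quad K (y.1 + (β / α) • (c t).1) (y.1 + (β / α) • (c t).1)) := by
            conv_lhs => rw [hz', quad_smul_smul, Real.sqrt_mul (mul_self_nonneg _),
              Real.sqrt_mul_self hRpos.le]
          show _ * √(quad K (y.1 + (β / α) • (c t).1) (y.1 + (β / α) • (c t).1)) ∈ _
          rw [← e2]
          exact ⟨hr, by rw [Real.sqrt_lt' one_pos]; simpa using hz.2.1⟩
      · refine measure_union_null h.volume_frontier_cone (volume_line fun h0 => ?_)
        have := y.2.1
        simp [h0, quad] at this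
    rw [h3, ← hvol, key, ← lintegral_const_mul' _ _ (by norm_num)]
    have hsub : ∫⁻ u in Q, ENNReal.ofReal (u.1 * |tri (c u.2).1 (vel c u.2) y.1| /
          √(quad K (y.1 + u.1 • (c u.2).1) (y.1 + u.1 • (c u.2).1)) ^ 3) =
        ∫⁻ u in U, ENNReal.ofReal (u.1 * |tri (c u.2).1 (vel c u.2) y.1| /
          √(quad K (y.1 + u.1 • (c u.2).1) (y.1 + u.1 • (c u.2).1)) ^ 3) := by
      rw [← lintegral_indicator hQm, ← lintegral_indicator hUm]
      refine lintegral_congr fun u => ?_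
      by_cases hu : u ∈ U
      · rw [indicator_of_mem hu, indicator_of_mem hu.1]
      · rw [indicator_of_notMem hu]
        by_cases hq : u ∈ Q
        · have : tri (c u.2).1 (vel c u.2) y.1 = 0 := by
            by_contra h0; exact hu ⟨hq, h0⟩
          rw [indicator_of_mem hq, this]; simp
        · rw [indicator_of_notMem hq]
    rw [hsub]
    refine setLIntegral_congr_fun hUm fun u hu => ?_
    have hu0 : 0 < u.1 := hu.1.2.1
    rw [htri, abs_mul, abs_of_pos hu0, show (3 : ENNReal) = ENNReal.ofReal 3 by norm_num,
      ← ENNReal.ofReal_mul (by norm_num)]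
    congr 1; ring
  · intro u _
    refine hasFDerivAt_of_coord fun i => ?_
    have h1 := hasFDerivAt_fst_mul_snd (hasDerivAt_id u.1) (hasDerivAt_pi.1 (h.hasDerivAt u.2) i)
    simpa using h1.const_add (y.1 i)
  · simp only [htri]
    exact measurable_fst.mul htm
  · intro u hu u' hu' R R' hR hR' e
    have p : 0 < R := pos_of_mul_pos_left hR.1 (Real.sqrt_nonneg _)
    have p' : 0 < R' := pos_of_mul_pos_left hR'.1 (Real.sqrt_nonneg _)
    obtain ⟨h1, h2, h3⟩ := h.ray_inj hy p p' hu.1.2.1 hu'.1.2.1 hu.1.2.2 hu'.1.2.2 hu.2 hu'.2 e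
    exact ⟨h1, Prod.ext h2 h3⟩

end Domain

/-! ### The measure on the space of geodesics -/

/-- The set of short conormal vectors of the geodesics in `E`. -/
def normals {K : ℝ} (E : Set (Geodesic K)) : Set (Fin 3 → ℝ) :=
  {n | 0 < dual K n n ∧ dual K n n < 1 ∧ ∃ g ∈ E, ∀ x : Space K, x ∈ g.1 ↔ dot n x.1 = 0}

theorem cosK_pos_of_lt {K w : ℝ} (hw : 0 < w) (h : 0 < K → w < Real.pi / (2 * √K)) :
    0 < cosK K w := by
  by_cases hK : 0 < K
  · have h1 := Real.sqrt_pos.2 hK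
    have h2 := (lt_div_iff₀ (by positivity)).1 (h hK)
    rw [cosK, if_pos hK]
    refine Real.cos_pos_of_mem_Ioo ⟨by have := mul_pos h1 hw; linarith [Real.pi_pos], ?_⟩
    linarith
  · exact cosK_pos (not_lt.1 hK) w

theorem cr_polarTangent (K w η : ℝ) :
    cr (polarTangent K w η).1.1 (polarTangent K w η).1.2 =
      ![sinK K w, cosK K w * -Real.cos η, cosK K w * -Real.sin η] := by
  have h := Real.sin_sq_add_cos_sq η
  ext i; fin_cases i
  · simp [cr, polarTangent, polarPoint]; linear_combination (sinK K w) * h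
  · simp [cr, polarTangent, polarPoint]
  · simp [cr, polarTangent, polarPoint]

/-- Each geodesic carries the two unit conormals ±n, whence 2/3 in place of 1/3. Polar parameters
miss conormals with n₀ = 0, belonging to geodesics through the base point, and those on the zeroth
axis; both sets are null. -/
theorem volume_normals {K : ℝ} {E : Set (Geodesic K)} (hE : MeasurableSet E) :
    volume (normals E) = ENNReal.ofReal (2 / 3) * liouville K E := by
  set P : Set (ℝ × ℝ) := {w : ℝ | 0 < w ∧ (0 < K → w < Real.pi / (2 * √K))} ×ˢ
      Ico (0 : ℝ) (2 * Real.pi) with hP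
  have hm : Measurable (polarGeodesic K) := measurable_polarGeodesic K
  have hPm : MeasurableSet P := (measurableSet_bounded K _).prod measurableSet_Ico
  set U := P ∩ polarGeodesic K ⁻¹' E with hU
  have hUm : MeasurableSet U := hPm.inter (hm hE)
  have hcos : ∀ u ∈ U, 0 < cosK K u.1 := fun u hu => cosK_pos_of_lt hu.1.1.1 hu.1.1.2
  have hlt : 0 < K → Real.pi / (2 * √K) < Real.pi / √K := fun hK => by
    have := Real.sqrt_pos.2 hK
    apply div_lt_div_of_pos_left Real.pi_pos this; linarith
  have hsin : ∀ u ∈ U, 0 < sinK K u.1 := fun u hu =>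
    sinK_pos hu.1.1.1 fun hK => (hu.1.1.2 hK).trans (hlt hK)
  have hliou : liouville K E = ∫⁻ u in U, ENNReal.ofReal (cosK K u.1) := by
    rw [liouville, Measure.map_apply hm hE, withDensity_apply _ (hm hE),
      Measure.restrict_restrict (hm hE), inter_comm]
  have key := volume_cone_image hUm
    (Ψ := fun u => ![sinK K u.1, cosK K u.1 * -Real.cos u.2, cosK K u.1 * -Real.sin u.2])
    (Ψ1 := fun u => ![cosK K u.1, -K * sinK K u.1 * -Real.cos u.2, -K * sinK K u.1 * -Real.sin u.2])
    (Ψ2 := fun u => ![0, cosK K u.1 * Real.sin u.2, cosK K u.1 * -Real.cos u.2])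
    (N := fun _ => 1) (S := {r : ℝ | 0 < |r| ∧ |r| < 1}) (k := 2 / 3) ?_ measurable_const ?_ ?_
    (fun _ _ => one_pos) lintegral_sq_punctured ?_
  · have htri : ∀ u : ℝ × ℝ,
        tri ![sinK K u.1, cosK K u.1 * -Real.cos u.2, cosK K u.1 * -Real.sin u.2]
        ![cosK K u.1, -K * sinK K u.1 * -Real.cos u.2, -K * sinK K u.1 * -Real.sin u.2]
        ![0, cosK K u.1 * Real.sin u.2, cosK K u.1 * -Real.cos u.2] = -cosK K u.1 := by
      intro u
      have h1 := cosK_sq_add K u.1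
      have h2 := Real.sin_sq_add_cos_sq u.2
      simp only [tri, Matrix.cons_val_zero, Matrix.cons_val_one, Matrix.cons_val]
      linear_combination (-cosK K u.1 * (cosK K u.1 ^ 2 + K * sinK K u.1 ^ 2)) * h2 - cosK K u.1 * h1
    rw [hliou, ← lintegral_const_mul' _ _ ENNReal.ofReal_ne_top]
    have e : ∫⁻ u in U, ENNReal.ofReal (2 / 3) * ENNReal.ofReal (cosK K u.1) =
        ∫⁻ u in U, ENNReal.ofReal (2 / 3 *
        |tri ![sinK K u.1, cosK K u.1 * -Real.cos u.2, cosK K u.1 * -Real.sin u.2]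
        ![cosK K u.1, -K * sinK K u.1 * -Real.cos u.2, -K * sinK K u.1 * -Real.sin u.2]
        ![0, cosK K u.1 * Real.sin u.2, cosK K u.1 * -Real.cos u.2]| / 1 ^ 3) := by
      refine setLIntegral_congr_fun hUm fun u hu => ?_
      rw [htri, abs_neg, abs_of_pos (hcos u hu), ← ENNReal.ofReal_mul (by norm_num)]
      congr 1; ring
    rw [e, ← key]
    symm
    refine volume_congr_of_sub (N := {z | dot ![1, 0, 0] z = 0} ∪ {z | cr ![1, 0, 0] z = 0}) ?_ ?_
      (measure_union_null (volume_plane fun h => by simpa using congrFun h 0)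
        (volume_line fun h => by simpa using congrFun h 0))
    · rintro _ ⟨u, hu, R, hR, rfl⟩
      rw [← cr_polarTangent]
      have hR0 : R ≠ 0 := fun h0 => by simp [h0] at hR
      have hd : dual K (R • cr (polarTangent K u.1 u.2).1.1 (polarTangent K u.1 u.2).1.2)
          (R • cr (polarTangent K u.1 u.2).1.1 (polarTangent K u.1 u.2).1.2) = R ^ 2 := by
        have := gram_self_eq_one (polarTangent K u.1 u.2)
        rw [gram] at this
        rw [dual_smul_smul, this]; ring
      refine ⟨by rw [hd]; positivity, ?_, polarGeodesic K u, hu.2, fun x => ?_⟩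
      · rw [hd, ← sq_abs]
        have := hR.2
        rw [mul_one] at this
        exact pow_lt_one₀ (abs_nonneg _) this two_ne_zero
      · rw [dot_smul, polarGeodesic, geodesic_normal]; simp [hR0]
    · intro n hn
      by_cases h0 : dot ![1, 0, 0] n = 0
      · exact Or.inr (Or.inl h0)
      by_cases hcr : cr ![1, 0, 0] n = 0
      · exact Or.inr (Or.inr hcr)
      left
      have hn0 : n 0 ≠ 0 := by simpa [dot] using h0
      obtain ⟨hd1, hd2, g, hg, hgn⟩ := hn
      -- R takes the sign of n₀, so that n₀ / R can be the sine of a distance w > 0.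
      obtain ⟨R, hRsq, hRn⟩ : ∃ R : ℝ, R ^ 2 = dual K n n ∧ 0 < n 0 / R := by
        have hsq := Real.sqrt_pos.2 hd1
        rcases hn0.lt_or_gt with h | h
        · exact ⟨-√(dual K n n), by rw [neg_sq, Real.sq_sqrt hd1.le],
            div_pos_of_neg_of_neg h (by linarith)⟩
        · exact ⟨√(dual K n n), Real.sq_sqrt hd1.le, div_pos h hsq⟩
      have hR0 : R ≠ 0 := by rintro rfl; simp at hRn
      set b := √(n 1 ^ 2 + n 2 ^ 2) / |R| with hb
      have hpos : 0 < n 1 ^ 2 + n 2 ^ 2 := by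
        refine lt_of_le_of_ne (by positivity) fun h => hcr ?_
        have h1 : n 1 = 0 := by nlinarith [sq_nonneg (n 1), sq_nonneg (n 2)]
        have h2 : n 2 = 0 := by nlinarith [sq_nonneg (n 1), sq_nonneg (n 2)]
        ext i; fin_cases i <;> simp [cr, h1, h2]
      have hb0 : 0 < b := div_pos (Real.sqrt_pos.2 hpos) (abs_pos.2 hR0)
      have hb2 : b ^ 2 = (n 1 ^ 2 + n 2 ^ 2) / R ^ 2 := by
        rw [hb, div_pow, Real.sq_sqrt hpos.le, sq_abs]
      have hq : b ^ 2 + K * (n 0 / R) ^ 2 = 1 := by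
        rw [hb2]; field_simp; rw [hRsq]; simp [dual]; ring
      obtain ⟨e1, e2⟩ := cosK_sinK_arcK hq hRn.le fun _ => hb0
      obtain ⟨η, hη, t1, t2⟩ := exists_angle (a := -n 1 / (R * b)) (b := -n 2 / (R * b)) (by
        have : R ^ 2 * b ^ 2 = n 1 ^ 2 + n 2 ^ 2 := by rw [hb2]; field_simp
        field_simp; linarith)
      set w := arcK K b (n 0 / R) with hw
      have hnR : n = R • ![sinK K w, cosK K w * -Real.cos η, cosK K w * -Real.sin η] := by
        ext i
        fin_cases i
        · simp [e2]; field_simp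
        · simp [e1, t1]; field_simp
        · simp [e1, t2]; field_simp
      have hw0 : 0 < w := by
        refine lt_of_le_of_ne (arcK_nonneg _ _ hRn.le) fun h => ?_
        rw [show w = 0 from h.symm, sinK_zero] at e2
        exact hRn.ne e2
      refine ⟨(w, η), ⟨⟨⟨hw0, fun hK => ?_⟩, hη⟩, ?_⟩, R, ⟨by simpa using hR0, ?_⟩, hnR⟩
      · show w < _
        rw [hw, arcK, if_pos hK, div_mul_eq_div_div, div_lt_div_iff_of_pos_right (Real.sqrt_pos.2 hK)]
        exact Real.arccos_lt_pi_div_two.2 hb0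
      · show polarGeodesic K (w, η) ∈ E
        have : polarGeodesic K (w, η) = g := by
          apply Subtype.ext
          ext x
          rw [hgn, polarGeodesic, geodesic_normal, cr_polarTangent, hnR, dot_smul]
          simp [hR0]
        rw [this]; exact hg
      · rw [mul_one]
        exact abs_lt_of_sq_lt_sq (by rw [hRsq]; simpa using hd2) zero_le_one
  · intro u _
    refine hasFDerivAt_of_coord fun i => ?_
    have hc := hasDerivAt_cosK K u.1
    have hs := hasDerivAt_sinK K u.1
    fin_cases i
    · simpa using hasFDerivAt_fst_mul_snd hs (hasDerivAt_const u.2 (1 : ℝ))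
    · simpa using hasFDerivAt_fst_mul_snd hc (Real.hasDerivAt_cos u.2).neg
    · simpa using hasFDerivAt_fst_mul_snd hc (Real.hasDerivAt_sin u.2).neg
  · exact (measurableSet_lt measurable_const continuous_abs.measurable).inter
      (measurableSet_lt continuous_abs.measurable measurable_const)
  · have h1 := (continuous_sinK K)
    have h2 := (continuous_cosK K)
    apply Continuous.measurable
    refine Continuous.tri ?_ ?_ ?_ <;>
    · refine continuous_pi fun i => ?_
      fin_cases i <;> simp <;> fun_prop
  · intro u hu u' hu' R R' hR hR' e
    have hs := hsin u hu
    have hs' := hsin u' hu'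
    have hco := hcos u hu
    have hco' := hcos u' hu'
    have hR0 : R ≠ 0 := fun h0 => by simp [h0] at hR
    have c0 : R * sinK K u.1 = R' * sinK K u'.1 := by simpa using congrFun e 0
    have hRR : R = R' := by
      have h1 := congrArg (fun z => dual K z z) e
      simp only [← cr_polarTangent, dual_smul_smul] at h1
      have g1 := gram_self_eq_one (polarTangent K u.1 u.2)
      have g2 := gram_self_eq_one (polarTangent K u'.1 u'.2)
      rw [gram] at g1 g2
      rw [g1, g2, mul_one, mul_one] at h1
      rcases mul_self_eq_mul_self_iff.1 h1 with h | h
      · exact h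
      · exfalso
        rw [h] at c0
        have h3 : R' * (sinK K u.1 + sinK K u'.1) = 0 := by linarith
        rcases mul_eq_zero.1 h3 with h4 | h4
        · rw [h4] at h; simp at h; exact hR0 h
        · linarith
    subst hRR
    have e' := smul_right_injective _ hR0 e
    have hss := mul_left_cancel₀ hR0 c0
    have c1 : cosK K u.1 * Real.cos u.2 = cosK K u'.1 * Real.cos u'.2 := by
      simpa using congrFun e' 1
    have c2 : cosK K u.1 * Real.sin u.2 = cosK K u'.1 * Real.sin u'.2 := by
      simpa using congrFun e' 2
    have hcc : cosK K u.1 = cosK K u'.1 := by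
      have h1 := cosK_sq_add K u.1
      have h2 := cosK_sq_add K u'.1
      rw [hss] at h1
      nlinarith
    refine ⟨rfl, Prod.ext ?_ ?_⟩
    · rw [← arcK_cosK_sinK (K := K) hu.1.1.1.le fun hK => ((hu.1.1.2 hK).trans (hlt hK)).le, hcc, hss,
        arcK_cosK_sinK hu'.1.1.1.le fun hK => ((hu'.1.1.2 hK).trans (hlt hK)).le]
    · rw [hcc] at c1 c2
      exact angle_inj hu.1.2 hu'.1.2 (mul_left_cancel₀ hco'.ne' c1) (mul_left_cancel₀ hco'.ne' c2)

/-! ### The geodesic through two points -/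

theorem isUnit_dir {K : ℝ} {x y : Space K} (h : 0 < gram K x.1 y.1 x.1 y.1) :
    quad K x.1 ((√(gram K x.1 y.1 x.1 y.1))⁻¹ • (y.1 - quad K x.1 y.1 • x.1)) = 0 ∧
    metric K ((√(gram K x.1 y.1 x.1 y.1))⁻¹ • (y.1 - quad K x.1 y.1 • x.1))
      ((√(gram K x.1 y.1 x.1 y.1))⁻¹ • (y.1 - quad K x.1 y.1 • x.1)) = 1 := by
  have h1 := Real.sqrt_pos.2 h
  have h2 := Real.mul_self_sqrt h.le
  set σ := √(gram K x.1 y.1 x.1 y.1)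
  set C := quad K x.1 y.1 with hC
  have h3 : quad K x.1 (σ⁻¹ • (y.1 - C • x.1)) = 0 := by
    have e : quad K x.1 (σ⁻¹ • (y.1 - C • x.1)) = σ⁻¹ * (quad K x.1 y.1 - C * quad K x.1 x.1) := by
      simp [quad]; ring
    rw [e, x.2.1, ← hC]; ring
  refine ⟨h3, ?_⟩
  rw [metric_eq_gram x.2 h3 h3]
  have e : gram K x.1 (σ⁻¹ • (y.1 - C • x.1)) x.1 (σ⁻¹ • (y.1 - C • x.1)) =
      σ⁻¹ * σ⁻¹ * gram K x.1 y.1 x.1 y.1 := by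
    simp [gram, dual, cr]; ring
  rw [e, ← h2]
  field_simp

open Classical in
/-- The unit tangent vector at `x` in the direction of `y`. -/
def dirTo {K : ℝ} (x y : Space K) : UnitTangent K :=
  if h : 0 < gram K x.1 y.1 x.1 y.1 then
    ⟨(x.1, (√(gram K x.1 y.1 x.1 y.1))⁻¹ • (y.1 - quad K x.1 y.1 • x.1)), x.2, isUnit_dir h⟩
  else polarTangent K 0 0

theorem dirTo_val {K : ℝ} {x y : Space K} (h : 0 < gram K x.1 y.1 x.1 y.1) :
    (dirTo x y).1 = (x.1, (√(gram K x.1 y.1 x.1 y.1))⁻¹ • (y.1 - quad K x.1 y.1 • x.1)) := by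
  rw [dirTo, dif_pos h]

theorem cr_dirTo {K : ℝ} {x y : Space K} (h : 0 < gram K x.1 y.1 x.1 y.1) :
    cr (dirTo x y).1.1 (dirTo x y).1.2 = (√(gram K x.1 y.1 x.1 y.1))⁻¹ • cr x.1 y.1 := by
  rw [dirTo_val h]
  ext i; fin_cases i <;> simp [cr] <;> ring

theorem measurable_toGeodesic {K : ℝ} : Measurable (toGeodesic (K := K)) := fun _ hs => hs

theorem measurable_dirTo {K : ℝ} : Measurable fun p : Space K × Space K => dirTo p.1 p.2 := by
  classical
  have c1 : Continuous fun p : Space K × Space K => p.1.1 := continuous_subtype_val.comp continuous_fst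
  have c2 : Continuous fun p : Space K × Space K => p.2.1 := continuous_subtype_val.comp continuous_snd
  have hg := c1.gram c2 c1 c2 (K := K)
  have h1 : MeasurableSet {p : Space K × Space K | 0 < gram K p.1.1 p.2.1 p.1.1 p.2.1} :=
    (isOpen_lt continuous_const hg).measurableSet
  have h2 : Measurable fun p : Space K × Space K =>
      (p.1.1, (√(gram K p.1.1 p.2.1 p.1.1 p.2.1))⁻¹ • (p.2.1 - quad K p.1.1 p.2.1 • p.1.1)) :=
    c1.measurable.prodMk (hg.sqrt.measurable.inv.smul
      (c2.measurable.sub ((c1.quad c2).measurable.smul c1.measurable)))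
  have h3 : Measurable fun p : Space K × Space K => if 0 < gram K p.1.1 p.2.1 p.1.1 p.2.1 then
        (p.1.1, (√(gram K p.1.1 p.2.1 p.1.1 p.2.1))⁻¹ • (p.2.1 - quad K p.1.1 p.2.1 • p.1.1))
      else (polarTangent K 0 0).1 := Measurable.ite h1 h2 measurable_const
  have h4 : ∀ p : Space K × Space K, (dirTo p.1 p.2).1 =
      if 0 < gram K p.1.1 p.2.1 p.1.1 p.2.1 then
        (p.1.1, (√(gram K p.1.1 p.2.1 p.1.1 p.2.1))⁻¹ • (p.2.1 - quad K p.1.1 p.2.1 • p.1.1))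
      else (polarTangent K 0 0).1 := by
    intro p
    rw [dirTo]; split_ifs <;> rfl
  have h5 : (fun p : Space K × Space K => dirTo p.1 p.2) = fun p => (⟨
      if 0 < gram K p.1.1 p.2.1 p.1.1 p.2.1 then
        (p.1.1, (√(gram K p.1.1 p.2.1 p.1.1 p.2.1))⁻¹ • (p.2.1 - quad K p.1.1 p.2.1 • p.1.1))
      else (polarTangent K 0 0).1, by rw [← h4]; exact (dirTo p.1 p.2).2⟩ : UnitTangent K) :=
    funext fun p => Subtype.ext (h4 p)
  rw [h5]
  exact h3.subtype_mk

theorem mem_toGeodesic_dirTo {K : ℝ} {x y : Space K} (h : 0 < gram K x.1 y.1 x.1 y.1)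
    (z : Space K) : z ∈ (toGeodesic (dirTo x y)).1 ↔ dot (cr x.1 y.1) z.1 = 0 := by
  have := Real.sqrt_pos.2 h
  rw [geodesic_normal, cr_dirTo h, dot_smul]
  simp [this.ne']

theorem dot_cr_left (x y : Fin 3 → ℝ) : dot (cr x y) x = 0 := by simp [dot, cr]; ring
theorem dot_cr_right (x y : Fin 3 → ℝ) : dot (cr x y) y = 0 := by simp [dot, cr]; ring

/-- In the unit tangent bundle the set is the projection, along the compact D, of a closed incidence
relation, hence closed. -/
theorem measurableSet_hitting {K : ℝ} {D : Set (Space K)} (hD : IsCompact D) :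
    MeasurableSet (hitting D) := by
  have hc : CompactSpace D := isCompact_iff_compactSpace.1 hD
  have hcl : IsClosed {p : UnitTangent K × D | dot (cr p.1.1.1 p.1.1.2) p.2.1.1 = 0} := by
    refine isClosed_eq ?_ continuous_const
    refine Continuous.dot (Continuous.cr ?_ ?_) ?_ <;> fun_prop
  have h2 := isClosedMap_fst_of_compactSpace _ hcl
  have : toGeodesic ⁻¹' hitting D =
      Prod.fst '' {p : UnitTangent K × D | dot (cr p.1.1.1 p.1.1.2) p.2.1.1 = 0} := by
    ext q
    constructor
    · rintro ⟨x, hx, hxD⟩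
      exact ⟨(q, ⟨x, hxD⟩), (geodesic_normal q x).1 hx, rfl⟩
    · rintro ⟨⟨q', x⟩, hx, rfl⟩
      exact ⟨x.1, (geodesic_normal q' x.1).2 hx, x.2⟩
  show MeasurableSet (toGeodesic ⁻¹' hitting D)
  rw [this]
  exact h2.measurableSet

/-! ### Geodesics parametrized by pairs of boundary points -/

/-- The normal tensor of a geodesic. -/
def tensor {K : ℝ} (g : Geodesic K) : Fin 3 → Fin 3 → ℝ := fun i j =>
  cr g.2.choose.1.1 g.2.choose.1.2 i * cr g.2.choose.1.1 g.2.choose.1.2 j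

theorem geodesic_normal_unique {K : ℝ} {q q' : UnitTangent K} (h : toGeodesic q = toGeodesic q') :
    ∃ κ : ℝ, κ ^ 2 = 1 ∧ cr q.1.1 q.1.2 = κ • cr q'.1.1 q'.1.2 := by
  have hmem : ∀ t, dot (cr q.1.1 q.1.2) (geo q' t).1 = 0 := by
    intro t
    rw [← geodesic_normal, h]; exact ⟨t, rfl⟩
  have h0 : dot (cr q.1.1 q.1.2) q'.1.1 = 0 := by
    have := hmem 0
    rw [geo_zero] at this
    exact this
  have h1 : dot (cr q.1.1 q.1.2) q'.1.2 = 0 := by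
    have hs : 0 < sinK K (if 0 < K then Real.pi / √K / 2 else 1) := by
      split_ifs with hK
      · have : 0 < Real.pi / √K := div_pos Real.pi_pos (Real.sqrt_pos.2 hK)
        exact sinK_pos (by linarith) fun _ => by linarith
      · exact sinK_pos one_pos fun h => absurd h hK
    have := hmem (if 0 < K then Real.pi / √K / 2 else 1)
    simp only [geo, dot_comb, h0] at this
    simpa [hs.ne'] using this
  obtain ⟨κ, hκ⟩ := eq_smul_cr (normal_ne_zero q') h0 h1
  refine ⟨κ, ?_, hκ⟩
  have g1 := gram_self_eq_one q
  have g2 := gram_self_eq_one q'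
  rw [gram] at g1 g2
  rw [hκ, dual_smul_smul, g2] at g1
  linarith

theorem tensor_toGeodesic {K : ℝ} (q : UnitTangent K) (i j : Fin 3) :
    tensor (toGeodesic q) i j = cr q.1.1 q.1.2 i * cr q.1.1 q.1.2 j := by
  obtain ⟨κ, h1, h2⟩ := geodesic_normal_unique (q := (toGeodesic q).2.choose) (q' := q)
    (Subtype.ext (toGeodesic q).2.choose_spec)
  rw [tensor, h2]
  simp only [Pi.smul_apply, smul_eq_mul]
  linear_combination (cr q.1.1 q.1.2 i * cr q.1.1 q.1.2 j) * h1

theorem measurable_tensor {K : ℝ} : Measurable (tensor (K := K)) := by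
  have h : Measurable (tensor (K := K) ∘ toGeodesic) := by
    refine measurable_pi_iff.2 fun i => measurable_pi_iff.2 fun j => ?_
    simp only [Function.comp_apply, tensor_toGeodesic]
    have : Continuous fun q : UnitTangent K => cr q.1.1 q.1.2 :=
      Continuous.cr (by fun_prop) (by fun_prop)
    exact (((continuous_apply i).comp this).mul ((continuous_apply j).comp this)).measurable
  intro s hs
  exact h hs

/-- The tensor n ⊗ n does not see the sign of the conormal, and the geodesic is the zero set of its
quadratic form. -/
theorem tensor_injective {K : ℝ} : Function.Injective (tensor (K := K)) := by
  rintro ⟨-, q, rfl⟩ ⟨-, q', rfl⟩ h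
  change tensor (toGeodesic q) = tensor (toGeodesic q') at h
  have key : ∀ (q : UnitTangent K) (x : Space K), x ∈ line q ↔
      ∑ i, ∑ j, tensor (toGeodesic q) i j * (x.1 i * x.1 j) = 0 := by
    intro q x
    simp only [tensor_toGeodesic]
    rw [mem_line_iff, tri_eq_dot, ← sq_eq_zero_iff]
    have : ∑ i, ∑ j, cr q.1.1 q.1.2 i * cr q.1.1 q.1.2 j * (x.1 i * x.1 j) =
        dot (cr q.1.1 q.1.2) x.1 ^ 2 := by
      simp only [Fin.sum_univ_three, dot]; ring
    rw [this]
  apply Subtype.ext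
  ext x
  show x ∈ line q ↔ x ∈ line q'
  rw [key, key, h]

/-- The space of geodesics only carries a quotient σ-algebra. Composition with the injective
measurable map `tensor` leads into a Euclidean space, where injective measurable images of Borel
sets are Borel, and preimages under `tensor` bring them back. -/
theorem measurableEmbedding_of_injOn {K : ℝ} {φ : ℝ × ℝ → Geodesic K} (hφ : Measurable φ)
    {V : Set (ℝ × ℝ)} (hV : MeasurableSet V) (hinj : InjOn φ V) :
    MeasurableEmbedding fun v : V => φ v := by
  have := hV.standardBorel
  have h1 : Measurable fun v : V => φ v := hφ.comp measurable_subtype_coe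
  have h2 : Function.Injective fun v : V => φ v := fun a b e => Subtype.ext (hinj a.2 b.2 e)
  have h3 : MeasurableEmbedding fun v : V => tensor (φ v) :=
    (measurable_tensor.comp h1).measurableEmbedding (tensor_injective.comp h2)
  refine ⟨h2, h1, fun {s} hs => ?_⟩
  have : (fun v : V => φ v) '' s = tensor ⁻¹' ((fun v : V => tensor (φ v)) '' s) := by
    ext g
    constructor
    · rintro ⟨v, hv, rfl⟩; exact ⟨v, hv, rfl⟩
    · rintro ⟨v, hv, e⟩; exact ⟨v, hv, tensor_injective e⟩
  rw [this]
  exact measurable_tensor (h3.measurableSet_image' hs)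

/-- The set of transversal pairs of parameters. -/
def pairs {K : ℝ} (c : ℝ → Space K) (T : ℝ) : Set (ℝ × ℝ) :=
  {u | 0 ≤ u.1 ∧ u.1 < u.2 ∧ u.2 < T ∧ tri (c u.1).1 (vel c u.1) (c u.2).1 ≠ 0}

/-- The geodesic through two boundary points. -/
def lineOf {K : ℝ} (c : ℝ → Space K) (u : ℝ × ℝ) : Geodesic K := toGeodesic (dirTo (c u.1) (c u.2))

/-- The density of the invariant measure with respect to the parameters of the end points. -/
def jac {K : ℝ} (c : ℝ → Space K) (s t : ℝ) : ℝ :=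
  tri (c s).1 (vel c s) (c t).1 * tri (c s).1 (c t).1 (vel c t) /
    √(gram K (c s).1 (c t).1 (c s).1 (c t).1) ^ 3

namespace Domain

variable {K : ℝ} {D : Set (Space K)} {c : ℝ → Space K} {T : ℝ}

theorem jac_nonneg (h : Domain D c T) (s t : ℝ) : 0 ≤ jac c s t :=
  div_nonneg (h.tri_mul_nonneg s t) (by positivity)

theorem continuous_c (h : Domain D c T) : Continuous c :=
  continuous_induced_rng.2 h.continuous_coe

theorem measurable_lineOf (h : Domain D c T) : Measurable (lineOf c) := by
  have hc : Measurable c := h.continuous_c.measurable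
  have h1 : Measurable fun u : ℝ × ℝ => (c u.1, c u.2) :=
    (hc.comp measurable_fst).prodMk (hc.comp measurable_snd)
  have h2 := measurable_dirTo.comp h1
  have h3 := measurable_toGeodesic.comp h2
  rw [show lineOf c = toGeodesic ∘ (fun p : Space K × Space K => dirTo p.1 p.2) ∘
    fun u : ℝ × ℝ => (c u.1, c u.2) from rfl]
  exact h3

theorem continuous_tri_vel (h : Domain D c T) :
    Continuous fun u : ℝ × ℝ => tri (c u.1).1 (vel c u.1) (c u.2).1 :=
  (h.continuous_coe.comp continuous_fst).tri (h.continuous_vel.comp continuous_fst)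
    (h.continuous_coe.comp continuous_snd)

theorem continuous_tri_vel' (h : Domain D c T) :
    Continuous fun u : ℝ × ℝ => tri (c u.1).1 (c u.2).1 (vel c u.2) :=
  (h.continuous_coe.comp continuous_fst).tri (h.continuous_coe.comp continuous_snd)
    (h.continuous_vel.comp continuous_snd)

theorem continuous_gram (h : Domain D c T) :
    Continuous fun u : ℝ × ℝ => gram K (c u.1).1 (c u.2).1 (c u.1).1 (c u.2).1 :=
  Continuous.gram (h.continuous_coe.comp continuous_fst) (h.continuous_coe.comp continuous_snd)
    (h.continuous_coe.comp continuous_fst) (h.continuous_coe.comp continuous_snd)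

theorem measurable_jac (h : Domain D c T) : Measurable fun u : ℝ × ℝ => jac c u.1 u.2 :=
  (h.continuous_tri_vel.measurable.mul h.continuous_tri_vel'.measurable).div
    (h.continuous_gram.sqrt.measurable.pow_const 3)

theorem measurableSet_pairs (h : Domain D c T) : MeasurableSet (pairs c T) := by
  have h1 : MeasurableSet {u : ℝ × ℝ | 0 ≤ u.1} := measurableSet_le measurable_const measurable_fst
  have h2 : MeasurableSet {u : ℝ × ℝ | u.1 < u.2} := measurableSet_lt measurable_fst measurable_snd
  have h3 : MeasurableSet {u : ℝ × ℝ | u.2 < T} := measurableSet_lt measurable_snd measurable_const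
  have h4 : MeasurableSet {u : ℝ × ℝ | tri (c u.1).1 (vel c u.1) (c u.2).1 ≠ 0} :=
    h.continuous_tri_vel.measurable (measurableSet_singleton 0).compl
  exact h1.inter (h2.inter (h3.inter h4))

theorem gram_pos_pairs (h : Domain D c T) {u : ℝ × ℝ} (hu : u ∈ pairs c T) :
    0 < gram K (c u.1).1 (c u.2).1 (c u.1).1 (c u.2).1 :=
  h.gram_pos ⟨hu.1, hu.2.1.trans hu.2.2.1⟩ ⟨hu.1.trans hu.2.1.le, hu.2.2.1⟩ hu.2.1.ne

theorem mem_lineOf (h : Domain D c T) {u : ℝ × ℝ} (hu : u ∈ pairs c T) :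
    c u.1 ∈ (lineOf c u).1 ∧ c u.2 ∈ (lineOf c u).1 := by
  have := h.gram_pos_pairs hu
  exact ⟨(mem_toGeodesic_dirTo this _).2 (dot_cr_left _ _),
    (mem_toGeodesic_dirTo this _).2 (dot_cr_right _ _)⟩

theorem lineOf_mem_hitting (h : Domain D c T) {u : ℝ × ℝ} (hu : u ∈ pairs c T) :
    lineOf c u ∈ hitting D := ⟨c u.1, (h.mem_lineOf hu).1, h.mem _⟩

/-- All four points are ends of the same chord, and the order within each pair leaves no choice. -/
theorem pairs_unique (h : Domain D c T) {u v : ℝ × ℝ} (hu : u ∈ pairs c T) (hv : v ∈ pairs c T)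
    (e : lineOf c u = lineOf c v) : u = v := by
  obtain ⟨ch, hch⟩ := exists_isChord h.compact h.convex (h.lineOf_mem_hitting hu)
  have m1 := (h.mem_lineOf hu).1
  have m2 := (h.mem_lineOf hu).2
  have m3 := (h.mem_lineOf hv).1
  have m4 := (h.mem_lineOf hv).2
  rw [← e] at m3 m4
  have I1 : u.1 ∈ Ico 0 T := ⟨hu.1, hu.2.1.trans hu.2.2.1⟩
  have I2 : u.2 ∈ Ico 0 T := ⟨hu.1.trans hu.2.1.le, hu.2.2.1⟩
  have I3 : v.1 ∈ Ico 0 T := ⟨hv.1, hv.2.1.trans hv.2.2.1⟩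
  have I4 : v.2 ∈ Ico 0 T := ⟨hv.1.trans hv.2.1.le, hv.2.2.1⟩
  have e1 := h.eq_end_of_mem hu.2.2.2 hch m1 m2 m1
  have e2 := h.eq_end_of_mem hu.2.2.2 hch m1 m2 m2
  have e3 := h.eq_end_of_mem hu.2.2.2 hch m1 m2 m3
  have e4 := h.eq_end_of_mem hu.2.2.2 hch m1 m2 m4
  have inj : ∀ {a b : ℝ}, a ∈ Ico 0 T → b ∈ Ico 0 T → ∀ {x : Space K}, c a = x → c b = x → a = b :=
    fun ha hb x ea eb => h.bd.injOn ha hb (ea.trans eb.symm)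
  have hlu := hu.2.1
  have hlv := hv.2.1
  rcases e1 with e1 | e1 <;> rcases e2 with e2 | e2
  · exact absurd (inj I1 I2 e1 e2) hlu.ne
  · rcases e3 with e3 | e3 <;> rcases e4 with e4 | e4
    · exact absurd (inj I3 I4 e3 e4) hlv.ne
    · exact Prod.ext (inj I1 I3 e1 e3) (inj I2 I4 e2 e4)
    · have := inj I1 I4 e1 e4; have := inj I2 I3 e2 e3; linarith
    · exact absurd (inj I3 I4 e3 e4) hlv.ne
  · rcases e3 with e3 | e3 <;> rcases e4 with e4 | e4
    · exact absurd (inj I3 I4 e3 e4) hlv.ne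
    · have := inj I1 I4 e1 e4; have := inj I2 I3 e2 e3; linarith
    · exact Prod.ext (inj I1 I3 e1 e3) (inj I2 I4 e2 e4)
    · exact absurd (inj I3 I4 e3 e4) hlv.ne
  · exact absurd (inj I1 I2 e1 e2) hlu.ne

/-- Conormals of supporting geodesics form a null set. -/
theorem volume_supporting_normals (D : Set (Space K)) :
    volume {n : Fin 3 → ℝ | (∀ z ∈ D, 0 ≤ dot n z.1) ∧ ∃ z ∈ D, dot n z.1 = 0} = 0 := by
  have hconv : Convex ℝ {n : Fin 3 → ℝ | ∀ z ∈ D, 0 ≤ dot n z.1} := by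
    intro m hm n hn a b ha hb _ z hz
    have : dot (a • m + b • n) z.1 = a * dot m z.1 + b * dot n z.1 := by simp [dot]; ring
    rw [this]
    exact add_nonneg (mul_nonneg ha (hm z hz)) (mul_nonneg hb (hn z hz))
  -- The conormals nonnegative on D form a convex cone. One that vanishes at a point z of D is on
  -- its frontier, because subtracting t z makes the value at z negative; and frontiers of convex
  -- sets are null.
  refine measure_mono_null ?_ (hconv.addHaar_frontier volume)
  rintro n ⟨hn, z, hz, h0⟩
  refine ⟨subset_closure hn, fun hi => ?_⟩
  have hcont : Continuous fun t : ℝ => n - t • z.1 := by fun_prop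
  have ht : Filter.Tendsto (fun t : ℝ => n - t • z.1) (nhdsWithin 0 (Ioi 0)) (nhds n) := by
    have := hcont.tendsto 0
    simp only [zero_smul, sub_zero] at this
    exact this.mono_left nhdsWithin_le_nhds
  obtain ⟨t, ht1, ht2⟩ := ((ht.eventually (mem_interior_iff_mem_nhds.1 hi)).and
    self_mem_nhdsWithin).exists
  have h1 := ht1 z hz
  have h2 : dot (n - t • z.1) z.1 = dot n z.1 - t * (z.1 0 ^ 2 + z.1 1 ^ 2 + z.1 2 ^ 2) := by
    simp [dot]; ring
  have h3 : 0 < z.1 0 ^ 2 + z.1 1 ^ 2 + z.1 2 ^ 2 := by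
    by_contra hcon
    have a0 := sq_nonneg (z.1 0); have a1 := sq_nonneg (z.1 1); have a2 := sq_nonneg (z.1 2)
    have b0 : z.1 0 = 0 := by nlinarith
    have b1 : z.1 1 = 0 := by nlinarith
    have b2 : z.1 2 = 0 := by nlinarith
    have := z.2.1
    simp [quad, b0, b1, b2] at this
  rw [h2, h0] at h1
  have := mul_pos (show (0 : ℝ) < t from ht2) h3
  linarith

/-- Points of both signs stay so when moved slightly towards an interior point of D; they then lie
in the interior of the cone, and so does a zero on the segment between them. -/
theorem exists_interior_zero (h : Domain D c T) {n : Fin 3 → ℝ} (h1 : ∃ z ∈ D, 0 < dot n z.1)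
    (h2 : ∃ z ∈ D, dot n z.1 < 0) : ∃ x ∈ interior D, dot n x.1 = 0 := by
  obtain ⟨z1, hz1, p1⟩ := h1
  obtain ⟨z2, hz2, p2⟩ := h2
  obtain ⟨z0, hz0⟩ := h.int_nonempty
  have hI : ∀ z ∈ D, ∀ t : ℝ, 0 < t → z.1 + t • z0.1 ∈ interior (cone D) := by
    intro z hz t ht
    have a1 : (1 + t) • z0.1 ∈ interior (cone D) := by
      rw [mem_interior_cone]
      exact ⟨inCone_smul (by positivity) z0, by rwa [proj_smul (by positivity)]⟩
    have a2 : (1 + t) • z.1 ∈ closure (cone D) :=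
      subset_closure ((smul_mem_cone (by positivity)).2 hz)
    have a3 := (convex_cone h.convex).combo_closure_interior_mem_interior a2 a1
      (show 0 ≤ 1 / (1 + t) by positivity) (show 0 < t / (1 + t) by positivity) (by field_simp)
    rw [smul_smul, smul_smul, div_mul_cancel₀ _ (by positivity), div_mul_cancel₀ _ (by positivity),
      one_smul] at a3
    exact a3
  obtain ⟨t, ht, q1, q2⟩ : ∃ t > 0, 0 < dot n z1.1 + t * dot n z0.1 ∧
      dot n z2.1 + t * dot n z0.1 < 0 := by
    have hc1 : Filter.Tendsto (fun t : ℝ => dot n z1.1 + t * dot n z0.1) (nhdsWithin 0 (Ioi 0))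
        (nhds (dot n z1.1)) := by
      have : Continuous fun t : ℝ => dot n z1.1 + t * dot n z0.1 := by fun_prop
      have := this.tendsto 0
      simp only [zero_mul, add_zero] at this
      exact this.mono_left nhdsWithin_le_nhds
    have hc2 : Filter.Tendsto (fun t : ℝ => dot n z2.1 + t * dot n z0.1) (nhdsWithin 0 (Ioi 0))
        (nhds (dot n z2.1)) := by
      have : Continuous fun t : ℝ => dot n z2.1 + t * dot n z0.1 := by fun_prop
      have := this.tendsto 0
      simp only [zero_mul, add_zero] at this
      exact this.mono_left nhdsWithin_le_nhds
    obtain ⟨t, ⟨e1, e2⟩, e3⟩ := (((hc1.eventually (lt_mem_nhds p1)).and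
      (hc2.eventually (gt_mem_nhds p2))).and self_mem_nhdsWithin).exists
    exact ⟨t, e3, e1, e2⟩
  set A := dot n z1.1 + t * dot n z0.1
  set B := dot n z2.1 + t * dot n z0.1
  -- The weights are chosen so that the functional, with values A and B at the two points, vanishes
  -- at the combination.
  have hw := (convex_cone h.convex).interior (hI z1 hz1 t ht) (hI z2 hz2 t ht)
    (show 0 ≤ -B / (A - B) from div_nonneg (by linarith) (by linarith))
    (show 0 ≤ A / (A - B) from div_nonneg (by linarith) (by linarith))
    (by have : A - B ≠ 0 := by linarith
        field_simp; ring)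
  set w := (-B / (A - B)) • (z1.1 + t • z0.1) + (A / (A - B)) • (z2.1 + t • z0.1) with hwdef
  have hw0 : dot n w = 0 := by
    have e : ∀ z : Fin 3 → ℝ, dot n (z + t • z0.1) = dot n z + t * dot n z0.1 := by
      intro z; simp [dot]; ring
    rw [hwdef, dot_comb, e, e]
    show -B / (A - B) * A + A / (A - B) * B = 0
    ring
  obtain ⟨c1, c2⟩ := mem_interior_cone.1 hw
  refine ⟨proj K w, c2, ?_⟩
  rw [c1.eq_smul_proj, dot_smul_right] at hw0
  exact (mul_eq_zero.1 hw0).resolve_left (Real.sqrt_pos.2 c1.1).ne'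

/-- A geodesic through an interior point is the line of a transversal pair. -/
theorem exists_pair (h : Domain D c T) {g : Geodesic K} {x : Space K} (hx : x ∈ interior D)
    (hxg : x ∈ g.1) : ∃ u ∈ pairs c T, lineOf c u = g := by
  obtain ⟨-, q, rfl⟩ := g
  set n := cr q.1.1 q.1.2 with hn
  have hgn : ∀ z : Space K, z ∈ line q ↔ dot n z.1 = 0 := geodesic_normal q
  have hxD := interior_subset hx
  obtain ⟨a, rfl⟩ : ∃ a, geo q a = x := hxg
  obtain ⟨y1, hy1D, hy1, hy1g⟩ : ∃ y ∈ D, geo q a ≠ y ∧ y ∈ line q := by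
    have hc : Filter.Tendsto (fun s => geo q (a + s)) (nhdsWithin 0 (Ioi 0)) (nhds (geo q a)) := by
      have : Continuous fun s => geo q (a + s) :=
        (continuous_geo q).comp (continuous_const.add continuous_id)
      have := this.tendsto 0
      rw [add_zero] at this
      exact this.mono_left nhdsWithin_le_nhds
    obtain ⟨δ, hδ, hδK⟩ : ∃ δ > 0, 0 < K → δ < Real.pi / √K := by
      by_cases hK : 0 < K
      · have : 0 < Real.pi / √K := div_pos Real.pi_pos (Real.sqrt_pos.2 hK)
        exact ⟨Real.pi / √K / 2, by linarith, fun _ => by linarith⟩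
      · exact ⟨1, one_pos, fun h => absurd h hK⟩
    obtain ⟨s, h1, h2⟩ := ((hc.eventually (isOpen_interior.mem_nhds hx)).and
      (Ioo_mem_nhdsGT hδ)).exists
    refine ⟨geo q (a + s), interior_subset h1, fun e => ?_, ⟨_, rfl⟩⟩
    have := geo_inj q (fun hK => by
      have := hδK hK
      rw [add_sub_cancel_left, abs_of_pos h2.1]; linarith [h2.2]) e
    linarith [h2.1]
  have hsolve : ∀ {x z w : Space K} {α β : ℝ}, x ∈ line q → z ∈ line q → 0 < β →
      z.1 = α • x.1 + β • w.1 → w ∈ line q := by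
    intro x z w α β hx hz hβ e
    rw [hgn] at hx hz ⊢
    rw [e, dot_comb, hx, mul_zero, zero_add] at hz
    exact (mul_eq_zero.1 hz).resolve_left hβ.ne'
  -- Leaving D from the interior point through y1 gives one end c t; leaving it from c t through the
  -- interior point gives the opposite end c s.
  obtain ⟨w, hw, α, β, hα, hβ, e⟩ := exists_exit h.compact h.convex hxD hy1D hy1
  obtain ⟨t, ht, rfl⟩ := h.exists_param hw
  have htg : c t ∈ line q := hsolve ⟨a, rfl⟩ hy1g hβ e
  have hne : c t ≠ geo q a := fun e => h.not_mem_interior t (by rwa [e])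
  obtain ⟨w, hw, α', β', hα', hβ', e'⟩ := exists_exit h.compact h.convex (h.mem t) hxD hne
  obtain ⟨s, hs, rfl⟩ := h.exists_param hw
  have hsg : c s ∈ line q := hsolve htg ⟨a, rfl⟩ hβ' e'
  have hst : s ≠ t := by
    rintro rfl
    have e'' : (geo q a).1 = (α' + β') • (c s).1 := by rw [add_smul]; exact e'
    have := (eq_of_smul (x := geo q a) (y := c s) (b := α' + β') one_pos (by linarith)
      (by rw [one_smul]; exact e'')).2
    exact hne this.symm
  have key : ∀ s ∈ Ico 0 T, ∀ t ∈ Ico 0 T, s < t → c s ∈ line q → c t ∈ line q →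
      ∃ u ∈ pairs c T, lineOf c u = toGeodesic q := by
    intro s hs t ht hst hsg htg
    have hcr := h.cr_ne hs ht hst.ne
    have hp : (s, t) ∈ pairs c T := by
      refine ⟨hs.1, hst, ht.2, fun h0 => ?_⟩
      have hsup := h.supporting_of_tri_eq_zero (g := toGeodesic q) hcr hsg htg h0
      have := hsup.2 ⟨⟨a, rfl⟩, hxD⟩
      rw [h.compact.isClosed.frontier_eq] at this
      exact this.2 hx
    exact ⟨(s, t), hp, geodesic_unique hcr (h.mem_lineOf hp).1 (h.mem_lineOf hp).2 hsg htg⟩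
  rcases hst.lt_or_gt with hlt | hlt
  · exact key s hs t ht hlt hsg htg
  · exact key t ht s hs hlt htg hsg

theorem hasFDerivAt_cr (h : Domain D c T) (u : ℝ × ℝ) :
    HasFDerivAt (fun u : ℝ × ℝ => cr (c u.1).1 (c u.2).1)
      ((ContinuousLinearMap.fst ℝ ℝ ℝ).smulRight (cr (vel c u.1) (c u.2).1) +
        (ContinuousLinearMap.snd ℝ ℝ ℝ).smulRight (cr (c u.1).1 (vel c u.2))) u := by
  have hs := hasDerivAt_pi.1 (h.hasDerivAt u.1)
  have ht := hasDerivAt_pi.1 (h.hasDerivAt u.2)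
  have hp := fun i j => hasFDerivAt_fst_mul_snd (hs i) (ht j)
  refine hasFDerivAt_of_coord fun i => ?_
  fin_cases i
  · refine ((hp 1 2).sub (hp 2 1)).congr_fderiv ?_
    ext <;> simp [cr]
  · refine ((hp 2 0).sub (hp 0 2)).congr_fderiv ?_
    ext <;> simp [cr]
  · refine ((hp 0 1).sub (hp 1 0)).congr_fderiv ?_
    ext <;> simp [cr]

/-- Up to the null set of supporting conormals and their negatives, the conormals of geodesics
hitting D are the multiples of `cr (c s) (c t)` for transversal pairs. The triple product of this
conormal with its two derivatives factors, up to sign, into the numerator of `jac`. -/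
theorem liouville_restrict (h : Domain D c T) :
    (liouville K).restrict (hitting D) = Measure.map (lineOf c)
      ((volume.restrict (pairs c T)).withDensity fun u => ENNReal.ofReal (jac c u.1 u.2)) := by
  have hm := h.measurable_lineOf
  have hVm := h.measurableSet_pairs
  have hHm := measurableSet_hitting h.compact
  ext E hE
  rw [Measure.restrict_apply hE, Measure.map_apply hm hE, withDensity_apply _ (hm hE),
    Measure.restrict_restrict (hm hE)]
  set U := lineOf c ⁻¹' E ∩ pairs c T with hU
  have hUm : MeasurableSet U := (hm hE).inter hVm
  have h3 : liouville K (E ∩ hitting D) = ENNReal.ofReal (3 / 2) * volume (normals (E ∩ hitting D)) := by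
    rw [volume_normals (hE.inter hHm), ← mul_assoc, ← ENNReal.ofReal_mul (by norm_num)]
    norm_num
  have htri : ∀ u : ℝ × ℝ, tri (cr (c u.1).1 (c u.2).1) (cr (vel c u.1) (c u.2).1)
      (cr (c u.1).1 (vel c u.2)) =
      -(tri (c u.1).1 (vel c u.1) (c u.2).1 * tri (c u.1).1 (c u.2).1 (vel c u.2)) := by
    intro u; simp [tri, cr]; ring
  have key := volume_cone_image hUm (Ψ := fun u => cr (c u.1).1 (c u.2).1)
    (Ψ1 := fun u => cr (vel c u.1) (c u.2).1) (Ψ2 := fun u => cr (c u.1).1 (vel c u.2))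
    (N := fun u => √(gram K (c u.1).1 (c u.2).1 (c u.1).1 (c u.2).1))
    (S := {r : ℝ | 0 < |r| ∧ |r| < 1}) (k := 2 / 3) (fun u _ => h.hasFDerivAt_cr u)
    h.continuous_gram.sqrt.measurable ?_ ?_
    (fun u hu => Real.sqrt_pos.2 (h.gram_pos_pairs hu.2)) lintegral_sq_punctured ?_
  · have hvol : volume {z | ∃ u ∈ U, ∃ R : ℝ,
        R * √(gram K (c u.1).1 (c u.2).1 (c u.1).1 (c u.2).1) ∈ {r : ℝ | 0 < |r| ∧ |r| < 1} ∧
          z = R • cr (c u.1).1 (c u.2).1} = volume (normals (E ∩ hitting D)) := by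
      refine volume_congr_of_sub (N := {n | (∀ z ∈ D, 0 ≤ dot n z.1) ∧ ∃ z ∈ D, dot n z.1 = 0} ∪
        Neg.neg ⁻¹' {n | (∀ z ∈ D, 0 ≤ dot n z.1) ∧ ∃ z ∈ D, dot n z.1 = 0}) ?_ ?_ ?_
      · rintro _ ⟨u, hu, R, hR, rfl⟩
        have hg := h.gram_pos_pairs hu.2
        have hR0 : R ≠ 0 := fun h0 => by simp [h0] at hR
        have hd : dual K (R • cr (c u.1).1 (c u.2).1) (R • cr (c u.1).1 (c u.2).1) =
            (R * √(gram K (c u.1).1 (c u.2).1 (c u.1).1 (c u.2).1)) ^ 2 := by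
          rw [dual_smul_smul, mul_pow, Real.sq_sqrt hg.le, gram]; ring
        refine ⟨by rw [hd, ← sq_abs]; exact pow_pos hR.1 2, by
          rw [hd, ← sq_abs]; exact pow_lt_one₀ (abs_nonneg _) hR.2 two_ne_zero,
          lineOf c u, ⟨hu.1, h.lineOf_mem_hitting hu.2⟩, fun x => ?_⟩
        rw [dot_smul, lineOf, mem_toGeodesic_dirTo hg]; simp [hR0]
      · rintro n ⟨hd1, hd2, g, ⟨hgE, x0, hx0, hx0D⟩, hgn⟩
        have hx0n := (hgn x0).1 hx0
        -- If n does not take both signs on D, then n or −n belongs to the null set of supporting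
        -- conormals.
        by_cases hpos : ∃ z ∈ D, 0 < dot n z.1
        swap
        · push Not at hpos
          refine Or.inr (Or.inr ⟨fun z hz => ?_, x0, hx0D, ?_⟩)
          · have := hpos z hz
            have e : dot (-n) z.1 = -dot n z.1 := by simp [dot]; ring
            rw [e]; linarith
          · have e : dot (-n) x0.1 = -dot n x0.1 := by simp [dot]; ring
            rw [e, hx0n, neg_zero]
        by_cases hneg : ∃ z ∈ D, dot n z.1 < 0
        swap
        · push Not at hneg
          exact Or.inr (Or.inl ⟨hneg, x0, hx0D, hx0n⟩)
        left
        obtain ⟨x, hxi, hxn⟩ := h.exists_interior_zero hpos hneg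
        obtain ⟨u, hu, hug⟩ := h.exists_pair hxi ((hgn x).2 hxn)
        have hm := h.mem_lineOf hu
        rw [hug] at hm
        have hg := h.gram_pos_pairs hu
        have hcr : cr (c u.1).1 (c u.2).1 ≠ 0 := fun h0 => by simp [gram, h0, dual] at hg
        obtain ⟨κ, hκ⟩ := eq_smul_cr hcr ((hgn _).1 hm.1) ((hgn _).1 hm.2)
        have hd : dual K n n =
            (κ * √(gram K (c u.1).1 (c u.2).1 (c u.1).1 (c u.2).1)) ^ 2 := by
          rw [hκ, dual_smul_smul, mul_pow, Real.sq_sqrt hg.le, gram]; ring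
        refine ⟨u, ⟨by show lineOf c u ∈ E; rw [hug]; exact hgE, hu⟩, κ, ⟨abs_pos.2 fun h0 => ?_, ?_⟩, hκ⟩
        · rw [h0] at hd; simp at hd; linarith
        · exact abs_lt_of_sq_lt_sq (by rw [← hd]; simpa using hd2) zero_le_one
      · refine measure_union_null (volume_supporting_normals D) ?_
        rw [Measure.measure_preimage_neg]
        exact volume_supporting_normals D
    rw [h3, ← hvol, key, ← lintegral_const_mul' _ _ ENNReal.ofReal_ne_top]
    refine setLIntegral_congr_fun hUm fun u hu => ?_
    rw [htri, abs_neg, abs_of_nonneg (h.tri_mul_nonneg _ _), ← ENNReal.ofReal_mul (by norm_num), jac]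
    congr 1; ring
  · exact (measurableSet_lt measurable_const continuous_abs.measurable).inter
      (measurableSet_lt continuous_abs.measurable measurable_const)
  · simp only [htri]
    exact (h.continuous_tri_vel.measurable.mul h.continuous_tri_vel'.measurable).neg
  · intro u hu u' hu' R R' hR hR' e
    have hR0 : R ≠ 0 := fun h0 => by simp [h0] at hR
    have hR0' : R' ≠ 0 := fun h0 => by simp [h0] at hR'
    have hg := h.gram_pos_pairs hu.2
    have hg' := h.gram_pos_pairs hu'.2
    have huu : u = u' := by
      refine h.pairs_unique hu.2 hu'.2 (Subtype.ext ?_)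
      ext x
      show x ∈ (toGeodesic _).1 ↔ x ∈ (toGeodesic _).1
      rw [mem_toGeodesic_dirTo hg, mem_toGeodesic_dirTo hg']
      have h1 := congrArg (fun n => dot n x.1) e
      simp only [dot_smul] at h1
      constructor
      · intro h2; rw [h2, mul_zero] at h1; exact (mul_eq_zero.1 h1.symm).resolve_left hR0'
      · intro h2; rw [h2, mul_zero] at h1; exact (mul_eq_zero.1 h1).resolve_left hR0
    subst huu
    have hcr : cr (c u.1).1 (c u.2).1 ≠ 0 := fun h0 => by simp [gram, h0, dual] at hg
    exact ⟨smul_left_injective ℝ hcr e, rfl⟩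

/-- `F` is arbitrary, since the functions of the chord are defined by choice and come without
measurability. A measurable embedding transfers integrals and integrability all the same. -/
theorem integral_hitting (h : Domain D c T) (F : Geodesic K → ℝ) :
    (IntegrableOn F (hitting D) (liouville K) ↔
      IntegrableOn (fun u => jac c u.1 u.2 * F (lineOf c u)) (pairs c T)) ∧
    ∫ g in hitting D, F g ∂(liouville K) = ∫ u in pairs c T, jac c u.1 u.2 * F (lineOf c u) := by
  have hVm := h.measurableSet_pairs
  have hJm : Measurable fun u : ℝ × ℝ => ENNReal.ofReal (jac c u.1 u.2) :=
    h.measurable_jac.ennreal_ofReal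
  have hemb := measurableEmbedding_of_injOn h.measurable_lineOf hVm
    (fun u hu v hv e => h.pairs_unique hu hv e)
  set ν : Measure (ℝ × ℝ) := volume.withDensity fun u => ENNReal.ofReal (jac c u.1 u.2) with hν
  have e1 : (liouville K).restrict (hitting D) =
      Measure.map (fun v : pairs c T => lineOf c v) (Measure.comap Subtype.val ν) := by
    rw [h.liouville_restrict, ← restrict_withDensity hVm, ← map_comap_subtype_coe hVm,
      Measure.map_map h.measurable_lineOf measurable_subtype_coe]
    rfl
  have e2 : ν.restrict (pairs c T) = (volume.restrict (pairs c T)).withDensity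
      fun u => ENNReal.ofReal (jac c u.1 u.2) := restrict_withDensity hVm _
  have hfin : ∀ᵐ u ∂(volume.restrict (pairs c T)), ENNReal.ofReal (jac c u.1 u.2) < ⊤ :=
    Filter.Eventually.of_forall fun u => ENNReal.ofReal_lt_top
  have hre : ∀ u : ℝ × ℝ, (ENNReal.ofReal (jac c u.1 u.2)).toReal = jac c u.1 u.2 := fun u =>
    ENNReal.toReal_ofReal (h.jac_nonneg _ _)
  constructor
  · rw [IntegrableOn, e1, hemb.integrable_map_iff]
    have h1 := (MeasurableEmbedding.subtype_coe hVm).integrable_map_iff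
      (μ := Measure.comap Subtype.val ν) (g := fun u => F (lineOf c u))
    rw [map_comap_subtype_coe hVm] at h1
    refine Iff.trans h1.symm ?_
    rw [e2, integrable_withDensity_iff_integrable_smul' hJm hfin]
    simp only [hre, smul_eq_mul]
    rfl
  · rw [e1, hemb.integral_map, integral_subtype_comap hVm fun u => F (lineOf c u), e2,
      integral_withDensity_eq_integral_toReal_smul hJm hfin]
    simp only [hre, smul_eq_mul]

theorem liouville_hitting (h : Domain D c T) :
    liouville K (hitting D) = ∫⁻ u in pairs c T, ENNReal.ofReal (jac c u.1 u.2) := by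
  rw [← Measure.restrict_apply_univ, h.liouville_restrict,
    Measure.map_apply h.measurable_lineOf MeasurableSet.univ, preimage_univ,
    withDensity_apply _ MeasurableSet.univ, Measure.restrict_univ]

end Domain

/-! ### The distance of two boundary points -/

/-- Up to sign and a factor, the left side is `C dσ − σ dC` for the distance from x to a point
moving with velocity y'. -/
theorem sqrt_gram_deriv_aux (K : ℝ) (x y y' : Fin 3 → ℝ) :
    gram K x y x y * quad K x y' - quad K x y * gram K x y x y' =
      quad K x x * gram K y y' y x := by
  simp [gram, dual, cr, quad]; ring

/-- The distance of two boundary points. -/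
def rho {K : ℝ} (c : ℝ → Space K) (s t : ℝ) : ℝ := dst K (c s).1 (c t).1

/-- The derivative of the distance of two boundary points with respect to the first one. -/
def rhoD {K : ℝ} (c : ℝ → Space K) (s t : ℝ) : ℝ :=
  -gram K (c s).1 (vel c s) (c s).1 (c t).1 / √(gram K (c s).1 (c t).1 (c s).1 (c t).1)

theorem rho_comm {K : ℝ} (c : ℝ → Space K) (s t : ℝ) : rho c s t = rho c t s := dst_comm _ _ _

theorem jac_comm {K : ℝ} (c : ℝ → Space K) (s t : ℝ) : jac c s t = jac c t s := by
  unfold jac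
  rw [gram_swap]
  congr 1
  simp [tri]; ring

theorem rho_nonneg {K : ℝ} (c : ℝ → Space K) (s t : ℝ) : 0 ≤ rho c s t :=
  arcK_nonneg _ _ (Real.sqrt_nonneg _)

theorem rho_self {K : ℝ} (c : ℝ → Space K) (s : ℝ) : rho c s s = 0 := by
  have h1 : gram K (c s).1 (c s).1 (c s).1 (c s).1 = 0 := by simp [gram, dual, cr]; ring
  have h2 : quad K (c s).1 (c s).1 = 1 := (c s).2.1
  have h3 : cosK K 0 = 1 := by simp [cosK]
  have h4 : sinK K 0 = 0 := by simp [sinK]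
  have h5 := arcK_cosK_sinK (K := K) (le_refl 0) fun h => by positivity
  rw [h3, h4] at h5
  rw [rho, dst, h1, h2, Real.sqrt_zero]; exact h5

/-- Integrability of a nonnegative derivative with limits at both end points. -/
theorem intervalIntegrable_of_tendsto_of_nonneg {a b fa fb : ℝ} {f f' : ℝ → ℝ} (hab : a < b)
    (hderiv : ∀ x ∈ Ioo a b, HasDerivAt f (f' x) x) (hpos : ∀ x ∈ Ioo a b, 0 ≤ f' x)
    (ha : Filter.Tendsto f (nhdsWithin a (Ioi a)) (nhds fa))
    (hb : Filter.Tendsto f (nhdsWithin b (Iio b)) (nhds fb)) :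
    IntervalIntegrable f' volume a b := by
  have h1 := continuousOn_Icc_extendFrom_Ioo
    (fun x hx => (hderiv x hx).continuousAt.continuousWithinAt) ha hb
  have h2 : IntegrableOn f' (Ioc a b) := by
    refine intervalIntegral.integrableOn_deriv_of_nonneg h1 (fun x hx => ?_) hpos
    refine (hderiv x hx).congr_of_eventuallyEq ?_
    filter_upwards [isOpen_Ioo.mem_nhds hx] with y hy
    exact extendFrom_eq (subset_closure hy) (hderiv y hy).continuousAt.continuousWithinAt
  rwa [intervalIntegrable_iff_integrableOn_Ioc_of_le hab.le]

namespace Domain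

variable {K : ℝ} {D : Set (Space K)} {c : ℝ → Space K} {T : ℝ}

theorem vnorm_vel (h : Domain D c T) (t : ℝ) :
    vnorm K (vel c t) = √(gram K (c t).1 (vel c t) (c t).1 (vel c t)) := by
  rw [vnorm, h.metric_vel]

theorem continuous_vnorm_vel (h : Domain D c T) : Continuous fun t => vnorm K (vel c t) := by
  simp only [h.vnorm_vel]
  exact (Continuous.gram h.continuous_coe h.continuous_vel h.continuous_coe h.continuous_vel).sqrt

theorem periodic_vel (h : Domain D c T) : Function.Periodic (vel c) T := by
  intro t
  have h1 : (fun s => (c (s + T) : Fin 3 → ℝ)) = fun s => (c s : Fin 3 → ℝ) := by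
    funext s; rw [h.bd.periodic s]
  rw [vel, ← deriv_comp_add_const (f := fun s => (c s : Fin 3 → ℝ)), h1]; rfl

theorem periodic_rho (h : Domain D c T) (s : ℝ) : Function.Periodic (rho c s) T := by
  intro t; rw [rho, h.bd.periodic t]; rfl

theorem periodic_rhoD (h : Domain D c T) (s : ℝ) : Function.Periodic (rhoD c s) T := by
  intro t; rw [rhoD, h.bd.periodic t]; rfl

theorem periodic_rhoD' (h : Domain D c T) (s : ℝ) : Function.Periodic (fun t => rhoD c t s) T := by
  intro t; simp only [rhoD, h.bd.periodic t, h.periodic_vel t]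

theorem periodic_jac (h : Domain D c T) (s : ℝ) : Function.Periodic (jac c s) T := by
  intro t; simp only [jac, h.bd.periodic t, h.periodic_vel t]

theorem gram_pos_of_mem_Ioo (h : Domain D c T) {s t : ℝ} (ht : t ∈ Ioo s (s + T)) :
    0 < gram K (c s).1 (c t).1 (c s).1 (c t).1 := by
  refine gram_pos_of_ne h.convex (h.mem s) (h.mem t) fun e => ?_
  have hI := h.bd.injOn
  obtain ⟨n, hn, -⟩ := existsUnique_add_zsmul_mem_Ico h.bd.period_pos s 0
  obtain ⟨m, hm, -⟩ := existsUnique_add_zsmul_mem_Ico h.bd.period_pos t 0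
  rw [zero_add] at hn hm
  have e1 := hI hn hm (by
    simp only [zsmul_eq_mul]
    rw [(h.bd.periodic.int_mul n) s, (h.bd.periodic.int_mul m) t, e])
  have hT := h.bd.period_pos
  simp only [zsmul_eq_mul] at e1
  have h1 : t - s = (n - m : ℤ) * T := by push_cast; linarith
  have h2 : (0 : ℝ) < (n - m : ℤ) := by
    by_contra hcon
    push Not at hcon
    have := mul_nonpos_of_nonpos_of_nonneg hcon hT.le
    linarith [ht.1]
  have h3 : ((n - m : ℤ) : ℝ) < 1 := by
    by_contra hcon
    push Not at hcon
    have := mul_le_mul_of_nonneg_right hcon hT.le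
    linarith [ht.2]
  have h4 : (0 : ℤ) < n - m := by exact_mod_cast h2
  have h5 : (n - m : ℤ) < 1 := by exact_mod_cast h3
  omega

theorem hasDerivAt_quad (h : Domain D c T) (x : Fin 3 → ℝ) (t : ℝ) :
    HasDerivAt (fun t => quad K x (c t).1) (quad K x (vel c t)) t := by
  have h1 := fun i => (hasDerivAt_pi.1 (h.hasDerivAt t) i)
  exact ((h1 0).const_mul (x 0)).add ((((h1 1).const_mul (x 1)).add ((h1 2).const_mul (x 2))).const_mul K)

theorem hasDerivAt_gram (h : Domain D c T) (x u : Fin 3 → ℝ) (t : ℝ) :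
    HasDerivAt (fun t => gram K x u x (c t).1) (gram K x u x (vel c t)) t := by
  have h1 := fun i => (hasDerivAt_pi.1 (h.hasDerivAt t) i)
  have h2 := ((((((h1 2).const_mul (x 1)).sub ((h1 1).const_mul (x 2))).const_mul
    (cr x u 0)).const_mul K).add ((((h1 0).const_mul (x 2)).sub ((h1 2).const_mul (x 0))).const_mul
    (cr x u 1))).add ((((h1 1).const_mul (x 0)).sub ((h1 0).const_mul (x 1))).const_mul (cr x u 2))
  exact h2

theorem hasDerivAt_gram_self (h : Domain D c T) (x : Fin 3 → ℝ) (t : ℝ) :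
    HasDerivAt (fun t => gram K x (c t).1 x (c t).1) (2 * gram K x (c t).1 x (vel c t)) t := by
  have h1 := fun i => (hasDerivAt_pi.1 (h.hasDerivAt t) i)
  have a0 := ((h1 2).const_mul (x 1)).sub ((h1 1).const_mul (x 2))
  have a1 := ((h1 0).const_mul (x 2)).sub ((h1 2).const_mul (x 0))
  have a2 := ((h1 1).const_mul (x 0)).sub ((h1 0).const_mul (x 1))
  refine ((((a0.mul a0).const_mul K).add (a1.mul a1)).add (a2.mul a2)).congr_deriv ?_
  simp [gram, dual, cr]; ring

theorem hasDerivAt_sqrt_gram (h : Domain D c T) {x : Fin 3 → ℝ} {t : ℝ}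
    (hp : 0 < gram K x (c t).1 x (c t).1) :
    HasDerivAt (fun t => √(gram K x (c t).1 x (c t).1))
      (gram K x (c t).1 x (vel c t) / √(gram K x (c t).1 x (c t).1)) t := by
  refine ((h.hasDerivAt_gram_self x t).sqrt hp.ne').congr_deriv ?_
  field_simp

theorem hasDerivAt_dst (h : Domain D c T) {x : Space K} {t : ℝ}
    (hp : 0 < gram K x.1 (c t).1 x.1 (c t).1) :
    HasDerivAt (fun t => dst K x.1 (c t).1)
      (-gram K (c t).1 (vel c t) (c t).1 x.1 / √(gram K x.1 (c t).1 x.1 (c t).1)) t := by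
  have hσ := Real.sqrt_pos.2 hp
  have hsq := Real.sq_sqrt hp.le
  have hx : quad K x.1 x.1 = 1 := x.2.1
  have hy : quad K (c t).1 (c t).1 = 1 := (c t).2.1
  have hv := h.quad_vel t
  refine (hasDerivAt_arcK (h.hasDerivAt_quad x.1 t) (h.hasDerivAt_sqrt_gram hp)
    (quad_sq_add x.2 (c t).2) hσ (fun hK => quad_pos x.2 (c t).2 hK) ?_).congr_deriv ?_
  · rw [mul_div_cancel₀ _ hσ.ne', K_mul_gram, hv, hx, quad_comm K (c t).1]
    ring
  · have := sqrt_gram_deriv_aux K x.1 (c t).1 (vel c t)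
    rw [hx, one_mul] at this
    rw [← this, neg_sub, sub_div, mul_div_assoc, mul_comm (gram _ _ _ _ _), mul_div_assoc]
    conv_rhs => rw [← hsq, Real.sqrt_sq hσ.le]
    field_simp

/-- `rhoD` differentiates in its first parameter, so the derivative in the second one has the
arguments exchanged. -/
theorem hasDerivAt_rho (h : Domain D c T) {s t : ℝ}
    (hp : 0 < gram K (c s).1 (c t).1 (c s).1 (c t).1) :
    HasDerivAt (rho c s) (rhoD c t s) t := by
  refine (h.hasDerivAt_dst hp).congr_deriv ?_
  rw [rhoD, gram_swap K (c t).1]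

/-- The density of the invariant measure is the mixed second derivative of the distance: this is
what makes the chord formula an integration by parts. -/
theorem hasDerivAt_rhoD (h : Domain D c T) {s t : ℝ}
    (hp : 0 < gram K (c s).1 (c t).1 (c s).1 (c t).1) :
    HasDerivAt (rhoD c s) (jac c s t) t := by
  have hσ := Real.sqrt_pos.2 hp
  have hsq := Real.sq_sqrt hp.le
  refine ((h.hasDerivAt_gram (c s).1 (vel c s) t).neg.div (h.hasDerivAt_sqrt_gram hp)
    hσ.ne').congr_deriv ?_
  have hm := gram_lagrange_mixed K (c s).1 (c t).1 (vel c s) (vel c t)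
  rw [(c s).2.1, one_mul] at hm
  rw [jac, ← hm]
  simp only [Pi.neg_apply]
  field_simp
  rw [hsq]
  ring

theorem continuous_rho (h : Domain D c T) : Continuous fun u : ℝ × ℝ => rho c u.1 u.2 := by
  have h1 : Continuous fun u : ℝ × ℝ => quad K (c u.1).1 (c u.2).1 :=
    (h.continuous_coe.comp continuous_fst).quad (h.continuous_coe.comp continuous_snd)
  have h2 := (continuous_arcK K).comp (h1.prodMk h.continuous_gram.sqrt)
  simp only [rho, dst]
  exact h2

theorem measurable_rhoD (h : Domain D c T) : Measurable fun u : ℝ × ℝ => rhoD c u.1 u.2 := by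
  have h1 : Continuous fun u : ℝ × ℝ => gram K (c u.1).1 (vel c u.1) (c u.1).1 (c u.2).1 :=
    Continuous.gram (h.continuous_coe.comp continuous_fst) (h.continuous_vel.comp continuous_fst)
      (h.continuous_coe.comp continuous_fst) (h.continuous_coe.comp continuous_snd)
  have h2 := h1.neg.measurable.div h.continuous_gram.sqrt.measurable
  exact h2

/-- Cauchy–Schwarz, as `gram_lagrange` without its square of a triple product. -/
theorem abs_rhoD_le (h : Domain D c T) (s t : ℝ) : |rhoD c s t| ≤ vnorm K (vel c s) := by
  rw [rhoD, abs_div, abs_neg, abs_of_nonneg (Real.sqrt_nonneg _), h.vnorm_vel]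
  refine div_le_of_le_mul₀ (Real.sqrt_nonneg _) (Real.sqrt_nonneg _) ?_
  rw [← Real.sqrt_mul (gram_nonneg (c s).2 _)]
  refine Real.abs_le_sqrt ?_
  rw [← gram_lagrange, (c s).2.1]
  nlinarith [sq_nonneg (tri (c s).1 (vel c s) (c t).1)]

/-- With the difference quotient w of the curve, the numerator of `rhoD` carries the factor t − s
and the root the factor |t − s|; the sign of their ratio separates the two sides. -/
theorem tendsto_rhoD_right (h : Domain D c T) (s : ℝ) :
    Filter.Tendsto (rhoD c s) (nhdsWithin s (Ioi s)) (nhds (-vnorm K (vel c s))) ∧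
    Filter.Tendsto (rhoD c s) (nhdsWithin s (Iio s)) (nhds (vnorm K (vel c s))) := by
  have hs := hasDerivAt_iff_tendsto_slope.1 (h.hasDerivAt s)
  set w : ℝ → Fin 3 → ℝ := slope (fun s => (c s : Fin 3 → ℝ)) s
  have hcr : ∀ t, cr (c s).1 (c t).1 = (t - s) • cr (c s).1 (w t) := by
    intro t
    have : (c t).1 = (c s).1 + (t - s) • w t := by
      have := sub_smul_slope (fun s => (c s : Fin 3 → ℝ)) s t
      show _ = _ + (t - s) • slope (fun s => (c s : Fin 3 → ℝ)) s t
      rw [this]; simp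
    rw [this]
    ext i; fin_cases i <;> simp [cr] <;> ring
  have c1 : Continuous fun z : Fin 3 → ℝ => gram K (c s).1 (vel c s) (c s).1 z :=
    Continuous.gram continuous_const continuous_const continuous_const continuous_id
  have c2 : Continuous fun z : Fin 3 → ℝ => gram K (c s).1 z (c s).1 z :=
    Continuous.gram continuous_const continuous_id continuous_const continuous_id
  have hpos : 0 < gram K (c s).1 (vel c s) (c s).1 (vel c s) := by
    rw [← h.metric_vel]; exact h.metric_vel_pos s
  have hlim : Filter.Tendsto (fun t => gram K (c s).1 (vel c s) (c s).1 (w t) /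
      √(gram K (c s).1 (w t) (c s).1 (w t))) (nhdsWithin s {s}ᶜ) (nhds (vnorm K (vel c s))) := by
    have := ((c1.tendsto _).comp hs).div ((c2.sqrt.tendsto _).comp hs) (Real.sqrt_pos.2 hpos).ne'
    rw [h.vnorm_vel]
    rwa [Real.div_sqrt] at this
  have e1 : ∀ t, gram K (c s).1 (vel c s) (c s).1 (c t).1 =
      (t - s) * gram K (c s).1 (vel c s) (c s).1 (w t) := by
    intro t
    rw [gram, hcr, gram]
    have := dual_smul_smul K 1 (t - s) (cr (c s).1 (vel c s)) (cr (c s).1 (w t))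
    rw [one_smul, one_mul] at this
    exact this
  have e2 : ∀ t, √(gram K (c s).1 (c t).1 (c s).1 (c t).1) =
      |t - s| * √(gram K (c s).1 (w t) (c s).1 (w t)) := by
    intro t
    rw [gram, hcr, dual_smul_smul, Real.sqrt_mul (mul_self_nonneg _), Real.sqrt_mul_self_eq_abs, gram]
  constructor
  · refine ((hlim.mono_left (nhdsWithin_mono _ fun t ht => ne_of_gt ht)).neg).congr' ?_
    filter_upwards [self_mem_nhdsWithin] with t ht
    have ht' : 0 < t - s := sub_pos.2 ht
    rw [rhoD, e1, e2, abs_of_pos ht', neg_div, mul_div_mul_left _ _ ht'.ne']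
  · refine (hlim.mono_left (nhdsWithin_mono _ fun t ht => ne_of_lt ht)).congr' ?_
    filter_upwards [self_mem_nhdsWithin] with t ht
    have ht' : t - s < 0 := sub_neg.2 ht
    rw [rhoD, e1, e2, abs_of_neg ht', ← neg_mul, mul_div_mul_left _ _ (by linarith)]

theorem tendsto_rhoD_period (h : Domain D c T) (s : ℝ) :
    Filter.Tendsto (rhoD c s) (nhdsWithin (s + T) (Iio (s + T))) (nhds (vnorm K (vel c s))) := by
  have h1 : Filter.Tendsto (fun t => t - T) (nhdsWithin (s + T) (Iio (s + T)))
      (nhdsWithin s (Iio s)) := by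
    refine tendsto_nhdsWithin_iff.2 ⟨?_, ?_⟩
    · have : Continuous fun t : ℝ => t - T := by fun_prop
      have := this.tendsto (s + T)
      rw [add_sub_cancel_right] at this
      exact this.mono_left nhdsWithin_le_nhds
    · filter_upwards [self_mem_nhdsWithin] with t ht
      have : t < s + T := ht
      show t - T < s
      linarith
  refine ((h.tendsto_rhoD_right s).2.comp h1).congr fun t => ?_
  exact (h.periodic_rhoD s).sub_eq t

/-! ### Integration by parts over one period of the boundary -/

theorem intervalIntegrable_jac (h : Domain D c T) (s a b : ℝ) :
    IntervalIntegrable (jac c s) volume a b := by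
  have hT := h.bd.period_pos
  refine (h.periodic_jac s).intervalIntegrable hT.ne' (t := s) ?_ a b
  -- Near the diagonal `jac` need not be bounded; it is integrable because it is nonnegative and its
  -- primitive `rhoD` has finite limits.
  exact intervalIntegrable_of_tendsto_of_nonneg (by linarith)
    (fun t ht => h.hasDerivAt_rhoD (h.gram_pos_of_mem_Ioo ht)) (fun t _ => h.jac_nonneg s t)
    (h.tendsto_rhoD_right s).1 (h.tendsto_rhoD_period s)

theorem integral_jac (h : Domain D c T) (s : ℝ) :
    ∫ t in (0 : ℝ)..T, jac c s t = 2 * vnorm K (vel c s) := by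
  have hT := h.bd.period_pos
  have := (h.periodic_jac s).intervalIntegral_add_eq 0 s
  rw [zero_add] at this
  rw [this, intervalIntegral.integral_eq_sub_of_hasDerivAt_of_tendsto (by linarith)
    (fun t ht => h.hasDerivAt_rhoD (h.gram_pos_of_mem_Ioo ht)) (h.intervalIntegrable_jac s _ _)
    (h.tendsto_rhoD_right s).1 (h.tendsto_rhoD_period s)]
  ring

theorem continuous_rho_right (h : Domain D c T) (s : ℝ) : Continuous (rho c s) := by
  have h1 : Continuous fun t : ℝ => (s, t) := by fun_prop
  have h2 := h.continuous_rho.comp h1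
  exact h2

theorem intervalIntegrable_rhoD_mul (h : Domain D c T) {φ : ℝ → ℝ} (hφ : Continuous φ) (s a b : ℝ) :
    IntervalIntegrable (fun t => φ (rho c s t) * rhoD c s t * rhoD c t s) volume a b := by
  have m1 : Measurable (fun t => rhoD c s t) := by
    have := h.measurable_rhoD.comp (measurable_prodMk_left (x := s))
    exact this
  have m2 : Measurable (fun t => rhoD c t s) := by
    have := h.measurable_rhoD.comp (measurable_prodMk_right (y := s))
    exact this
  have hc : Continuous fun t => φ (rho c s t) := hφ.comp (h.continuous_rho_right s)
  have hb : Continuous fun t => |φ (rho c s t)| * vnorm K (vel c s) * vnorm K (vel c t) :=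
    (hc.abs.mul continuous_const).mul h.continuous_vnorm_vel
  refine (hb.intervalIntegrable a b).mono_fun
    ((hc.measurable.mul m1).mul m2).aestronglyMeasurable (Filter.Eventually.of_forall fun t => ?_)
  have n1 := Real.sqrt_nonneg (metric K (vel c s) (vel c s))
  have n2 := Real.sqrt_nonneg (metric K (vel c t) (vel c t))
  simp only [Real.norm_eq_abs, abs_mul, abs_abs]
  rw [vnorm] at *
  rw [vnorm, abs_of_nonneg n1, abs_of_nonneg n2]
  gcongr
  · exact h.abs_rhoD_le s t
  · exact h.abs_rhoD_le t s

theorem intervalIntegrable_mul_jac (h : Domain D c T) {φ : ℝ → ℝ} (hφ : Continuous φ) (s a b : ℝ) :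
    IntervalIntegrable (fun t => φ (rho c s t) * jac c s t) volume a b :=
  (h.intervalIntegrable_jac s a b).continuousOn_mul (hφ.comp (h.continuous_rho_right s)).continuousOn

/-- On (s, s + T) the integrand is the t-derivative of f(ρ) ∂ρ/∂s, with limits −f(0)|c'(s)| and
f(0)|c'(s)| at the ends, where ρ vanishes. -/
theorem integral_add_jac (h : Domain D c T) {f : ℝ → ℝ} (hf : ContDiff ℝ 1 f) (s : ℝ) :
    ∫ t in (0 : ℝ)..T, (f (rho c s t) * jac c s t +
      deriv f (rho c s t) * rhoD c s t * rhoD c t s) = 2 * f 0 * vnorm K (vel c s) := by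
  have hT := h.bd.period_pos
  have hper : Function.Periodic (fun t => f (rho c s t) * jac c s t +
      deriv f (rho c s t) * rhoD c s t * rhoD c t s) T := by
    intro t
    simp only [h.periodic_jac s t, h.periodic_rho s t, h.periodic_rhoD s t, h.periodic_rhoD' s t]
  have := hper.intervalIntegral_add_eq 0 s
  rw [zero_add] at this
  have hρ := h.continuous_rho_right s
  have l1 : Filter.Tendsto (fun t => f (rho c s t)) (nhdsWithin s (Ioi s)) (nhds (f 0)) := by
    have := (hf.continuous.comp hρ).tendsto s
    simp only [Function.comp_apply, rho_self] at this
    exact this.mono_left nhdsWithin_le_nhds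
  have l2 : Filter.Tendsto (fun t => f (rho c s t)) (nhdsWithin (s + T) (Iio (s + T)))
      (nhds (f 0)) := by
    have := (hf.continuous.comp hρ).tendsto (s + T)
    simp only [Function.comp_apply, h.periodic_rho s s, rho_self] at this
    exact this.mono_left nhdsWithin_le_nhds
  rw [this, intervalIntegral.integral_eq_sub_of_hasDerivAt_of_tendsto (by linarith)
    (f := fun t => f (rho c s t) * rhoD c s t) (fun t ht => ?_)
    ((h.intervalIntegrable_mul_jac hf.continuous s _ _).add
      (h.intervalIntegrable_rhoD_mul (hf.continuous_deriv le_rfl) s _ _))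
    (l1.mul (h.tendsto_rhoD_right s).1) (l2.mul (h.tendsto_rhoD_period s))]
  · ring
  · have hp := h.gram_pos_of_mem_Ioo ht
    have d1 := (hf.differentiable one_ne_zero (rho c s t)).hasDerivAt.comp t (h.hasDerivAt_rho hp)
    refine (d1.mul (h.hasDerivAt_rhoD hp)).congr_deriv ?_
    simp only [Function.comp_apply]
    ring

end Domain

/-! ### Integration over all pairs of boundary points -/

/-- The square of parameters. -/
def square (T : ℝ) : Set (ℝ × ℝ) := Ico 0 T ×ˢ Ico 0 T

/-- The part of the square of parameters above the diagonal. -/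
def upper (T : ℝ) : Set (ℝ × ℝ) := {u | u ∈ square T ∧ u.1 < u.2}

theorem measurableSet_square (T : ℝ) : MeasurableSet (square T) :=
  measurableSet_Ico.prod measurableSet_Ico

theorem measurableSet_upper (T : ℝ) : MeasurableSet (upper T) :=
  (measurableSet_square T).inter (measurableSet_lt measurable_fst measurable_snd)

theorem upper_subset (T : ℝ) : upper T ⊆ square T := fun _ h => h.1

theorem pairs_subset_upper {K : ℝ} (c : ℝ → Space K) (T : ℝ) : pairs c T ⊆ upper T :=
  fun _ hu => ⟨⟨⟨hu.1, hu.2.1.trans hu.2.2.1⟩, ⟨hu.1.trans hu.2.1.le, hu.2.2.1⟩⟩, hu.2.1⟩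

theorem volume_restrict_square (T : ℝ) : (volume : Measure (ℝ × ℝ)).restrict (square T) =
    (volume.restrict (Ico 0 T)).prod (volume.restrict (Ico 0 T)) := by
  rw [Measure.prod_restrict]; rfl

theorem volume_diagonal : (volume : Measure (ℝ × ℝ)) {u | u.1 = u.2} = 0 := by
  have hm : MeasurableSet {u : ℝ × ℝ | u.1 = u.2} := measurableSet_eq_fun measurable_fst measurable_snd
  rw [Measure.volume_eq_prod, Measure.measure_prod_null hm]
  refine Filter.Eventually.of_forall fun x => ?_
  have : Prod.mk x ⁻¹' {u : ℝ × ℝ | u.1 = u.2} = {x} := by ext y; simp [eq_comm]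
  show volume _ = 0
  rw [this]; simp

theorem integral_eq_two_mul_of_swap {S : Set (ℝ × ℝ)}
    (hsw : ∀ u, u ∈ S → u.swap ∈ S) {F : ℝ × ℝ → ℝ} (hF : ∀ u, F u.swap = F u)
    (hi : IntegrableOn F S) :
    ∫ u in S, F u = 2 * ∫ u in S ∩ {u | u.1 < u.2}, F u := by
  have hm : MeasurableSet {u : ℝ × ℝ | u.1 < u.2} := measurableSet_lt measurable_fst measurable_snd
  have hm' : MeasurableSet {u : ℝ × ℝ | u.2 < u.1} := measurableSet_lt measurable_snd measurable_fst
  have e1 := integral_inter_add_sdiff hm hi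
  have e2 : ∫ u in S \ {u | u.1 < u.2}, F u = ∫ u in S ∩ {u | u.2 < u.1}, F u := by
    refine setIntegral_congr_set ?_
    have h0 : ∀ᵐ u : ℝ × ℝ, u.1 ≠ u.2 := by
      rw [ae_iff]; simpa using volume_diagonal
    filter_upwards [h0] with u hu
    refine propext ⟨fun h => ⟨h.1, ?_⟩, fun h => ⟨h.1, ?_⟩⟩
    · exact lt_of_le_of_ne (not_lt.1 h.2) hu.symm
    · exact not_lt.2 (le_of_lt (show u.2 < u.1 from h.2))
  have e3 : ∫ u in S ∩ {u | u.2 < u.1}, F u = ∫ u in S ∩ {u | u.1 < u.2}, F u := by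
    have hp : MeasurePreserving (Prod.swap : ℝ × ℝ → ℝ × ℝ) volume volume :=
      Measure.measurePreserving_swap
    have := hp.setIntegral_preimage_emb MeasurableEquiv.prodComm.measurableEmbedding F
      (S ∩ {u | u.2 < u.1})
    rw [← this]
    have hset : Prod.swap ⁻¹' (S ∩ {u : ℝ × ℝ | u.2 < u.1}) = S ∩ {u | u.1 < u.2} := by
      ext u
      refine ⟨fun h => ⟨?_, h.2⟩, fun h => ⟨hsw u h.1, h.2⟩⟩
      have := hsw _ h.1
      rwa [Prod.swap_swap] at this
    rw [hset]
    exact integral_congr_ae (Filter.Eventually.of_forall fun u => hF u)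
  rw [← e1, e2, e3]; ring

theorem integrableOn_of_interval {T : ℝ} {F : ℝ → ℝ} (hF : IntervalIntegrable F volume 0 T)
    (hT : 0 < T) :
    Integrable F (volume.restrict (Ico 0 T)) :=
  (intervalIntegrable_iff_integrableOn_Ico_of_le hT.le).1 hF

theorem integral_Ico {T : ℝ} (F : ℝ → ℝ) (hT : 0 < T) :
    ∫ t in Ico 0 T, F t = ∫ t in (0 : ℝ)..T, F t := by
  rw [intervalIntegral.integral_of_le hT.le, integral_Ico_eq_integral_Ioc]

theorem square_symm {T : ℝ} {F : ℝ × ℝ → ℝ} (hF : ∀ u, F u.swap = F u)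
    (hi : IntegrableOn F (square T)) :
    ∫ u in square T, F u = 2 * ∫ u in upper T, F u :=
  integral_eq_two_mul_of_swap (S := square T) (fun _ hu => ⟨hu.2, hu.1⟩) hF hi

theorem jac_eq_zero {K : ℝ} {c : ℝ → Space K} {T : ℝ} {u : ℝ × ℝ}
    (hu : u ∈ upper T \ pairs c T) :
    jac c u.1 u.2 = 0 := by
  have : tri (c u.1).1 (vel c u.1) (c u.2).1 = 0 := by
    by_contra h0
    exact hu.2 ⟨hu.1.1.1.1, hu.1.2, hu.1.1.2.2, h0⟩
  rw [jac, this]; simp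

theorem integral_pairs_jac {K : ℝ} (c : ℝ → Space K) (T : ℝ) (φ : ℝ × ℝ → ℝ) :
    ∫ u in pairs c T, φ u * jac c u.1 u.2 = ∫ u in upper T, φ u * jac c u.1 u.2 := by
  refine (setIntegral_eq_of_subset_of_forall_sdiff_eq_zero (measurableSet_upper T)
    (pairs_subset_upper c T) fun u hu => ?_).symm
  rw [jac_eq_zero hu, mul_zero]

namespace Domain

variable {K : ℝ} {D : Set (Space K)} {c : ℝ → Space K} {T : ℝ}

theorem integrableOn_jac (h : Domain D c T) :
    IntegrableOn (fun u : ℝ × ℝ => jac c u.1 u.2) (square T) := by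
  have hT := h.bd.period_pos
  rw [IntegrableOn, volume_restrict_square,
    integrable_prod_iff h.measurable_jac.aestronglyMeasurable]
  refine ⟨Filter.Eventually.of_forall fun s =>
    integrableOn_of_interval (h.intervalIntegrable_jac s 0 T) hT, ?_⟩
  have : (fun s => ∫ t in Ico 0 T, ‖jac c s t‖) = fun s => 2 * vnorm K (vel c s) := by
    funext s
    simp only [Real.norm_of_nonneg (h.jac_nonneg _ _)]
    rw [integral_Ico _ hT, h.integral_jac]
  rw [this]
  exact integrableOn_of_interval
    ((continuous_const.mul h.continuous_vnorm_vel).intervalIntegrable _ _) hT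

theorem integrableOn_mul_jac (h : Domain D c T) {φ : ℝ → ℝ} (hφ : Continuous φ) :
    IntegrableOn (fun u : ℝ × ℝ => φ (rho c u.1 u.2) * jac c u.1 u.2) (square T) :=
  IntegrableOn.continuousOn_mul_of_subset (hφ.comp h.continuous_rho).continuousOn
    h.integrableOn_jac (isCompact_Icc.prod isCompact_Icc) (measurableSet_square T)
    (prod_mono Ico_subset_Icc_self Ico_subset_Icc_self)

theorem integrableOn_rhoD_mul (h : Domain D c T) {φ : ℝ → ℝ} (hφ : Continuous φ) :
    IntegrableOn (fun u : ℝ × ℝ => φ (rho c u.1 u.2) * (rhoD c u.1 u.2 * rhoD c u.2 u.1))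
      (square T) := by
  have m1 := h.measurable_rhoD
  have m2 : Measurable fun u : ℝ × ℝ => rhoD c u.2 u.1 := by
    have := m1.comp measurable_swap
    exact this
  have hv : Continuous fun u : ℝ × ℝ => vnorm K (vel c u.1) * vnorm K (vel c u.2) :=
    (h.continuous_vnorm_vel.comp continuous_fst).mul (h.continuous_vnorm_vel.comp continuous_snd)
  refine IntegrableOn.continuousOn_mul_of_subset (hφ.comp h.continuous_rho).continuousOn
    ?_ (isCompact_Icc.prod isCompact_Icc) (measurableSet_square T)
    (prod_mono Ico_subset_Icc_self Ico_subset_Icc_self)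
  have hi : IntegrableOn (fun u : ℝ × ℝ => vnorm K (vel c u.1) * vnorm K (vel c u.2)) (square T) :=
    (hv.continuousOn.integrableOn_compact (isCompact_Icc.prod isCompact_Icc)).mono_set
      (prod_mono Ico_subset_Icc_self Ico_subset_Icc_self)
  refine Integrable.mono' hi (m1.mul m2).aestronglyMeasurable
    (Filter.Eventually.of_forall fun u => ?_)
  rw [Real.norm_eq_abs, abs_mul]
  exact mul_le_mul (h.abs_rhoD_le _ _) (h.abs_rhoD_le _ _) (abs_nonneg _) (Real.sqrt_nonneg _)

theorem integral_square (h : Domain D c T) {f : ℝ → ℝ} (hf : ContDiff ℝ 1 f) :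
    (∫ u in square T, f (rho c u.1 u.2) * jac c u.1 u.2) +
      ∫ u in square T, deriv f (rho c u.1 u.2) * (rhoD c u.1 u.2 * rhoD c u.2 u.1) =
    2 * (f 0 * curveLength c T) := by
  have hT := h.bd.period_pos
  have i1 := h.integrableOn_mul_jac hf.continuous
  have i2 := h.integrableOn_rhoD_mul (hf.continuous_deriv le_rfl)
  rw [← integral_add i1 i2]
  have i3 := Integrable.add i1 i2
  rw [volume_restrict_square] at i3 ⊢
  refine (integral_prod _ i3).trans ?_
  simp only [Pi.add_apply]
  have : (fun s => ∫ t in Ico 0 T, (f (rho c s t) * jac c s t +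
      deriv f (rho c s t) * (rhoD c s t * rhoD c t s))) = fun s => 2 * f 0 * vnorm K (vel c s) := by
    funext s
    rw [integral_Ico _ hT, ← h.integral_add_jac hf]
    simp only [mul_assoc]
  simp only [this]
  rw [integral_Ico _ hT, intervalIntegral.integral_const_mul, curveLength]
  ring

/-- Symmetry in (s,t) halves the identity over the square. The density vanishes on non-transversal
pairs, but the other integrand does not, so its domain remains all of `upper T`; the excess is the
segment term. -/
theorem integral_pairs (h : Domain D c T) {f : ℝ → ℝ} (hf : ContDiff ℝ 1 f) :
    ∫ u in pairs c T, f (rho c u.1 u.2) * jac c u.1 u.2 = f 0 * curveLength c T -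
      ∫ u in upper T, deriv f (rho c u.1 u.2) * (rhoD c u.1 u.2 * rhoD c u.2 u.1) := by
  have e := h.integral_square hf
  rw [square_symm (fun u => by simp [rho_comm c u.2, jac_comm c u.2])
    (h.integrableOn_mul_jac hf.continuous),
    square_symm (fun u => by simp only [Prod.fst_swap, Prod.snd_swap, rho_comm c u.2]; ring)
    (h.integrableOn_rhoD_mul (hf.continuous_deriv le_rfl))] at e
  rw [integral_pairs_jac c T fun u => f (rho c u.1 u.2)]
  linarith

theorem crofton (h : Domain D c T) :
    liouville K (hitting D) = ENNReal.ofReal (curveLength c T) := by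
  have e := h.integral_pairs (f := fun _ => 1) contDiff_const
  simp only [one_mul, deriv_const, zero_mul, integral_zero, sub_zero] at e
  rw [h.liouville_hitting, ← e, ofReal_integral_eq_lintegral_ofReal]
  · exact (h.integrableOn_jac.mono_set (upper_subset T)).mono_set (pairs_subset_upper c T)
  · exact Filter.Eventually.of_forall fun u => h.jac_nonneg _ _

end Domain

/-! ### The angles between a chord and the boundary -/

theorem cot_arccos {z : ℝ} (hz : |z| ≤ 1) : Real.cot (Real.arccos z) = z / √(1 - z ^ 2) := by
  rw [Real.cot_eq_cos_div_sin, Real.sin_arccos, Real.cos_arccos (abs_le.1 hz).1 (abs_le.1 hz).2]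

/-- By `gram_lagrange`, `metric K u v` and `|tri x v u|` are the length of u times the cosine and
the sine of the angle. -/
theorem cot_angle {K : ℝ} {x u v : Fin 3 → ℝ} (hx : IsPoint K x) (hu : quad K x u = 0)
    (hv : quad K x v = 0) (hv1 : metric K v v = 1) (hs : tri x v u ≠ 0) :
    Real.cot (angle K u v) = metric K u v / |tri x v u| := by
  have e := gram_lagrange K x u v
  rw [← metric_eq_gram hx hu hv, ← metric_eq_gram hx hu hu, ← metric_eq_gram hx hv hv, hv1, hx.1,
    show tri x u v = -tri x v u by simp [tri]; ring] at e
  have hs2 : 0 < tri x v u ^ 2 := by positivity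
  have hm : 0 < metric K u u := by nlinarith [sq_nonneg (metric K u v)]
  have hq := Real.sqrt_pos.2 hm
  have hsq := Real.sq_sqrt hm.le
  have hz : 1 - (metric K u v / √(metric K u u)) ^ 2 = (|tri x v u| / √(metric K u u)) ^ 2 := by
    rw [div_pow, div_pow, hsq, sq_abs]
    field_simp
    linarith
  have hz1 : |metric K u v / √(metric K u u)| ≤ 1 := by
    rw [← sq_le_one_iff_abs_le_one]
    nlinarith [sq_nonneg (|tri x v u| / √(metric K u u))]
  have habs := abs_pos.2 hs
  rw [angle, vnorm, vnorm, hv1, Real.sqrt_one, mul_one, cot_arccos hz1, hz,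
    Real.sqrt_sq (by positivity)]
  field_simp

theorem quad_geoVel {K : ℝ} (q : UnitTangent K) (t : ℝ) : quad K (geo q t).1 (geoVel q t) = 0 :=
  (q.flow t).2.2.1

theorem metric_geoVel {K : ℝ} (q : UnitTangent K) (t : ℝ) :
    metric K (geoVel q t) (geoVel q t) = 1 := (q.flow t).2.2.2

namespace Domain

variable {K : ℝ} {D : Set (Space K)} {c : ℝ → Space K} {T : ℝ}

theorem vel_eq_of_eq (h : Domain D c T) {s t : ℝ} (e : c s = c t) : vel c s = vel c t := by
  obtain ⟨n, hn, -⟩ := existsUnique_add_zsmul_mem_Ico h.bd.period_pos s 0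
  obtain ⟨m, hm, -⟩ := existsUnique_add_zsmul_mem_Ico h.bd.period_pos t 0
  rw [zero_add] at hn hm
  simp only [zsmul_eq_mul] at hn hm
  have e1 := h.bd.injOn hn hm (by
    rw [(h.bd.periodic.int_mul n) s, (h.bd.periodic.int_mul m) t, e])
  rw [← (h.periodic_vel.int_mul n) s, ← (h.periodic_vel.int_mul m) t, e1]

theorem sideTangent_eq (h : Domain D c T) {q : UnitTangent K} {a : ℝ}
    (hs : side q (vel c a) ≠ 0) :
    (sideTangent c q (c a) = vel c a ∨ sideTangent c q (c a) = -vel c a) ∧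
      0 < side q (sideTangent c q (c a)) := by
  have hneg : side q (-vel c a) = -side q (vel c a) := by
    rw [side_eq, side_eq]; simp [tri]; ring
  have hex : ∃ τ, ∃ t, c t = c a ∧ (τ = vel c t ∨ τ = -vel c t) ∧ 0 < side q τ := by
    rcases hs.lt_or_gt with h1 | h1
    · exact ⟨-vel c a, a, rfl, Or.inr rfl, by rw [hneg]; linarith⟩
    · exact ⟨vel c a, a, rfl, Or.inl rfl, h1⟩
  obtain ⟨t, ht, h2, h3⟩ := Classical.epsilon_spec hex
  rw [h.vel_eq_of_eq ht] at h2
  exact ⟨h2, h3⟩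

/-- The cotangent of the angle between the boundary and a geodesic. -/
theorem cot_sideTangent (h : Domain D c T) {q : UnitTangent K} {a : ℝ} {w : Fin 3 → ℝ}
    (hw : quad K (c a).1 w = 0) (hw1 : metric K w w = 1)
    (hcr : cr (c a).1 w = cr q.1.1 q.1.2 ∨ cr (c a).1 w = -cr q.1.1 q.1.2)
    (hs : side q (vel c a) ≠ 0) :
    Real.cot (angle K (sideTangent c q (c a)) w) = metric K (vel c a) w / side q (vel c a) := by
  obtain ⟨h1, h2⟩ := h.sideTangent_eq hs
  have hv := h.quad_vel a
  set τ := sideTangent c q (c a)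
  have ht : ∀ z, |tri (c a).1 w z| = |side q z| := by
    intro z
    rw [side_eq, tri_eq_dot, tri_eq_dot]
    rcases hcr with e | e
    · rw [e]
    · rw [e, ← abs_neg]; congr 1; simp [dot]; ring
  have hτ : quad K (c a).1 τ = 0 := by
    rcases h1 with e | e
    · rw [e]; exact hv
    · rw [e]; simp [quad] at hv ⊢; linarith
  have hne : tri (c a).1 w τ ≠ 0 := by
    rw [← abs_pos, ht]; exact abs_pos.2 h2.ne'
  rw [cot_angle (c a).2 hτ hw hw1 hne, ht, abs_of_pos h2]
  -- The opposite tangent changes the sign of numerator and denominator alike, so the ratio can be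
  -- taken with the velocity itself.
  rcases h1 with e | e
  · rw [e]
  · have e1 : metric K (-vel c a) w = -metric K (vel c a) w := by simp [metric]; ring
    have e2 : side q (-vel c a) = -side q (vel c a) := by
      rw [side_eq, side_eq]; simp [tri]; ring
    rw [e, e1, e2, neg_div_neg_eq]

/-- First variation and density in the frame of the chord: all cross products of its points are
multiples of the conormal N. -/
theorem rhoD_geo (h : Domain D c T) {q : UnitTangent K} {l a b : ℝ} (hl : 0 < sinK K l)
    (ha : c a = geo q 0) (hb : c b = geo q l) :
    rhoD c a b = -metric K (vel c a) q.1.2 ∧ rhoD c b a = metric K (vel c b) (geoVel q l) ∧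
    jac c a b * sinK K l = -(side q (vel c a) * side q (vel c b)) := by
  set N := cr q.1.1 q.1.2 with hN
  have e0 : (c a).1 = q.1.1 := by rw [ha, geo_zero]; rfl
  have e1 : cr (c a).1 (c b).1 = sinK K l • N := by
    rw [ha, hb, cr_geo_geo, sub_zero]
  have e2 : cr (c b).1 (c a).1 = -(sinK K l • N) := by
    rw [← e1]; ext i; fin_cases i <;> simp [cr] <;> ring
  have e3 : cr (c b).1 (geoVel q l) = N := by rw [hb]; exact cr_geo_vel q l
  have hq0 : quad K (c a).1 q.1.2 = 0 := by rw [e0]; exact q.2.2.1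
  have hg : gram K (c a).1 (c b).1 (c a).1 (c b).1 = sinK K l ^ 2 := by
    have := gram_self_eq_one q
    rw [gram] at this
    rw [gram, e1, dual_smul_smul, this]; ring
  have hσ : √(gram K (c a).1 (c b).1 (c a).1 (c b).1) = sinK K l := by
    rw [hg, Real.sqrt_sq hl.le]
  have hσ' : √(gram K (c b).1 (c a).1 (c b).1 (c a).1) = sinK K l := by
    rw [gram_swap, hσ]
  refine ⟨?_, ?_, ?_⟩
  · rw [rhoD, hσ, metric_eq_gram (c a).2 (h.quad_vel a) hq0, gram, gram, e1, e0, ← hN]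
    have := dual_smul_smul K 1 (sinK K l) (cr q.1.1 (vel c a)) N
    rw [one_smul, one_mul] at this
    rw [this]; field_simp
  · have hq1 : quad K (c b).1 (geoVel q l) = 0 := by rw [hb]; exact quad_geoVel q l
    rw [rhoD, hσ', metric_eq_gram (c b).2 (h.quad_vel b) hq1, gram, gram, e2, e3]
    have := dual_smul_smul K 1 (-sinK K l) (cr (c b).1 (vel c b)) N
    rw [one_smul, one_mul, neg_smul] at this
    rw [this]; field_simp
  · have t1 : tri (c a).1 (vel c a) (c b).1 = -(sinK K l * side q (vel c a)) := by
      have : tri (c a).1 (vel c a) (c b).1 = -dot (cr (c a).1 (c b).1) (vel c a) := by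
        rw [← tri_eq_dot]; simp [tri]; ring
      rw [this, e1, dot_smul, side_eq, tri_eq_dot]
    have t2 : tri (c a).1 (c b).1 (vel c b) = sinK K l * side q (vel c b) := by
      rw [tri_eq_dot, e1, dot_smul, side_eq, tri_eq_dot]
    rw [jac, hσ, t1, t2]
    field_simp

/-- Each cotangent is a ratio `metric / side`. By `rhoD_geo` the numerators are the derivatives of
the distance up to sign, with product `rhoD c a b * rhoD c b a`, and the product of the denominators
is minus the density times sin_K l. -/
theorem cot_mul_cot (h : Domain D c T) {q : UnitTangent K} {l a b : ℝ} (hl : 0 < sinK K l)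
    (ha : c a = geo q 0) (hb : c b = geo q l) (hne : tri (c a).1 (vel c a) (c b).1 ≠ 0) :
    jac c a b * (sinK K l * Real.cot (angle K (sideTangent c q q.pt) q.vec) *
      Real.cot (angle K (sideTangent c q (geo q l)) (-geoVel q l))) =
    -(rhoD c a b * rhoD c b a) := by
  obtain ⟨r1, r2, r3⟩ := h.rhoD_geo hl ha hb
  have e0 : q.pt = c a := by rw [ha, geo_zero]
  have hJ : jac c a b ≠ 0 := by
    have h1 : tri (c a).1 (c b).1 (vel c b) ≠ 0 := fun h0 => hne (h.tri_eq_zero_symm (by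
      rw [← h0]; simp [tri]; ring))
    have h2 : 0 < gram K (c a).1 (c b).1 (c a).1 (c b).1 := by
      refine XK.gram_pos (c a).2 fun h0 => h1 ?_
      rw [tri_eq_dot, h0]; simp [dot]
    exact div_ne_zero (mul_ne_zero hne h1) (pow_ne_zero _ (Real.sqrt_pos.2 h2).ne')
  have hss : side q (vel c a) * side q (vel c b) ≠ 0 := fun h0 => by
    rw [h0, neg_zero] at r3
    exact mul_ne_zero hJ hl.ne' r3
  have hc1 := h.cot_sideTangent (q := q) (a := a) (w := q.vec) (by rw [← e0]; exact q.2.2.1)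
    q.2.2.2 (Or.inl (by rw [← e0]; rfl)) (left_ne_zero_of_mul hss)
  have hc2 := h.cot_sideTangent (q := q) (a := b) (w := -geoVel q l)
    (by have := quad_geoVel q l
        rw [hb]; simp [quad] at this ⊢; linarith)
    (by rw [← metric_geoVel q l]; simp [metric])
    (Or.inr (by rw [hb, ← cr_geo_vel q l]; ext i; fin_cases i <;> simp [cr] <;> ring))
    (right_ne_zero_of_mul hss)
  rw [e0, ← hb, hc1, hc2, r1, r2]
  have e1 : metric K (vel c b) (-geoVel q l) = -metric K (vel c b) (geoVel q l) := by
    simp [metric]; ring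
  rw [e1]
  have hA := left_ne_zero_of_mul hss
  have hB := right_ne_zero_of_mul hss
  have : jac c a b * (sinK K l * (metric K (vel c a) q.vec / side q (vel c a)) *
      (-metric K (vel c b) (geoVel q l) / side q (vel c b))) =
      (jac c a b * sinK K l) * ((metric K (vel c a) q.vec / side q (vel c a)) *
      (-metric K (vel c b) (geoVel q l) / side q (vel c b))) := by ring
  rw [this, r3]
  show _ = -(-metric K (vel c a) q.vec * _)
  field_simp

/-- The orientation of `chord` is a choice, so `c u.1` may be its initial or its final point; all
quantities compared are symmetric in the two ends. -/
theorem pairs_spec (h : Domain D c T) {u : ℝ × ℝ} (hu : u ∈ pairs c T) :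
    chordLength D (lineOf c u) = rho c u.1 u.2 ∧ ∀ f : ℝ → ℝ,
    jac c u.1 u.2 * pleijelIntegrand D c f (lineOf c u) =
      -(deriv f (rho c u.1 u.2) * (rhoD c u.1 u.2 * rhoD c u.2 u.1)) := by
  have hch := chord_spec h.compact h.convex (h.lineOf_mem_hitting hu)
  have m1 := (h.mem_lineOf hu).1
  have m2 := (h.mem_lineOf hu).2
  have I1 : u.1 ∈ Ico 0 T := ⟨hu.1, hu.2.1.trans hu.2.2.1⟩
  have I2 : u.2 ∈ Ico 0 T := ⟨hu.1.trans hu.2.1.le, hu.2.2.1⟩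
  have hne := h.c_ne I1 I2 hu.2.1.ne
  have key : ∃ a b, (a = u.1 ∧ b = u.2 ∨ a = u.2 ∧ b = u.1) ∧
      c a = geo (chord D (lineOf c u)).1 0 ∧ c b = geo (chord D (lineOf c u)).1
        (chord D (lineOf c u)).2 := by
    rcases h.eq_end_of_mem hu.2.2.2 hch m1 m2 m1 with e1 | e1 <;>
      rcases h.eq_end_of_mem hu.2.2.2 hch m1 m2 m2 with e2 | e2
    · exact absurd (e1.trans e2.symm) hne
    · exact ⟨u.1, u.2, Or.inl ⟨rfl, rfl⟩, e1, e2⟩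
    · exact ⟨u.2, u.1, Or.inr ⟨rfl, rfl⟩, e2, e1⟩
    · exact absurd (e1.trans e2.symm) hne
  obtain ⟨a, b, hab, ea, eb⟩ := key
  have hl0 : 0 < (chord D (lineOf c u)).2 := by
    refine lt_of_le_of_ne hch.2.1 fun h0 => ?_
    rw [← h0] at eb
    rcases hab with ⟨rfl, rfl⟩ | ⟨rfl, rfl⟩
    · exact hne (ea.trans eb.symm)
    · exact hne (eb.trans ea.symm)
  have hl : 0 < sinK K (chord D (lineOf c u)).2 :=
    sinK_pos hl0 fun hK => hch.lt_pi h.convex hK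
  have hρ : rho c a b = chordLength D (lineOf c u) := by
    rw [rho, ea, eb, dst_geo_geo _ hl0.le fun hK => by
      have := hch.lt_pi h.convex hK
      linarith]
    simp [chordLength]
  have hneab : tri (c a).1 (vel c a) (c b).1 ≠ 0 := by
    rcases hab with ⟨rfl, rfl⟩ | ⟨rfl, rfl⟩
    · exact hu.2.2.2
    · exact fun h0 => hu.2.2.2 (h.tri_eq_zero_symm h0)
  have hmain := h.cot_mul_cot hl ea eb hneab
  have hρ' : chordLength D (lineOf c u) = rho c u.1 u.2 := by
    rw [← hρ]
    rcases hab with ⟨rfl, rfl⟩ | ⟨rfl, rfl⟩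
    · rfl
    · exact rho_comm _ _ _
  have hJ : jac c u.1 u.2 = jac c a b := by
    rcases hab with ⟨rfl, rfl⟩ | ⟨rfl, rfl⟩
    · rfl
    · exact jac_comm _ _ _
  have hR : rhoD c u.1 u.2 * rhoD c u.2 u.1 = rhoD c a b * rhoD c b a := by
    rcases hab with ⟨rfl, rfl⟩ | ⟨rfl, rfl⟩
    · rfl
    · exact mul_comm _ _
  refine ⟨hρ', fun f => ?_⟩
  rw [hR, ← mul_neg, ← hmain, hJ, ← hρ', pleijelIntegrand, alphaOne, alphaTwo]
  simp only [chordLength]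
  ring

/-- The two integrals of the chord formula in terms of boundary parameters. -/
theorem integral_formula (h : Domain D c T) {f : ℝ → ℝ} (hf : ContDiff ℝ 1 f) :
    IntegrableOn (fun g => f (chordLength D g)) (hitting D) (liouville K) ∧
    IntegrableOn (pleijelIntegrand D c f) (hitting D) (liouville K) ∧
    ∫ g in hitting D, f (chordLength D g) ∂(liouville K) =
      ∫ g in hitting D, pleijelIntegrand D c f g ∂(liouville K) + f 0 * curveLength c T -
      ∫ u in upper T \ pairs c T, deriv f (rho c u.1 u.2) * (rhoD c u.1 u.2 * rhoD c u.2 u.1) := by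
  have hVm := h.measurableSet_pairs
  have hsub := (pairs_subset_upper c T).trans (upper_subset T)
  have i1 := (h.integrableOn_mul_jac hf.continuous).mono_set hsub
  have i2 := h.integrableOn_rhoD_mul (hf.continuous_deriv le_rfl)
  have e1 : ∀ u ∈ pairs c T, jac c u.1 u.2 * f (chordLength D (lineOf c u)) =
      f (rho c u.1 u.2) * jac c u.1 u.2 := fun u hu => by
    rw [(h.pairs_spec hu).1, mul_comm]
  have e2 : ∀ u ∈ pairs c T, jac c u.1 u.2 * pleijelIntegrand D c f (lineOf c u) =
      -(deriv f (rho c u.1 u.2) * (rhoD c u.1 u.2 * rhoD c u.2 u.1)) := fun u hu =>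
    (h.pairs_spec hu).2 f
  have F1 := h.integral_hitting fun g => f (chordLength D g)
  have F2 := h.integral_hitting (pleijelIntegrand D c f)
  refine ⟨F1.1.2 ((integrableOn_congr_fun e1 hVm).2 i1),
    F2.1.2 ((integrableOn_congr_fun e2 hVm).2 (i2.mono_set hsub).neg), ?_⟩
  rw [F1.2, F2.2, setIntegral_congr_fun hVm e1, setIntegral_congr_fun hVm e2, integral_neg,
    h.integral_pairs hf]
  have := setIntegral_sdiff hVm (i2.mono_set (upper_subset T)) (pairs_subset_upper c T)
  linarith

end Domain

/-! ### Geodesic segments in the boundary -/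

/-- Splitting the inner integral at b = a yields (f(a) − f(0)) + (f(l − a) − f(0)), and both terms
have the same integral over [0,l]. -/
theorem integral_deriv_abs_sub {f : ℝ → ℝ} (hf : ContDiff ℝ 1 f) {l : ℝ} (hl : 0 ≤ l) :
    ∫ a in Ioc 0 l, ∫ b in Ioc 0 l, deriv f |a - b| = 2 * ∫ x in (0 : ℝ)..l, (f x - f 0) := by
  have hf' := hf.continuous_deriv le_rfl
  have hfc := hf.continuous
  have hd := fun x => (hf.differentiable one_ne_zero x).hasDerivAt
  have e1 : ∀ a ∈ Ioc 0 l, ∫ b in Ioc 0 l, deriv f |a - b| = (f a - f 0) + (f (l - a) - f 0) := by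
    intro a ha
    have hc : Continuous fun b => deriv f |a - b| := by fun_prop
    rw [← intervalIntegral.integral_of_le hl,
      ← intervalIntegral.integral_add_adjacent_intervals (b := a) (hc.intervalIntegrable _ _)
        (hc.intervalIntegrable _ _)]
    congr 1
    · have : ∫ b in (0 : ℝ)..a, deriv f |a - b| = ∫ b in (0 : ℝ)..a, deriv f (a - b) := by
        refine intervalIntegral.integral_congr fun b hb => ?_
        rw [uIcc_of_le ha.1.le] at hb
        simp only [abs_of_nonneg (sub_nonneg.2 hb.2)]
      rw [this, intervalIntegral.integral_comp_sub_left (fun x => deriv f x) a, sub_self, sub_zero]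
      exact intervalIntegral.integral_eq_sub_of_hasDerivAt (fun x _ => hd x)
        (hf'.intervalIntegrable _ _)
    · have : ∫ b in a..l, deriv f |a - b| = ∫ b in a..l, deriv f (b - a) := by
        refine intervalIntegral.integral_congr fun b hb => ?_
        rw [uIcc_of_le ha.2] at hb
        simp only [abs_sub_comm a b, abs_of_nonneg (sub_nonneg.2 hb.1)]
      rw [this, intervalIntegral.integral_comp_sub_right (fun x => deriv f x) a, sub_self]
      exact intervalIntegral.integral_eq_sub_of_hasDerivAt (fun x _ => hd x)
        (hf'.intervalIntegrable _ _)
  rw [setIntegral_congr_fun measurableSet_Ioc e1, ← intervalIntegral.integral_of_le hl]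
  have hc : Continuous fun x => f x - f 0 := by fun_prop
  have hc' : Continuous fun x => f (l - x) - f 0 := by fun_prop
  rw [intervalIntegral.integral_add (hc.intervalIntegrable _ _) (hc'.intervalIntegrable _ _),
    intervalIntegral.integral_comp_sub_left (fun x => f x - f 0) l, sub_self, sub_zero]
  ring

/-- The parameters of the boundary points on a geodesic. -/
def touching {K : ℝ} (c : ℝ → Space K) (T : ℝ) (g : Geodesic K) : Set ℝ :=
  {s | s ∈ Ico 0 T ∧ c s ∈ g.1}

/-- The ordered pairs of parameters of boundary points on a geodesic. -/
def touchingPairs {K : ℝ} (c : ℝ → Space K) (T : ℝ) (g : Geodesic K) : Set (ℝ × ℝ) :=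
  touching c T g ×ˢ touching c T g ∩ {u | u.1 < u.2}

/-- The speed of the boundary along a geodesic. -/
def speed {K : ℝ} (c : ℝ → Space K) (q : UnitTangent K) (s : ℝ) : ℝ :=
  dual K (cr (c s).1 (vel c s)) (cr q.1.1 q.1.2)

/-- The position of a boundary point on a geodesic. -/
def position {K : ℝ} (c : ℝ → Space K) (q : UnitTangent K) (s : ℝ) : ℝ :=
  dst K (geo q 0).1 (c s).1

namespace Domain

variable {K : ℝ} {D : Set (Space K)} {c : ℝ → Space K} {T : ℝ}

theorem continuous_position (h : Domain D c T) (q : UnitTangent K) : Continuous (position c q) := by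
  have h1 : Continuous fun s => quad K (geo q 0).1 (c s).1 :=
    Continuous.quad continuous_const h.continuous_coe
  have h2 : Continuous fun s => √(gram K (geo q 0).1 (c s).1 (geo q 0).1 (c s).1) :=
    (Continuous.gram continuous_const h.continuous_coe continuous_const h.continuous_coe).sqrt
  have h3 := (continuous_arcK K).comp (h1.prodMk h2)
  unfold position dst
  exact h3

theorem continuous_speed (h : Domain D c T) (q : UnitTangent K) : Continuous (speed c q) :=
  (h.continuous_coe.cr h.continuous_vel).dual continuous_const

theorem measurableSet_touching (h : Domain D c T) (g : Geodesic K) :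
    MeasurableSet (touching c T g) := by
  obtain ⟨-, q, rfl⟩ := g
  have hc : Continuous fun s => dot (cr q.1.1 q.1.2) (c s).1 :=
    Continuous.dot continuous_const h.continuous_coe
  have : touching c T (toGeodesic q) = Ico 0 T ∩ {s | dot (cr q.1.1 q.1.2) (c s).1 = 0} := by
    ext s
    exact and_congr_right fun _ => geodesic_normal q (c s)
  exact this ▸ measurableSet_Ico.inter (measurableSet_eq_fun hc.measurable measurable_const)

section segment

variable {g : Geodesic K} {q : UnitTangent K} {l : ℝ}

theorem position_spec (h : Domain D c T) (hch : IsChord D g (q, l)) {s : ℝ}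
    (hs : s ∈ touching c T g) : position c q s ∈ Icc 0 l ∧ geo q (position c q s) = c s := by
  have : c s ∈ g.1 ∩ D := ⟨hs.2, h.mem s⟩
  rw [hch.2.2] at this
  obtain ⟨m, hm, e⟩ := this
  have e2 : position c q s = m := by
    rw [position, ← e, dst_geo_geo q hm.1 fun hK => by
      have := hch.lt_pi h.convex hK
      linarith [hm.2]]
    ring
  rw [e2]
  exact ⟨hm, e⟩

theorem rho_touching (h : Domain D c T) (hch : IsChord D g (q, l)) {s t : ℝ}
    (hs : s ∈ touching c T g) (ht : t ∈ touching c T g) :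
    rho c s t = |position c q s - position c q t| := by
  obtain ⟨h1, e1⟩ := h.position_spec hch hs
  obtain ⟨h2, e2⟩ := h.position_spec hch ht
  have hpi := hch.lt_pi h.convex
  rcases le_total (position c q s) (position c q t) with hle | hle
  · rw [rho, ← e1, ← e2, dst_geo_geo q hle fun hK => by
      have := hpi hK; linarith [h1.1, h2.2], abs_sub_comm, abs_of_nonneg (by linarith)]
  · rw [rho_comm, rho, ← e1, ← e2, dst_geo_geo q hle fun hK => by
      have := hpi hK; linarith [h2.1, h1.2], abs_of_nonneg (by linarith)]

/-- On a common geodesic the distance is the difference of the positions, so its two partial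
derivatives are the speeds with opposite signs. -/
theorem rhoD_mul_touching (h : Domain D c T) (hch : IsChord D g (q, l)) {s t : ℝ}
    (hs : s ∈ touching c T g) (ht : t ∈ touching c T g) (hst : s ≠ t) :
    rhoD c s t * rhoD c t s = -(speed c q s * speed c q t) := by
  obtain ⟨h1, e1⟩ := h.position_spec hch hs
  obtain ⟨h2, e2⟩ := h.position_spec hch ht
  have hg := h.gram_pos hs.1 ht.1 hst
  set δ := position c q t - position c q s
  have c1 : cr (c s).1 (c t).1 = sinK K δ • cr q.1.1 q.1.2 := by rw [← e1, ← e2, cr_geo_geo]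
  have c2 : cr (c t).1 (c s).1 = (-sinK K δ) • cr q.1.1 q.1.2 := by
    rw [neg_smul, ← c1]; ext i; fin_cases i <;> simp [cr] <;> ring
  have d1 : ∀ (m : Fin 3 → ℝ) (r : ℝ), dual K m (r • cr q.1.1 q.1.2) =
      r * dual K m (cr q.1.1 q.1.2) := fun m r => by
    have := dual_smul_smul K 1 r m (cr q.1.1 q.1.2)
    rwa [one_smul, one_mul] at this
  have hN := gram_self_eq_one q
  rw [gram] at hN
  have hg2 : gram K (c s).1 (c t).1 (c s).1 (c t).1 = sinK K δ ^ 2 := by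
    rw [gram, c1, dual_smul_smul, hN]; ring
  have hne : sinK K δ ^ 2 ≠ 0 := by rw [← hg2]; exact hg.ne'
  rw [rhoD, rhoD, gram_swap K (c t).1 (c s).1, div_mul_div_comm, Real.mul_self_sqrt hg.le, hg2,
    gram, gram, c1, c2, d1, d1]
  show -(sinK K δ * speed c q s) * -(-sinK K δ * speed c q t) / _ = _
  rw [div_eq_iff hne]; ring

/-- On a boundary segment the conormal of the boundary is `speed` times that of the geodesic, and it
has the sign ε on the interior of D at each of the points. The boundary therefore runs through the
segment in one direction. -/
theorem speed_mul_pos (h : Domain D c T) (hch : IsChord D g (q, l)) (hg : g ∈ supporting D)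
    {s t : ℝ} (hs : s ∈ touching c T g) (ht : t ∈ touching c T g) (hst : s ≠ t) :
    0 < speed c q s * speed c q t := by
  obtain ⟨ε, hε, ho⟩ := h.exists_orientation
  obtain ⟨z, hz⟩ := h.int_nonempty
  have hN := gram_self_eq_one q
  rw [gram] at hN
  have key : ∀ {s t : ℝ}, s ∈ touching c T g → t ∈ touching c T g → s ≠ t →
      0 < ε * (speed c q s * dot (cr q.1.1 q.1.2) z.1) := by
    intro s t hs ht hst
    have h0 := h.tri_eq_zero_of_supporting hg (h.c_ne hs.1 ht.1 hst) hs.2 ht.2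
    have hcr := h.cr_ne hs.1 ht.1 hst
    obtain ⟨κ, hκ⟩ := eq_smul_cr hcr (n := cr (c s).1 (vel c s)) (dot_cr_left _ _)
      (by rw [← tri_eq_dot]; exact h0)
    obtain ⟨h1, e1⟩ := h.position_spec hch hs
    obtain ⟨h2, e2⟩ := h.position_spec hch ht
    have c1 : cr (c s).1 (c t).1 = sinK K (position c q t - position c q s) • cr q.1.1 q.1.2 := by
      rw [← e1, ← e2, cr_geo_geo]
    rw [c1, smul_smul] at hκ
    have hsp : speed c q s = κ * sinK K (position c q t - position c q s) := by
      have := dual_smul_smul K (κ * sinK K (position c q t - position c q s)) 1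
        (cr q.1.1 q.1.2) (cr q.1.1 q.1.2)
      rw [one_smul, hN] at this
      rw [speed, hκ, this]; ring
    have := (ho s).2 z hz
    rwa [tri_eq_dot, hκ, dot_smul, ← hsp] at this
  have k1 := key hs ht hst
  have k2 := key ht hs hst.symm
  have hε2 : ε * ε = 1 := by rcases hε with rfl | rfl <;> norm_num
  have k3 := mul_pos k1 k2
  have : ε * (speed c q s * dot (cr q.1.1 q.1.2) z.1) * (ε * (speed c q t *
      dot (cr q.1.1 q.1.2) z.1)) = (speed c q s * speed c q t) *
      (dot (cr q.1.1 q.1.2) z.1) ^ 2 := by linear_combination (speed c q s * speed c q t *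
      (dot (cr q.1.1 q.1.2) z.1) ^ 2) * hε2
  rw [this] at k3
  by_contra hc
  exact absurd k3 (not_lt.2 (mul_nonpos_of_nonpos_of_nonneg (not_lt.1 hc) (sq_nonneg _)))

theorem hasDerivAt_position (h : Domain D c T) (hch : IsChord D g (q, l)) {s : ℝ}
    (hs : s ∈ touching c T g) (h0 : 0 < position c q s) :
    HasDerivAt (position c q) (speed c q s) s := by
  obtain ⟨h1, e1⟩ := h.position_spec hch hs
  have hl := sinK_pos h0 fun hK => (h1.2.trans_lt (hch.lt_pi h.convex hK))
  have hN := gram_self_eq_one q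
  rw [gram] at hN
  have c1 : cr (geo q 0).1 (c s).1 = sinK K (position c q s) • cr q.1.1 q.1.2 := by
    conv_lhs => rw [← e1, cr_geo_geo, sub_zero]
  have c2 : cr (c s).1 (geo q 0).1 = (-sinK K (position c q s)) • cr q.1.1 q.1.2 := by
    rw [neg_smul, ← c1]; ext i; fin_cases i <;> simp [cr] <;> ring
  have hg : gram K (geo q 0).1 (c s).1 (geo q 0).1 (c s).1 = sinK K (position c q s) ^ 2 := by
    rw [gram, c1, dual_smul_smul, hN]; ring
  refine (h.hasDerivAt_dst (x := geo q 0) (by rw [hg]; positivity)).congr_deriv ?_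
  have := dual_smul_smul K 1 (-sinK K (position c q s)) (cr (c s).1 (vel c s)) (cr q.1.1 q.1.2)
  rw [one_smul, one_mul] at this
  rw [hg, Real.sqrt_sq hl.le, gram, c2, this, speed]
  field_simp

/-- At position 0 the distance from the initial point may fail to be differentiable; by simplicity
of the curve this concerns at most one parameter. -/
theorem touching_ae_eq (h : Domain D c T) (hch : IsChord D g (q, l)) :
    volume.restrict (touching c T g) =
      volume.restrict (touching c T g ∩ {s | 0 < position c q s}) := by
  refine Measure.restrict_congr_set ?_
  have hsub : (touching c T g ∩ {s | ¬ 0 < position c q s}).Subsingleton := by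
    rintro s ⟨hs, hs0⟩ t ⟨ht, ht0⟩
    obtain ⟨h1, e1⟩ := h.position_spec hch hs
    obtain ⟨h2, e2⟩ := h.position_spec hch ht
    have z1 : position c q s = 0 := le_antisymm (not_lt.1 hs0) h1.1
    have z2 : position c q t = 0 := le_antisymm (not_lt.1 ht0) h2.1
    exact h.bd.injOn hs.1 ht.1 (by rw [← e1, ← e2, z1, z2])
  have h0 := hsub.measure_zero volume
  filter_upwards [measure_eq_zero_iff_ae_notMem.1 h0] with s hs
  refine propext ⟨fun h1 => ⟨h1, ?_⟩, fun h1 => h1.1⟩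
  by_contra h2
  exact hs ⟨h1, h2⟩

/-- Substitution of arc length along the geodesic. Surjectivity onto the chord holds because all
points of the chord of a supporting geodesic are boundary points. -/
theorem integral_touching (h : Domain D c T) (hch : IsChord D g (q, l)) (hg : g ∈ supporting D)
    (F : ℝ → ℝ) :
    ∫ s in touching c T g, |speed c q s| * F (position c q s) = ∫ a in Ioc 0 l, F a := by
  set P := touching c T g ∩ {s | 0 < position c q s} with hP
  have hPm : MeasurableSet P := (h.measurableSet_touching g).inter
    (measurableSet_lt measurable_const (h.continuous_position q).measurable)
  have himg : position c q '' P = Ioc 0 l := by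
    ext a
    constructor
    · rintro ⟨s, hs, rfl⟩
      exact ⟨hs.2, (h.position_spec hch hs.1).1.2⟩
    · intro ha
      have hm : geo q a ∈ g.1 ∩ D := by rw [hch.2.2]; exact ⟨a, ⟨ha.1.le, ha.2⟩, rfl⟩
      obtain ⟨s, hs, e⟩ := h.exists_param (hg.2 hm)
      have hst : s ∈ touching c T g := ⟨hs, by rw [e]; exact hm.1⟩
      have e2 : position c q s = a := by
        rw [position, e, dst_geo_geo q ha.1.le fun hK => by
          have := hch.lt_pi h.convex hK
          linarith [ha.2], sub_zero]
      exact ⟨s, ⟨hst, by rw [Set.mem_ofPred_eq, e2]; exact ha.1⟩, e2⟩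
  have hinj : InjOn (position c q) P := by
    intro s hs t ht e
    refine h.bd.injOn hs.1.1 ht.1.1 ?_
    rw [← (h.position_spec hch hs.1).2, ← (h.position_spec hch ht.1).2, e]
  have := integral_image_eq_integral_abs_deriv_smul hPm
    (fun s hs => (h.hasDerivAt_position hch hs.1 hs.2).hasDerivWithinAt) hinj F
  rw [himg] at this
  rw [this, h.touching_ae_eq hch]
  rfl

/-- Positions substituted in both variables turn the integrand into −f'(|a − b|), and the ordered
pairs make up half of the square. -/
theorem integral_touchingPairs (h : Domain D c T) (hch : IsChord D g (q, l))
    (hg : g ∈ supporting D) {f : ℝ → ℝ} (hf : ContDiff ℝ 1 f) :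
    ∫ u in touchingPairs c T g, deriv f (rho c u.1 u.2) * (rhoD c u.1 u.2 * rhoD c u.2 u.1) =
      -∫ x in (0 : ℝ)..l, (f x - f 0) := by
  have hPm := h.measurableSet_touching g
  have hf' := hf.continuous_deriv le_rfl
  have hp := h.continuous_position q
  have hs := h.continuous_speed q
  set F : ℝ × ℝ → ℝ := fun u => |speed c q u.1| * (|speed c q u.2| *
    deriv f |position c q u.1 - position c q u.2|) with hF
  have hFc : Continuous F := by
    have a1 := hp.comp (continuous_fst (X := ℝ) (Y := ℝ))
    have a2 := hp.comp (continuous_snd (X := ℝ) (Y := ℝ))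
    have b1 := hs.comp (continuous_fst (X := ℝ) (Y := ℝ))
    have b2 := hs.comp (continuous_snd (X := ℝ) (Y := ℝ))
    exact b1.abs.mul (b2.abs.mul (hf'.comp (a1.sub a2).abs))
  have hi : IntegrableOn F (touching c T g ×ˢ touching c T g) :=
    (hFc.continuousOn.integrableOn_compact (isCompact_Icc.prod isCompact_Icc)).mono_set
      (prod_mono (fun s hs => Ico_subset_Icc_self hs.1) (fun s hs => Ico_subset_Icc_self hs.1))
  have e1 : ∫ u in touchingPairs c T g, deriv f (rho c u.1 u.2) *
      (rhoD c u.1 u.2 * rhoD c u.2 u.1) = -∫ u in touchingPairs c T g, F u := by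
    rw [← integral_neg]
    refine setIntegral_congr_fun ((hPm.prod hPm).inter
      (measurableSet_lt measurable_fst measurable_snd)) fun u hu => ?_
    have hlt : u.1 < u.2 := hu.2
    simp only [hF]
    rw [h.rho_touching hch hu.1.1 hu.1.2, h.rhoD_mul_touching hch hu.1.1 hu.1.2 hlt.ne,
      ← abs_of_pos (h.speed_mul_pos hch hg hu.1.1 hu.1.2 hlt.ne), abs_mul]
    ring
  have e2 := integral_eq_two_mul_of_swap (S := touching c T g ×ˢ touching c T g)
    (fun u hu => ⟨hu.2, hu.1⟩) (F := F) (fun u => by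
      simp only [hF, Prod.fst_swap, Prod.snd_swap, abs_sub_comm (position c q u.2)]; ring) hi
  have e3 : ∫ u in touching c T g ×ˢ touching c T g, F u = 2 * ∫ x in (0 : ℝ)..l, (f x - f 0) := by
    rw [IntegrableOn, Measure.volume_eq_prod, ← Measure.prod_restrict] at hi
    rw [← integral_deriv_abs_sub hf hch.2.1, Measure.volume_eq_prod, ← Measure.prod_restrict,
      integral_prod _ hi]
    simp only [hF]
    have : ∀ s, ∫ t in touching c T g, |speed c q s| * (|speed c q t| *
        deriv f |position c q s - position c q t|) =
        |speed c q s| * ∫ b in Ioc 0 l, deriv f |position c q s - b| := by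
      intro s
      rw [integral_const_mul, h.integral_touching hch hg fun b => deriv f |position c q s - b|]
    simp only [this]
    exact h.integral_touching hch hg fun a => ∫ b in Ioc 0 l, deriv f |a - b|
  rw [e1]
  rw [touchingPairs]
  linarith

end segment

/-! ### The non-transversal pairs, sorted by boundary segments -/

theorem sdiff_pairs_eq (h : Domain D c T) : upper T \ pairs c T =
    ⋃ g : {g : supporting D | 0 < chordLength D g.1}, touchingPairs c T g.1.1 := by
  ext u
  constructor
  · intro hu
    have h0 : tri (c u.1).1 (vel c u.1) (c u.2).1 = 0 := by
      by_contra h0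
      exact hu.2 ⟨hu.1.1.1.1, hu.1.2, hu.1.1.2.2, h0⟩
    have hlt : u.1 < u.2 := hu.1.2
    have hg := h.gram_pos hu.1.1.1 hu.1.1.2 hlt.ne
    have m1 : c u.1 ∈ (lineOf c u).1 := (mem_toGeodesic_dirTo hg _).2 (dot_cr_left _ _)
    have m2 : c u.2 ∈ (lineOf c u).1 := (mem_toGeodesic_dirTo hg _).2 (dot_cr_right _ _)
    have hsup := h.supporting_of_tri_eq_zero (h.cr_ne hu.1.1.1 hu.1.1.2 hlt.ne) m1 m2 h0
    have hch := chord_spec h.compact h.convex hsup.1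
    have hl : 0 < chordLength D (lineOf c u) := by
      refine lt_of_le_of_ne hch.2.1 fun hl0 => h.c_ne hu.1.1.1 hu.1.1.2 hlt.ne ?_
      obtain ⟨p1, q1⟩ := h.position_spec hch ⟨hu.1.1.1, m1⟩
      obtain ⟨p2, q2⟩ := h.position_spec hch ⟨hu.1.1.2, m2⟩
      have z1 := le_antisymm (p1.2.trans_eq hl0.symm) p1.1
      have z2 := le_antisymm (p2.2.trans_eq hl0.symm) p2.1
      rw [← q1, ← q2, z1, z2]
    exact mem_iUnion.2 ⟨⟨⟨lineOf c u, hsup⟩, hl⟩, ⟨⟨hu.1.1.1, m1⟩, ⟨hu.1.1.2, m2⟩⟩, hlt⟩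
  · intro hu
    obtain ⟨g, ⟨⟨h1, h2⟩, hlt⟩⟩ := mem_iUnion.1 hu
    have hlt' : u.1 < u.2 := hlt
    refine ⟨⟨⟨h1.1, h2.1⟩, hlt⟩, fun hp => hp.2.2.2 ?_⟩
    exact h.tri_eq_zero_of_supporting g.1.2 (h.c_ne h1.1 h2.1 hlt'.ne) h1.2 h2.2

theorem disjoint_touchingPairs (h : Domain D c T) {g g' : Geodesic K} (hgg : g ≠ g') :
    Disjoint (touchingPairs c T g) (touchingPairs c T g') := by
  refine Set.disjoint_left.2 fun u hu hu' => hgg ?_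
  obtain ⟨-, q, rfl⟩ := g
  obtain ⟨-, q', rfl⟩ := g'
  have hlt : u.1 < u.2 := hu.2
  exact geodesic_unique (h.cr_ne hu.1.1.1 hu.1.2.1 hlt.ne) hu.1.1.2 hu.1.2.2 hu'.1.1.2 hu'.1.2.2

theorem measurableSet_touchingPairs (h : Domain D c T) (g : Geodesic K) :
    MeasurableSet (touchingPairs c T g) :=
  ((h.measurableSet_touching g).prod (h.measurableSet_touching g)).inter
    (measurableSet_lt measurable_fst measurable_snd)

/-- Disjoint measurable sets of positive measure are countable in number. That `touchingPairs` is
not null is seen from f(x) = x, for which the integral over it is −l²/2. -/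
theorem countable_segments (h : Domain D c T) :
    Countable {g : supporting D | 0 < chordLength D g.1} := by
  have h1 := Measure.countable_meas_pos_of_disjoint_iUnion (μ := (volume : Measure (ℝ × ℝ)))
    (As := fun g : {g : supporting D | 0 < chordLength D g.1} => touchingPairs c T g.1.1)
    (fun g => h.measurableSet_touchingPairs _)
    (fun g g' hgg => h.disjoint_touchingPairs fun e => hgg (Subtype.ext (Subtype.ext e)))
  have h2 : {g : {g : supporting D | 0 < chordLength D g.1} |
      0 < volume (touchingPairs c T g.1.1)} = univ := by
    refine eq_univ_of_forall fun g => ?_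
    rw [Set.mem_ofPred_eq, pos_iff_ne_zero]
    intro h0
    have hch := chord_spec h.compact h.convex g.1.2.1
    have := h.integral_touchingPairs (q := (chord D g.1.1).1) (l := (chord D g.1.1).2) hch g.1.2
      (f := fun x => x) contDiff_id
    rw [Measure.restrict_eq_zero.2 h0, integral_zero_measure] at this
    simp only [sub_zero, integral_id] at this
    have hl : 0 < (chord D g.1.1).2 := g.2
    nlinarith
  rw [h2] at h1
  exact countable_univ_iff.1 h1

theorem hasSum_segments (h : Domain D c T) {f : ℝ → ℝ} (hf : ContDiff ℝ 1 f) :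
    HasSum (fun g : supporting D => ∫ x in (0 : ℝ)..chordLength D g, (f x - f 0))
      (-∫ u in upper T \ pairs c T, deriv f (rho c u.1 u.2) *
        (rhoD c u.1 u.2 * rhoD c u.2 u.1)) := by
  have := h.countable_segments
  have hi := ((h.integrableOn_rhoD_mul (hf.continuous_deriv le_rfl)).mono_set
    (upper_subset T)).mono_set (sdiff_subset (s := upper T) (t := pairs c T))
  rw [h.sdiff_pairs_eq] at hi ⊢
  have hsum := (hasSum_integral_iUnion (fun g => h.measurableSet_touchingPairs _)
    (fun g g' hgg => h.disjoint_touchingPairs fun e => hgg (Subtype.ext (Subtype.ext e))) hi).neg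
  -- Supporting geodesics that touch D in one point may be uncountably many, but their terms are 0.
  refine (hasSum_subtype_iff_of_support_subset (s := {g : supporting D | 0 < chordLength D g.1})
    fun g hg => ?_).1 ?_
  · have hch := chord_spec h.compact h.convex g.2.1
    refine lt_of_le_of_ne hch.2.1 fun h0 => hg ?_
    have h0' : chordLength D g.1 = 0 := h0.symm
    simp only [h0', intervalIntegral.integral_same]
  · refine hsum.congr_fun ?_
    intro g
    have hch := chord_spec h.compact h.convex g.1.2.1
    rw [h.integral_touchingPairs (q := (chord D g.1.1).1) (l := (chord D g.1.1).2) hch g.1.2 hf,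
      neg_neg]
    rfl

theorem chordLength_eq_zero (h : Domain D c T) (hD : NoBoundarySegment D) (g : supporting D) :
    chordLength D g.1 = 0 := by
  have hch := chord_spec h.compact h.convex g.2.1
  by_contra h0
  obtain ⟨s, hs, hn⟩ := hD (chord D g.1).1 _ (lt_of_le_of_ne hch.2.1 (Ne.symm h0))
  exact hn (g.2.2 (by rw [hch.2.2]; exact ⟨s, hs, rfl⟩))

end Domain

/-! ### Radial integrals -/

theorem lintegral_Ioi_of_hasDerivAt {g g' : ℝ → ℝ} {a : ℝ} (hc : ContinuousWithinAt g (Ici 0) 0)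
    (hd : ∀ x ∈ Ioi (0 : ℝ), HasDerivAt g (g' x) x) (hp : ∀ x ∈ Ioi (0 : ℝ), 0 ≤ g' x)
    (hl : Filter.Tendsto g Filter.atTop (nhds a)) :
    ∫⁻ x in Ioi (0 : ℝ), ENNReal.ofReal (g' x) = ENNReal.ofReal (a - g 0) := by
  have hi := integrableOn_Ioi_deriv_of_nonneg hc hd hp hl
  rw [← integral_Ioi_of_hasDerivAt_of_tendsto hc hd hi hl,
    ofReal_integral_eq_lintegral_ofReal hi]
  exact (ae_restrict_iff' measurableSet_Ioi).2 (Filter.Eventually.of_forall hp)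

/-- The norm of `y + b x` for points with `quad y x = C`. -/
def rad (C b : ℝ) : ℝ := √(1 + 2 * C * b + b ^ 2)

theorem rad_arg_pos {C b : ℝ} (hC : -1 < C) (hb : 0 ≤ b) : 0 < 1 + 2 * C * b + b ^ 2 := by
  nlinarith [sq_nonneg (1 - b), mul_nonneg hb (show 0 ≤ C + 1 by linarith), sq_nonneg (1 + b)]

theorem rad_pos {C b : ℝ} (hC : -1 < C) (hb : 0 ≤ b) : 0 < rad C b :=
  Real.sqrt_pos.2 (rad_arg_pos hC hb)

theorem rad_sq {C b : ℝ} (hC : -1 < C) (hb : 0 ≤ b) : rad C b ^ 2 = 1 + 2 * C * b + b ^ 2 :=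
  Real.sq_sqrt (rad_arg_pos hC hb).le

theorem rad_zero (C : ℝ) : rad C 0 = 1 := by simp [rad]

theorem continuous_rad (C : ℝ) : Continuous (rad C) := by unfold rad; fun_prop

theorem hasDerivAt_rad {C b : ℝ} (hC : -1 < C) (hb : 0 ≤ b) :
    HasDerivAt (rad C) ((b + C) / rad C b) b := by
  have h1 : HasDerivAt (fun b : ℝ => 1 + 2 * C * b + b ^ 2) (2 * C + 2 * b) b := by
    have := (((hasDerivAt_id b).const_mul (2 * C)).const_add 1).add ((hasDerivAt_id b).pow 2)
    refine this.congr_deriv ?_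
    simp
  refine (h1.sqrt (rad_arg_pos hC hb).ne').congr_deriv ?_
  have := rad_pos hC hb
  rw [rad] at *
  field_simp
  ring

theorem tendsto_div_rad (C : ℝ) :
    Filter.Tendsto (fun b => b / rad C b) Filter.atTop (nhds 1) ∧
    Filter.Tendsto (fun b => 1 / rad C b) Filter.atTop (nhds 0) := by
  have h0 : Filter.Tendsto (fun b : ℝ => b⁻¹) Filter.atTop (nhds 0) := tendsto_inv_atTop_zero
  have hc : Continuous fun z : ℝ => √(z ^ 2 + 2 * C * z + 1) := by fun_prop
  have h1 := (hc.tendsto 0).comp h0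
  have h2 : Filter.Tendsto (fun b => b / rad C b) Filter.atTop (nhds 1) := by
    have h3 := h1.inv₀ (by simp)
    norm_num at h3
    refine h3.congr' ?_
    filter_upwards [Filter.eventually_gt_atTop 0] with b hb
    have : rad C b = b * √((b⁻¹) ^ 2 + 2 * C * b⁻¹ + 1) := by
      conv_rhs => rw [← Real.sqrt_sq hb.le]
      rw [← Real.sqrt_mul (sq_nonneg b), rad, Real.sqrt_sq hb.le]
      congr 1
      field_simp
    rw [this]
    simp only [inv_pow]
    rw [div_mul_eq_div_div, div_self hb.ne', one_div]
  refine ⟨h2, ?_⟩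
  have h4 := h2.mul h0
  rw [one_mul] at h4
  refine h4.congr' ?_
  filter_upwards [Filter.eventually_gt_atTop 0] with b hb
  field_simp

/-- Divided by `rad C b`, this is 1 + cos_K r > 0, where r is the distance from y to the projection
of y + b x. -/
theorem rad_add_pos {K C b σ : ℝ} (hC : -1 < C) (hb : 0 ≤ b) (h : C ^ 2 + K * σ ^ 2 = 1)
    (hK : K ≤ 0 → 0 < C) : 0 < rad C b + (1 + C * b) := by
  have hp := rad_pos hC hb
  have hs := rad_sq hC hb
  rcases le_or_gt K 0 with h1 | h1
  · have := mul_nonneg (hK h1).le hb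
    linarith
  · by_contra hcon
    push Not at hcon
    have h2 : rad C b ^ 2 ≤ (1 + C * b) ^ 2 := by nlinarith
    have h3 : 0 ≤ b ^ 2 * (K * σ ^ 2) := by positivity
    have h4 : b ^ 2 * (1 - C ^ 2) ≤ 0 := by nlinarith
    have h5 : b ^ 2 * (1 - C ^ 2) = b ^ 2 * (K * σ ^ 2) := by rw [← h]; ring
    have h6 : b ^ 2 * (1 - C ^ 2) = 0 := by linarith
    have h7 : rad C b ^ 2 = (1 + C * b) ^ 2 := by rw [hs]; linear_combination h6
    rcases mul_eq_zero.1 h6 with h8 | h8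
    · have : b = 0 := by simpa using h8
      subst this
      linarith
    · have : C = 1 := by nlinarith
      subst this
      linarith

/-- Along the ray cos_K r = (1 + C b)/N and sin_K r = b σ/N with N = `rad C b`. For σ ≠ 0 the
primitive is sin_K² r / (σ² (1 + cos_K r)), that is (1 − cos_K r)/(K σ²) in a form that survives K =
0. -/
theorem lintegral_area {K C σ : ℝ} (hC : -1 < C) (h : C ^ 2 + K * σ ^ 2 = 1) (hK : K ≤ 0 → 0 < C) :
    ∫⁻ b in Ioi (0 : ℝ), ENNReal.ofReal (b / rad C b ^ 3) = ENNReal.ofReal (1 / (1 + C)) := by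
  have hM := fun {b : ℝ} (hb : 0 ≤ b) => rad_add_pos hC hb h hK
  have hN := fun {b : ℝ} (hb : 0 ≤ b) => rad_pos hC hb
  have key := lintegral_Ioi_of_hasDerivAt (g := fun b => b ^ 2 / (rad C b * (rad C b + (1 + C * b))))
    (g' := fun b => b / rad C b ^ 3) (a := 1 / (1 + C)) ?_ ?_ ?_ ?_
  · simpa using key
  · have h1 : ContinuousAt (fun b => b ^ 2 / (rad C b * (rad C b + (1 + C * b)))) 0 := by
      have c1 := (continuous_rad C).continuousAt (x := 0)
      refine ContinuousAt.div (by fun_prop) (by fun_prop) ?_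
      exact (mul_pos (hN le_rfl) (hM le_rfl)).ne'
    exact h1.continuousWithinAt
  · intro b hb
    have hb' : 0 ≤ b := le_of_lt hb
    have d1 := hasDerivAt_rad hC hb'
    have d2 : HasDerivAt (fun b : ℝ => 1 + C * b) C b := by
      simpa using ((hasDerivAt_id b).const_mul C).const_add 1
    have d3 : HasDerivAt (fun b : ℝ => b ^ 2) (2 * b) b := by simpa using hasDerivAt_pow 2 b
    refine (d3.div (d1.mul (d1.add d2)) (mul_pos (hN hb') (hM hb')).ne').congr_deriv ?_
    have hs := rad_sq hC hb'
    have n1 := hN hb'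
    have n2 := hM hb'
    simp only [Pi.mul_apply, Pi.add_apply]
    set N := rad C b
    rw [div_eq_div_iff (by positivity) (by positivity)]
    field_simp
    linear_combination b * (2 * N + (1 + b * C)) * hs
  · intro b hb
    have hb' : 0 ≤ b := le_of_lt hb
    have := hN hb'
    positivity
  · obtain ⟨l1, l2⟩ := tendsto_div_rad C
    have l3 := (l1.pow 2).div ((l2.add (l1.const_mul C)).const_add 1)
      (by linarith : (1 : ℝ) + (0 + C * 1) ≠ 0)
    have : (1 : ℝ) ^ 2 / (1 + (0 + C * 1)) = 1 / (1 + C) := by ring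
    rw [this] at l3
    refine l3.congr' ?_
    filter_upwards [Filter.eventually_ge_atTop 0] with b hb
    have n1 := hN hb
    have n2 := hM hb
    simp only [Pi.div_apply]
    have : 1 + (1 / rad C b + C * (b / rad C b)) = (rad C b + (1 + C * b)) / rad C b := by
      field_simp
    rw [this]
    field_simp

/-- As dr = σ db / N², the integrand is (1 + cos_K r) dr / σ with primitive (r + sin_K r)/σ; b → ∞
corresponds to the far end of the chord. -/
theorem lintegral_chord {K C σ : ℝ} (hC : -1 < C) (h : C ^ 2 + K * σ ^ 2 = 1) (hK : K ≤ 0 → 0 < C)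
    (hσ : 0 < σ) :
    ∫⁻ b in Ioi (0 : ℝ), ENNReal.ofReal ((rad C b + (1 + C * b)) / rad C b ^ 3) =
      ENNReal.ofReal (arcK K C σ / σ + 1) := by
  have hN := fun {b : ℝ} (hb : 0 ≤ b) => rad_pos hC hb
  have key := lintegral_Ioi_of_hasDerivAt
    (g := fun b => arcK K ((1 + C * b) / rad C b) (b * σ / rad C b) / σ + b / rad C b)
    (g' := fun b => (rad C b + (1 + C * b)) / rad C b ^ 3) (a := arcK K C σ / σ + 1) ?_ ?_ ?_ ?_
  · have h0 : arcK K 1 0 = 0 := by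
      have := arcK_cosK_sinK (K := K) le_rfl fun h => by positivity
      simpa [cosK, sinK] using this
    simpa [rad_zero, h0] using key
  · have h1 : ContinuousAt (fun b => ((1 + C * b) / rad C b, b * σ / rad C b)) 0 := by
      have c1 := (continuous_rad C).continuousAt (x := 0)
      have n := (hN (le_refl 0)).ne'
      exact ContinuousAt.prodMk (ContinuousAt.div (by fun_prop) c1 n)
        (ContinuousAt.div (by fun_prop) c1 n)
    have h2 : ContinuousAt (fun b => b / rad C b) 0 :=
      ContinuousAt.div (by fun_prop) (continuous_rad C).continuousAt (hN (le_refl 0)).ne'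
    have h3 := ((continuous_arcK K).continuousAt.comp h1).div_const σ
    exact (h3.add h2).continuousWithinAt
  · intro b hb
    have hb0 : 0 < b := hb
    have hb' : 0 ≤ b := hb0.le
    have d1 := hasDerivAt_rad hC hb'
    have n1 := hN hb'
    have hs := rad_sq hC hb'
    have d2 : HasDerivAt (fun b : ℝ => 1 + C * b) C b := by
      simpa using ((hasDerivAt_id b).const_mul C).const_add 1
    have d3 : HasDerivAt (fun b : ℝ => b * σ) σ b := by
      simpa using (hasDerivAt_id b).mul_const σ
    have d4 := d2.div d1 n1.ne'
    have d5 := d3.div d1 n1.ne'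
    have d6 := (hasDerivAt_id b).div d1 n1.ne'
    have e1 : ((1 + C * b) / rad C b) ^ 2 + K * (b * σ / rad C b) ^ 2 = 1 := by
      rw [div_pow, div_pow, hs, mul_div_assoc', ← add_div,
        div_eq_one_iff_eq (by rw [← hs]; positivity)]
      linear_combination b ^ 2 * h
    have e2 : 0 < b * σ / rad C b := by positivity
    have e3 : K ≤ 0 → 0 < (1 + C * b) / rad C b := fun hK' => by
      have := hK hK'
      positivity
    have e4 : (1 + C * b) / rad C b * ((C * rad C b - (1 + C * b) * ((b + C) / rad C b)) /
        rad C b ^ 2) + K * (b * σ / rad C b * ((σ * rad C b - b * σ * ((b + C) / rad C b)) /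
        rad C b ^ 2)) = 0 := by
      set N := rad C b
      field_simp
      linear_combination (C * (1 + C * b) + K * σ ^ 2 * b) * hs + b * (1 + b * C) * h
    have d7 := hasDerivAt_arcK (K := K) d4 d5 e1 e2 e3 e4
    refine ((d7.div_const σ).add d6).congr_deriv ?_
    simp only [Pi.div_apply, id]
    set N := rad C b
    field_simp
    linear_combination N * hs
  · intro b hb
    have hb' : 0 ≤ b := le_of_lt hb
    have := hN hb'
    have := rad_add_pos hC hb' h hK
    positivity
  · obtain ⟨l1, l2⟩ := tendsto_div_rad C
    have l3 := ((l2.add (l1.const_mul C)).prodMk_nhds (l1.const_mul σ))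
    have l4 := (((continuous_arcK K).tendsto _).comp l3).div_const σ
    have l5 := l4.add l1
    simp only [zero_add, mul_one] at l5
    refine l5.congr fun b => ?_
    simp only [Function.comp_apply]
    congr 3 <;> ring

/-! ### The total angle of the boundary seen from an interior point -/

/-- A solid cone with axis `x`, without the axis. -/
def solid (K : ℝ) (x : Fin 3 → ℝ) : Set (Fin 3 → ℝ) :=
  {z | 0 < quad K x z ∧ quad K x z < 1 ∧ 0 < gram K x z x z ∧ gram K x z x z < quad K x z ^ 2}

theorem lintegral_sections {U : Set (ℝ × ℝ)} (hU : MeasurableSet U) {f : ℝ × ℝ → ENNReal}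
    (hf : Measurable f) :
    ∫⁻ u in U, f u = ∫⁻ t, ∫⁻ r in {r | (t, r) ∈ U}, f (t, r) := by
  rw [← lintegral_indicator hU, Measure.volume_eq_prod,
    lintegral_prod _ (hf.indicator hU).aemeasurable]
  refine lintegral_congr fun t => ?_
  have := lintegral_indicator (μ := (volume : Measure ℝ)) (measurable_prodMk_left (x := t) hU)
    fun r => f (t, r)
  exact this

theorem lintegral_linear {w a : ℝ} (hw : 0 ≤ w) (ha : 0 < a) :
    ∫⁻ r in {r : ℝ | 0 < r ∧ r * a < 1}, ENNReal.ofReal (w * r) =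
      ENNReal.ofReal (w / (2 * a ^ 2)) := by
  have hset : {r : ℝ | 0 < r ∧ r * a < 1} = Ioo 0 (1 / a) := by
    ext r; exact and_congr_right fun _ => (lt_div_iff₀ ha).symm
  have h0 : (0 : ℝ) ≤ 1 / a := by positivity
  have hi : IntegrableOn (fun r => w * r) (Ioo 0 (1 / a)) :=
    ((by fun_prop : Continuous fun r : ℝ => w * r).continuousOn.integrableOn_compact
      isCompact_Icc).mono_set Ioo_subset_Icc_self
  rw [hset, ← ofReal_integral_eq_lintegral_ofReal hi
    ((ae_restrict_iff' measurableSet_Ioo).2 (Filter.Eventually.of_forall fun r hr =>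
      mul_nonneg hw hr.1.le)), ← integral_Ioc_eq_integral_Ioo,
    ← intervalIntegral.integral_of_le h0, intervalIntegral.integral_const_mul, integral_id]
  congr 1
  field_simp
  ring

theorem quad_add_smul (K a : ℝ) (x y z : Fin 3 → ℝ) :
    quad K x (y + a • z) = quad K x y + a * quad K x z := by simp [quad]; ring

theorem gram_add_smul (K a : ℝ) (x v : Fin 3 → ℝ) :
    gram K x (x + a • v) x (x + a • v) = a ^ 2 * gram K x v x v := by
  simp [gram, dual, cr]; ring

theorem gram_smul (K a : ℝ) (x v : Fin 3 → ℝ) :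
    gram K x (a • v) x (a • v) = a ^ 2 * gram K x v x v := by
  simp [gram, dual, cr]; ring

/-- Volume of the solid cone. -/
theorem volume_solid {K : ℝ} (q : UnitTangent K) :
    volume (solid K q.1.1) = ENNReal.ofReal (Real.pi / 3) := by
  set x := q.1.1 with hx
  set e := q.1.2 with he
  set n := cr x e with hn
  -- `e'` completes `e` to an orthonormal frame of the tangent plane at x with `tri x e e' = 1`, so
  -- the volume is that of a Euclidean cone of height 1 and radius 1.
  set e' : Fin 3 → ℝ := ![K * n 0, n 1, n 2] with he'
  have hxx : quad K x x = 1 := q.2.1.1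
  have hxe : quad K x e = 0 := q.2.2.1
  have hdn : dual K n n = 1 := gram_self_eq_one q
  have hxe' : quad K x e' = 0 := by
    simp [quad, he', hn, cr]; ring
  have htri : tri x e e' = 1 := by
    rw [tri_eq_dot, ← hdn]; simp [dot, dual, he']; ring
  have g11 : gram K x e x e = 1 := hdn
  have g12 : gram K x e x e' = 0 := by
    simp [gram, dual, he', hn, cr]; ring
  have g22 : gram K x e' x e' = 1 := by
    have := gram_lagrange K x e e'
    rw [g12, htri, hxx, g11] at this
    linarith
  have hgab : ∀ a b : ℝ, gram K x (a • e + b • e') x (a • e + b • e') = a ^ 2 + b ^ 2 := by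
    intro a b
    have : gram K x (a • e + b • e') x (a • e + b • e') = a ^ 2 * gram K x e x e +
        2 * a * b * gram K x e x e' + b ^ 2 * gram K x e' x e' := by
      simp [gram, dual, cr]; ring
    rw [this, g11, g12, g22]; ring
  have hqab : ∀ a b : ℝ, quad K x (a • e + b • e') = 0 := by
    intro a b
    have : quad K x (a • e + b • e') = a * quad K x e + b * quad K x e' := by simp [quad]; ring
    rw [this, hxe, hxe']; ring
  have hdecomp : ∀ z, ∃ a b : ℝ, z = quad K x z • x + (a • e + b • e') := by
    intro z
    have e1 : z = tri z e e' • x + (tri x z e' • e + tri x e z • e') := by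
      have h1 : ∀ i, tri x e e' * z i = tri z e e' * x i + (tri x z e' * e i + tri x e z * e' i) := by
        intro i; fin_cases i <;> simp [tri] <;> ring
      ext i
      have := h1 i
      rw [htri, one_mul] at this
      simpa using this
    have e2 : quad K x z = tri z e e' := by
      conv_lhs => rw [e1]
      have := quad_comb K 1 0 (tri z e e') 1 x x x (tri x z e' • e + tri x e z • e')
      simp only [one_smul, zero_smul, add_zero] at this
      rw [this, hqab, hxx]; ring
    exact ⟨_, _, by rw [e2]; exact e1⟩
  set Ψ1 : ℝ × ℝ → Fin 3 → ℝ := fun u => Real.cos u.2 • e + Real.sin u.2 • e' with hΨ1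
  have hd : ∀ u : ℝ × ℝ, HasFDerivAt (fun u : ℝ × ℝ => x + u.1 • Ψ1 u)
      ((ContinuousLinearMap.fst ℝ ℝ ℝ).smulRight (Ψ1 u) + (ContinuousLinearMap.snd ℝ ℝ ℝ).smulRight
        (u.1 • (-Real.sin u.2 • e + Real.cos u.2 • e'))) u := by
    intro u
    refine hasFDerivAt_of_coord fun i => ?_
    have h1 : HasDerivAt (fun θ => Real.cos θ * e i + Real.sin θ * e' i)
        (-Real.sin u.2 * e i + Real.cos u.2 * e' i) u.2 :=
      ((Real.hasDerivAt_cos u.2).mul_const _).add ((Real.hasDerivAt_sin u.2).mul_const _)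
    have h2 := (hasFDerivAt_fst_mul_snd (hasDerivAt_id u.1) h1).const_add (x i)
    refine h2.congr_fderiv ?_
    ext <;> simp [hΨ1]
  have htri' : ∀ u : ℝ × ℝ, tri (x + u.1 • Ψ1 u) (Ψ1 u)
      (u.1 • (-Real.sin u.2 • e + Real.cos u.2 • e')) = u.1 := by
    intro u
    have : tri (x + u.1 • Ψ1 u) (Ψ1 u) (u.1 • (-Real.sin u.2 • e + Real.cos u.2 • e')) =
        u.1 * (Real.sin u.2 ^ 2 + Real.cos u.2 ^ 2) * tri x e e' := by
      simp only [tri, hΨ1, Pi.add_apply, Pi.smul_apply, smul_eq_mul]; ring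
    rw [this, Real.sin_sq_add_cos_sq, htri]; ring
  have hgu : ∀ u : ℝ × ℝ, gram K x (Ψ1 u) x (Ψ1 u) = 1 := by
    intro u; rw [hΨ1, hgab, Real.cos_sq_add_sin_sq]
  have key := volume_cone_image (U := Ioo (0 : ℝ) 1 ×ˢ Ico 0 (2 * Real.pi))
    (measurableSet_Ioo.prod measurableSet_Ico) (Ψ := fun u => x + u.1 • Ψ1 u) (Ψ1 := Ψ1)
    (Ψ2 := fun u => u.1 • (-Real.sin u.2 • e + Real.cos u.2 • e')) (fun u _ => hd u)
    (N := fun _ => 1) measurable_const (S := Ioo 0 1) measurableSet_Ioo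
    (by simp only [htri']; exact measurable_fst) (k := 1 / 3) (fun _ _ => one_pos)
    lintegral_sq_unit ?_
  · have hset : {z | ∃ u ∈ Ioo (0 : ℝ) 1 ×ˢ Ico 0 (2 * Real.pi), ∃ R : ℝ, R * 1 ∈ Ioo (0 : ℝ) 1 ∧
        z = R • (x + u.1 • Ψ1 u)} = solid K x := by
      ext z
      constructor
      · rintro ⟨u, hu, R, hR, rfl⟩
        rw [mul_one] at hR
        have q1 : quad K x (R • (x + u.1 • Ψ1 u)) = R := by
          have := quad_comb K 1 0 R 0 x x (x + u.1 • Ψ1 u) x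
          simp only [one_smul, zero_smul, add_zero] at this
          rw [this, quad_add_smul, hΨ1, hqab, hxx]; ring
        have g1 : gram K x (R • (x + u.1 • Ψ1 u)) x (R • (x + u.1 • Ψ1 u)) = (R * u.1) ^ 2 := by
          rw [gram_smul, gram_add_smul, hgu]; ring
        have hu1 := hu.1
        show 0 < _ ∧ _ < _ ∧ 0 < _ ∧ _ < _
        rw [q1, g1]
        refine ⟨hR.1, hR.2, pow_pos (mul_pos hR.1 hu1.1) 2, ?_⟩
        have : R * u.1 < R := by nlinarith [hR.1, hu1.2]
        exact pow_lt_pow_left₀ this (mul_pos hR.1 hu1.1).le two_ne_zero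
      · rintro ⟨h1, h2, h3, h4⟩
        obtain ⟨a, b, hz⟩ := hdecomp z
        set R := quad K x z
        have hg : gram K x z x z = a ^ 2 + b ^ 2 := by
          rw [hz, ← hgab]; simp [gram, dual, cr]; ring
        rw [hg] at h3 h4
        have hs := Real.sqrt_pos.2 h3
        have hss := Real.sq_sqrt h3.le
        obtain ⟨θ, hθ, hc, hsn⟩ := exists_angle (a := a / √(a ^ 2 + b ^ 2))
          (b := b / √(a ^ 2 + b ^ 2)) (by rw [div_pow, div_pow, hss]; field_simp)
        refine ⟨(√(a ^ 2 + b ^ 2) / R, θ), ⟨⟨by positivity, ?_⟩, hθ⟩, R, ⟨by linarith, by linarith⟩, ?_⟩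
        · show √(a ^ 2 + b ^ 2) / R < 1
          rw [div_lt_one h1]
          exact lt_of_pow_lt_pow_left₀ 2 h1.le (by rw [hss]; exact h4)
        · conv_lhs => rw [hz]
          simp only [hΨ1, hc, hsn]
          ext i
          simp only [Pi.add_apply, Pi.smul_apply, smul_eq_mul]
          field_simp
    rw [hset] at key
    rw [key]
    simp only [htri']
    have hm : Measurable fun u : ℝ × ℝ => ENNReal.ofReal (1 / 3 * |u.1| / 1 ^ 3) := by fun_prop
    rw [Measure.volume_eq_prod, ← Measure.prod_restrict, lintegral_prod _ hm.aemeasurable]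
    simp only [lintegral_const, Measure.restrict_apply_univ, Real.volume_Ico, sub_zero]
    have e1 : ∀ r ∈ Ioo (0 : ℝ) 1, ENNReal.ofReal (1 / 3 * |r| / 1 ^ 3) *
        ENNReal.ofReal (2 * Real.pi) = ENNReal.ofReal (2 * Real.pi / 3 * r) := by
      intro r hr
      rw [← ENNReal.ofReal_mul (by positivity), abs_of_pos hr.1]
      congr 1; ring
    rw [setLIntegral_congr_fun measurableSet_Ioo e1]
    have := lintegral_linear (w := 2 * Real.pi / 3) (a := 1) (by positivity) one_pos
    have hI : {r : ℝ | 0 < r ∧ r * 1 < 1} = Ioo 0 1 := by ext r; simp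
    rw [hI] at this
    rw [this]
    congr 1; ring
  · intro u hu u' hu' R R' hR hR' heq
    rw [mul_one] at hR hR'
    have q1 : ∀ (R : ℝ) (u : ℝ × ℝ), quad K x (R • (x + u.1 • Ψ1 u)) = R := by
      intro R u
      have := quad_comb K 1 0 R 0 x x (x + u.1 • Ψ1 u) x
      simp only [one_smul, zero_smul, add_zero] at this
      rw [this, quad_add_smul, hΨ1, hqab, hxx]; ring
    have hRR : R = R' := by
      have := congrArg (quad K x) heq
      simpa only [q1] using this
    subst hRR
    have h1 := smul_right_injective _ hR.1.ne' heq
    have h2 : u.1 • Ψ1 u = u'.1 • Ψ1 u' := add_left_cancel h1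
    have h3 := congrArg (fun v => gram K x v x v) h2
    simp only [gram_smul, hgu, mul_one] at h3
    have h4 : u.1 = u'.1 := by
      have a1 : 0 < u.1 := hu.1.1
      have a2 : 0 < u'.1 := hu'.1.1
      nlinarith
    rw [h4] at h2
    have h5 : Ψ1 u = Ψ1 u' := smul_right_injective _ (ne_of_gt hu'.1.1) h2
    have t1 : ∀ u : ℝ × ℝ, tri x (Ψ1 u) e' = Real.cos u.2 * tri x e e' := by
      intro u; simp [tri, hΨ1]; ring
    have t2 : ∀ u : ℝ × ℝ, tri x e (Ψ1 u) = Real.sin u.2 * tri x e e' := by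
      intro u; simp [tri, hΨ1]; ring
    have c1 := congrArg (fun v => tri x v e') h5
    have c2 := congrArg (fun v => tri x e v) h5
    simp only [t1, t2, htri, mul_one] at c1 c2
    exact ⟨rfl, Prod.ext h4 (angle_inj hu.2 hu'.2 c1 c2)⟩

namespace Domain

variable {K : ℝ} {D : Set (Space K)} {c : ℝ → Space K} {T : ℝ}

/-- If two boundary points lie in the same direction from x, one is, up to scale, a nonnegative
combination of the other and x. Its own supporting functional vanishes there but is positive at x,
so the coefficient of x is 0. -/
theorem angle_param_inj (h : Domain D c T) {x : Space K} (hx : x ∈ interior D) {a b s t : ℝ}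
    (ha : 0 < a) (hb : 0 < b) (hs : s ∈ Ico 0 T) (ht : t ∈ Ico 0 T)
    (e : a • ((c s).1 - quad K x.1 (c s).1 • x.1) = b • ((c t).1 - quad K x.1 (c t).1 • x.1)) :
    a = b ∧ s = t := by
  obtain ⟨ε, hε, ho⟩ := h.exists_orientation
  have key : ∀ {a b d s t : ℝ}, 0 < a → 0 < b → s ∈ Ico 0 T → t ∈ Ico 0 T → 0 ≤ d →
      a • (c s).1 + d • x.1 = b • (c t).1 → a = b ∧ s = t := by
    intro a b d s t ha hb hs ht hd e
    have h1 := congrArg (fun z => ε * tri (c t).1 (vel c t) z) e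
    have e1 : ∀ z, tri (c t).1 (vel c t) (a • z + d • x.1) =
        a * tri (c t).1 (vel c t) z + d * tri (c t).1 (vel c t) x.1 := by
      intro z; simp [tri]; ring
    have e2 : tri (c t).1 (vel c t) (b • (c t).1) = 0 := by simp [tri]; ring
    simp only [e1, e2] at h1
    have h2 := mul_nonneg ha.le ((ho t).1 _ (h.mem s))
    have h3 := (ho t).2 x hx
    have hd0 : d = 0 := by
      by_contra hne
      have := mul_pos (lt_of_le_of_ne hd (Ne.symm hne)) h3
      nlinarith
    rw [hd0, zero_smul, add_zero] at e
    obtain ⟨e3, e4⟩ := eq_of_smul ha hb e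
    exact ⟨e3, h.bd.injOn hs ht e4⟩
  rcases le_total 0 (b * quad K x.1 (c t).1 - a * quad K x.1 (c s).1) with hd | hd
  · refine key ha hb hs ht hd ?_
    have : a • (c s).1 = a • ((c s).1 - quad K x.1 (c s).1 • x.1) +
        (a * quad K x.1 (c s).1) • x.1 := by rw [smul_sub, smul_smul]; abel
    rw [this, e, smul_sub, smul_smul, sub_smul]; abel
  · have := key (d := a * quad K x.1 (c s).1 - b * quad K x.1 (c t).1) hb ha ht hs (by linarith) (by
      have : b • (c t).1 = b • ((c t).1 - quad K x.1 (c t).1 • x.1) +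
        (b * quad K x.1 (c t).1) • x.1 := by rw [smul_sub, smul_smul]; abel
      rw [this, ← e, smul_sub, smul_smul, sub_smul]; abel)
    exact ⟨this.1.symm, this.2.symm⟩

/-- For small δ > 0 the vector x + δ v stays in the cone over D, and the segment from x through its
projection leaves D at a boundary point in the direction v. -/
theorem angle_param_surj (h : Domain D c T) {x : Space K} (hx : x ∈ interior D) {v : Fin 3 → ℝ}
    (hv : quad K x.1 v = 0) (hv0 : v ≠ 0) :
    ∃ t ∈ Ico 0 T, ∃ a : ℝ, 0 < a ∧ v = a • ((c t).1 - quad K x.1 (c t).1 • x.1) := by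
  have hxi : x.1 ∈ interior (cone D) :=
    mem_interior_cone.2 ⟨inCone_point x, by rw [proj_point]; exact hx⟩
  have hcont : Continuous fun δ : ℝ => x.1 + δ • v := by fun_prop
  have ht := hcont.tendsto 0
  simp only [zero_smul, add_zero] at ht
  obtain ⟨δ, h1, h2⟩ := (((ht.mono_left nhdsWithin_le_nhds).eventually
    (mem_interior_iff_mem_nhds.1 hxi)).and (self_mem_nhdsWithin (s := Ioi (0 : ℝ)))).exists
  have hδ : 0 < δ := h2
  obtain ⟨hin, hD⟩ := h1
  set p := proj K (x.1 + δ • v)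
  set r := √(quad K (x.1 + δ • v) (x.1 + δ • v))
  have hr : 0 < r := Real.sqrt_pos.2 hin.1
  have hp : x.1 + δ • v = r • p.1 := hin.eq_smul_proj
  have hxx : quad K x.1 x.1 = 1 := x.2.1
  have hqc : ∀ (a b : ℝ) (z : Fin 3 → ℝ), quad K x.1 (a • x.1 + b • z) = a + b * quad K x.1 z := by
    intro a b z
    have := quad_comb K 1 0 a b x.1 x.1 x.1 z
    simp only [one_smul, zero_smul, add_zero] at this
    rw [this, hxx]; ring
  have hne : x ≠ p := by
    intro e
    rw [← e] at hp
    have h3 := congrArg (quad K x.1) hp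
    have h4 := hqc 1 δ v
    have h5 := hqc r 0 v
    rw [one_smul, hv] at h4
    rw [zero_smul, add_zero] at h5
    rw [h4, h5] at h3
    have hr1 : r = 1 := by linarith
    rw [hr1, one_smul] at hp
    have : δ • v = 0 := by simpa using hp
    exact (smul_ne_zero hδ.ne' hv0) this
  obtain ⟨w, hw, α, β, hα, hβ, e⟩ := exists_exit h.compact h.convex (interior_subset hx) hD hne
  obtain ⟨t, ht, rfl⟩ := h.exists_param hw
  have e1 : δ • v = (r * α - 1) • x.1 + (r * β) • (c t).1 := by
    have : δ • v = r • p.1 - x.1 := by rw [← hp]; abel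
    rw [this, e, smul_add, smul_smul, smul_smul, sub_smul, one_smul]; abel
  have e2 := congrArg (quad K x.1) e1
  have e3 := hqc 0 δ v
  rw [zero_smul, zero_add, hv] at e3
  rw [e3, hqc] at e2
  refine ⟨t, ht, r * β / δ, by positivity, ?_⟩
  have e4 : v = δ⁻¹ • (δ • v) := by rw [smul_smul, inv_mul_cancel₀ hδ.ne', one_smul]
  rw [e4, e1, show r * α - 1 = -(r * β * quad K x.1 (c t).1) by linarith, smul_add, smul_smul,
    smul_smul, smul_sub, smul_smul]
  rw [show δ⁻¹ * -(r * β * quad K x.1 (c t).1) = -(r * β / δ * quad K x.1 (c t).1) by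
    field_simp, show δ⁻¹ * (r * β) = r * β / δ by field_simp, neg_smul]
  abel

theorem gram_interior_pos (h : Domain D c T) {x : Space K} (hx : x ∈ interior D) (t : ℝ) :
    0 < gram K x.1 (c t).1 x.1 (c t).1 :=
  gram_pos_of_ne h.convex (interior_subset hx) (h.mem t) fun e => h.not_mem_interior t (e ▸ hx)

/-- The integrand is dθ/dt for the direction θ of c(t) seen from x. The boundary sweeps every
direction exactly once, so it parametrizes the solid cone, and comparison with `volume_solid` gives
the total angle without winding numbers. -/
theorem lintegral_angle (h : Domain D c T) {x : Space K} (hx : x ∈ interior D) :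
    ∫⁻ t in Ico 0 T, ENNReal.ofReal (|tri (c t).1 (vel c t) x.1| /
      gram K x.1 (c t).1 x.1 (c t).1) = ENNReal.ofReal (2 * Real.pi) := by
  obtain ⟨q, hq⟩ : ∃ q : UnitTangent K, q.1.1 = x.1 := by
    have hne : x ≠ c 0 := fun e => h.not_mem_interior 0 (e ▸ hx)
    obtain ⟨q, d, -, -, h3, -⟩ := exists_segment h.convex (interior_subset hx) (h.mem 0) hne
    exact ⟨q, congrArg Subtype.val h3⟩
  have hvol := volume_solid q
  rw [hq] at hvol
  have hxx : quad K x.1 x.1 = 1 := x.2.1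
  have hG := fun t => h.gram_interior_pos hx t
  set Φ : ℝ → Fin 3 → ℝ := fun t => (c t).1 - quad K x.1 (c t).1 • x.1 with hΦ
  have hqΦ : ∀ t, quad K x.1 (Φ t) = 0 := by
    intro t
    have : quad K x.1 (Φ t) = quad K x.1 (c t).1 - quad K x.1 (c t).1 * quad K x.1 x.1 := by
      simp [hΦ, quad]; ring
    rw [this, hxx]; ring
  have hgΦ : ∀ t, gram K x.1 (Φ t) x.1 (Φ t) = gram K x.1 (c t).1 x.1 (c t).1 := by
    intro t; simp [hΦ, gram, dual, cr]; ring
  set U : Set (ℝ × ℝ) := {u | u.1 ∈ Ico 0 T ∧ 0 < u.2 ∧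
    u.2 * √(gram K x.1 (c u.1).1 x.1 (c u.1).1) < 1} with hU
  have hcσ : Continuous fun t => √(gram K x.1 (c t).1 x.1 (c t).1) :=
    (Continuous.gram continuous_const h.continuous_coe continuous_const h.continuous_coe).sqrt
  have hUm : MeasurableSet U := by
    have m1 : Measurable fun u : ℝ × ℝ => u.2 * √(gram K x.1 (c u.1).1 x.1 (c u.1).1) :=
      measurable_snd.mul (hcσ.measurable.comp measurable_fst)
    exact (measurable_fst measurableSet_Ico).inter
      ((measurableSet_lt measurable_const measurable_snd).inter
        (measurableSet_lt m1 measurable_const))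
  have hct : Continuous fun t => tri (c t).1 (vel c t) x.1 :=
    Continuous.tri h.continuous_coe h.continuous_vel continuous_const
  have htri : ∀ u : ℝ × ℝ, tri (x.1 + u.2 • Φ u.1)
      (u.2 • (vel c u.1 - quad K x.1 (vel c u.1) • x.1)) (Φ u.1) =
      -(u.2 * tri (c u.1).1 (vel c u.1) x.1) := by
    intro u; simp [hΦ, tri]; ring
  have hd : ∀ u : ℝ × ℝ, HasFDerivAt (fun u : ℝ × ℝ => x.1 + u.2 • Φ u.1)
      ((ContinuousLinearMap.fst ℝ ℝ ℝ).smulRight (u.2 • (vel c u.1 - quad K x.1 (vel c u.1) • x.1)) +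
        (ContinuousLinearMap.snd ℝ ℝ ℝ).smulRight (Φ u.1)) u := by
    intro u
    refine hasFDerivAt_of_coord fun i => ?_
    have h1 : HasDerivAt (fun t => Φ t i) (vel c u.1 i - quad K x.1 (vel c u.1) * x.1 i) u.1 :=
      (hasDerivAt_pi.1 (h.hasDerivAt u.1) i).sub ((h.hasDerivAt_quad x.1 u.1).mul_const _)
    have h2 := (hasFDerivAt_fst_mul_snd h1 (hasDerivAt_id u.2)).const_add (x.1 i)
    have e1 : (fun v : ℝ × ℝ => (x.1 + v.2 • Φ v.1) i) = fun v => x.1 i + Φ v.1 i * id v.2 := by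
      funext v; simp [mul_comm]
    rw [e1]
    refine h2.congr_fderiv ?_
    ext <;> simp [mul_comm]
  have q1 : ∀ (R : ℝ) (u : ℝ × ℝ), quad K x.1 (R • (x.1 + u.2 • Φ u.1)) = R := by
    intro R u
    have := quad_comb K 1 0 R 0 x.1 x.1 (x.1 + u.2 • Φ u.1) x.1
    simp only [one_smul, zero_smul, add_zero] at this
    rw [this, quad_add_smul, hqΦ, hxx]; ring
  have key := volume_cone_image hUm (Ψ := fun u => x.1 + u.2 • Φ u.1)
    (Ψ1 := fun u => u.2 • (vel c u.1 - quad K x.1 (vel c u.1) • x.1)) (Ψ2 := fun u => Φ u.1)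
    (fun u _ => hd u) (N := fun _ => 1) measurable_const (S := Ioo 0 1) measurableSet_Ioo
    (by simp only [htri]; exact (measurable_snd.mul (hct.measurable.comp measurable_fst)).neg)
    (k := 1 / 3) (fun _ _ => one_pos) lintegral_sq_unit ?_
  · have hset : {z | ∃ u ∈ U, ∃ R : ℝ, R * 1 ∈ Ioo (0 : ℝ) 1 ∧ z = R • (x.1 + u.2 • Φ u.1)} =
        solid K x.1 := by
      ext z
      constructor
      · rintro ⟨u, ⟨hu1, hu2, hu3⟩, R, hR, rfl⟩
        rw [mul_one] at hR
        have g1 : gram K x.1 (R • (x.1 + u.2 • Φ u.1)) x.1 (R • (x.1 + u.2 • Φ u.1)) =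
            (R * (u.2 * √(gram K x.1 (c u.1).1 x.1 (c u.1).1))) ^ 2 := by
          rw [gram_smul, gram_add_smul, hgΦ, mul_pow, mul_pow, Real.sq_sqrt (hG _).le]
        have hσ := Real.sqrt_pos.2 (hG u.1)
        show 0 < _ ∧ _ < _ ∧ 0 < _ ∧ _ < _
        rw [q1, g1]
        refine ⟨hR.1, hR.2, pow_pos (mul_pos hR.1 (mul_pos hu2 hσ)) 2, ?_⟩
        refine pow_lt_pow_left₀ ?_ (mul_pos hR.1 (mul_pos hu2 hσ)).le two_ne_zero
        nlinarith [hR.1]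
      · rintro ⟨h1, h2, h3, h4⟩
        set R := quad K x.1 z
        have hv : quad K x.1 (z - R • x.1) = 0 := by
          have : quad K x.1 (z - R • x.1) = quad K x.1 z - R * quad K x.1 x.1 := by
            simp [quad]; ring
          rw [this, hxx]; ring
        have hgv : gram K x.1 (z - R • x.1) x.1 (z - R • x.1) = gram K x.1 z x.1 z := by
          simp [gram, dual, cr]; ring
        have hv0 : z - R • x.1 ≠ 0 := by
          intro h0
          rw [h0] at hgv
          have : gram K x.1 0 x.1 0 = 0 := by simp [gram, dual, cr]
          linarith
        obtain ⟨t, ht, a, ha, e⟩ := h.angle_param_surj hx hv hv0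
        have e' : z - R • x.1 = a • Φ t := e
        rw [e', gram_smul, hgΦ] at hgv
        refine ⟨(t, a / R), ⟨ht, by positivity, ?_⟩, R, ⟨by linarith, by linarith⟩, ?_⟩
        · show a / R * √(gram K x.1 (c t).1 x.1 (c t).1) < 1
          rw [div_mul_eq_mul_div, div_lt_one h1]
          refine lt_of_pow_lt_pow_left₀ 2 h1.le ?_
          rw [mul_pow, Real.sq_sqrt (hG t).le, hgv]
          exact h4
        · show z = R • (x.1 + (a / R) • Φ t)
          rw [smul_add, smul_smul, mul_div_cancel₀ _ h1.ne', ← e']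
          abel
    rw [hset, hvol, lintegral_sections hUm] at key
    -- The integral of r over 0 < r < 1/σ is 1/(2σ²), with σ² the `gram` of x and c(t): hence the
    -- factor 1/6 and the denominator.
    · have e1 : ∀ t, ∫⁻ r in {r | (t, r) ∈ U}, ENNReal.ofReal (1 / 3 * |tri (x.1 + r • Φ t)
          (r • (vel c t - quad K x.1 (vel c t) • x.1)) (Φ t)| / 1 ^ 3) =
          (Ico 0 T).indicator (fun t => ENNReal.ofReal (1 / 6) * ENNReal.ofReal
            (|tri (c t).1 (vel c t) x.1| / gram K x.1 (c t).1 x.1 (c t).1)) t := by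
        intro t
        by_cases ht : t ∈ Ico 0 T
        · have hsec : {r | (t, r) ∈ U} = {r : ℝ | 0 < r ∧ r *
              √(gram K x.1 (c t).1 x.1 (c t).1) < 1} := by
            ext r; exact ⟨fun h => h.2, fun h => ⟨ht, h⟩⟩
          have hms : MeasurableSet {r : ℝ | 0 < r ∧ r * √(gram K x.1 (c t).1 x.1 (c t).1) < 1} := by
            rw [← hsec]; exact measurable_prodMk_left hUm
          rw [indicator_of_mem ht, hsec, ← ENNReal.ofReal_mul (by norm_num)]
          have := lintegral_linear (w := |tri (c t).1 (vel c t) x.1| / 3) (by positivity)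
            (Real.sqrt_pos.2 (hG t))
          rw [Real.sq_sqrt (hG t).le] at this
          rw [show 1 / 6 * (|tri (c t).1 (vel c t) x.1| / gram K x.1 (c t).1 x.1 (c t).1) =
            |tri (c t).1 (vel c t) x.1| / 3 / (2 * gram K x.1 (c t).1 x.1 (c t).1) by
              have := (hG t).ne'
              field_simp; ring, ← this]
          refine setLIntegral_congr_fun hms fun r hr => ?_
          have := htri (t, r)
          simp only at this
          rw [this, abs_neg, abs_mul, abs_of_pos hr.1]
          congr 1; ring
        · have hsec : {r | (t, r) ∈ U} = ∅ := by
            ext r; exact ⟨fun h => ht h.1, fun h => h.elim⟩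
          rw [indicator_of_notMem ht, hsec]; simp
      rw [lintegral_congr e1, lintegral_indicator measurableSet_Ico,
        lintegral_const_mul' _ _ ENNReal.ofReal_ne_top] at key
      have h6 : ENNReal.ofReal 6 * ENNReal.ofReal (1 / 6) = 1 := by
        rw [← ENNReal.ofReal_mul (by norm_num)]; norm_num
      calc _ = ENNReal.ofReal 6 * (ENNReal.ofReal (1 / 6) * ∫⁻ t in Ico 0 T, ENNReal.ofReal
            (|tri (c t).1 (vel c t) x.1| / gram K x.1 (c t).1 x.1 (c t).1)) := by
            rw [← mul_assoc, h6, one_mul]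
        _ = _ := by
            rw [← key, ← ENNReal.ofReal_mul (by norm_num)]
            congr 1; ring
    · simp only [htri]
      have m1 : Measurable fun u : ℝ × ℝ => u.2 * tri (c u.1).1 (vel c u.1) x.1 :=
        measurable_snd.mul (hct.measurable.comp measurable_fst)
      exact (((m1.neg.abs).const_mul _).div_const _).ennreal_ofReal
  · intro u hu u' hu' R R' hR hR' heq
    rw [mul_one] at hR hR'
    have hRR : R = R' := by
      have := congrArg (quad K x.1) heq
      simpa only [q1] using this
    subst hRR
    have h1 := smul_right_injective _ hR.1.ne' heq
    have h2 : u.2 • Φ u.1 = u'.2 • Φ u'.1 := add_left_cancel h1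
    obtain ⟨h3, h4⟩ := h.angle_param_inj hx hu.2.1 hu'.2.1 hu.1 hu'.1 h2
    exact ⟨rfl, Prod.ext h4 h3⟩

end Domain

/-! ### The isoperimetric inequality -/

namespace Domain

variable {K : ℝ} {D : Set (Space K)} {c : ℝ → Space K} {T : ℝ}

theorem sqrt_quad_ray (x y : Space K) (b : ℝ) :
    √(quad K (x.1 + b • y.1) (x.1 + b • y.1)) = rad (quad K x.1 y.1) b := by
  have hx : quad K x.1 x.1 = 1 := x.2.1
  have hy : quad K y.1 y.1 = 1 := y.2.1
  have := quad_comb K 1 b 1 b x.1 y.1 x.1 y.1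
  simp only [one_smul] at this
  rw [rad, this, hx, hy, quad_comm K y.1 x.1]
  congr 1; ring

theorem lintegral_ray_prod {F : ℝ × ℝ → ENNReal} (hF : Measurable F) :
    ∫⁻ u in Ioi (0 : ℝ) ×ˢ Ico 0 T, F u = ∫⁻ t in Ico 0 T, ∫⁻ b in Ioi (0 : ℝ), F (b, t) := by
  rw [Measure.volume_eq_prod, ← Measure.prod_restrict, lintegral_prod_symm _ hF.aemeasurable]

theorem measurable_ray_density (h : Domain D c T) (y : Space K) :
    Measurable fun u : ℝ × ℝ => ENNReal.ofReal (u.1 * |tri (c u.2).1 (vel c u.2) y.1| /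
      √(quad K (y.1 + u.1 • (c u.2).1) (y.1 + u.1 • (c u.2).1)) ^ 3) := by
  have c1 : Continuous fun u : ℝ × ℝ => tri (c u.2).1 (vel c u.2) y.1 :=
    Continuous.tri (h.continuous_coe.comp continuous_snd) (h.continuous_vel.comp continuous_snd)
      continuous_const
  have c2 : Continuous fun u : ℝ × ℝ => y.1 + u.1 • (c u.2).1 :=
    continuous_const.add (continuous_fst.smul (h.continuous_coe.comp continuous_snd))
  exact ((measurable_fst.mul c1.abs.measurable).div
    ((c2.quad c2).sqrt.measurable.pow_const 3)).ennreal_ofReal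

theorem one_add_quad_pos (h : Domain D c T) {x : Space K} (hx : x ∈ D) (t : ℝ) :
    0 < 1 + quad K x.1 (c t).1 := by
  linarith [quad_gt_neg_one h.convex hx (h.mem t)]

theorem area_eq_lintegral (h : Domain D c T) {x : Space K} (hx : x ∈ D) :
    area K D = ∫⁻ t in Ico 0 T,
      ENNReal.ofReal (|tri (c t).1 (vel c t) x.1| / (1 + quad K x.1 (c t).1)) := by
  have hm : Measurable fun u : ℝ × ℝ => proj K (x.1 + u.1 • (c u.2).1) := by
    have c2 : Continuous fun u : ℝ × ℝ => x.1 + u.1 • (c u.2).1 :=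
      continuous_const.add (continuous_fst.smul (h.continuous_coe.comp continuous_snd))
    exact (measurable_proj K).comp c2.measurable
  rw [← Measure.restrict_apply_univ, h.area_restrict hx, Measure.map_apply hm MeasurableSet.univ,
    preimage_univ, withDensity_apply _ MeasurableSet.univ, Measure.restrict_univ,
    lintegral_ray_prod (h.measurable_ray_density x)]
  refine lintegral_congr fun t => ?_
  have hC := quad_gt_neg_one h.convex hx (h.mem t)
  have key := lintegral_area hC (quad_sq_add x.2 (c t).2) (fun hK => quad_pos x.2 (c t).2 hK)
  rw [div_eq_mul_one_div, ENNReal.ofReal_mul (abs_nonneg _), ← key,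
    ← lintegral_const_mul' _ _ ENNReal.ofReal_ne_top]
  refine lintegral_congr fun b => ?_
  simp only
  rw [sqrt_quad_ray, ← ENNReal.ofReal_mul (abs_nonneg _)]
  congr 1; ring

theorem area_frontier (h : Domain D c T) : area K (frontier D) = 0 := by
  have h1 := volume_unitCone (K := K) (E := frontier D) isClosed_frontier.measurableSet
  have h2 : unitCone (frontier D) ⊆ frontier (cone D) := by
    rintro z ⟨hz1, -, hz3⟩
    rw [h.compact.isClosed.frontier_eq] at hz3
    exact ⟨subset_closure ⟨hz1, hz3.1⟩, fun hi => hz3.2 (mem_interior_cone.1 hi).2⟩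
  rw [measure_mono_null h2 h.volume_frontier_cone] at h1
  rcases mul_eq_zero.1 h1.symm with h3 | h3
  · norm_num at h3
  · exact h3

theorem continuous_tri_point (h : Domain D c T) (x : Fin 3 → ℝ) :
    Continuous fun t => |tri (c t).1 (vel c t) x| :=
  (Continuous.tri h.continuous_coe h.continuous_vel continuous_const).abs

theorem continuous_quad_point (h : Domain D c T) (x : Fin 3 → ℝ) :
    Continuous fun t => quad K x (c t).1 := Continuous.quad continuous_const h.continuous_coe

theorem continuous_gram_point (h : Domain D c T) (x : Fin 3 → ℝ) :
    Continuous fun t => gram K x (c t).1 x (c t).1 :=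
  Continuous.gram continuous_const h.continuous_coe continuous_const h.continuous_coe

theorem integrableOn_Ico {F : ℝ → ℝ} (hF : Continuous F) (T : ℝ) : IntegrableOn F (Ico 0 T) :=
  (hF.continuousOn.integrableOn_compact isCompact_Icc).mono_set Ico_subset_Icc_self

theorem area_lt_top (h : Domain D c T) : area K D < ⊤ := by
  rw [h.area_eq_lintegral (h.mem 0)]
  have := (integrableOn_Ico ((h.continuous_tri_point (c 0).1).div
    (continuous_const.add (h.continuous_quad_point (c 0).1))
    fun t => (h.one_add_quad_pos (h.mem 0) t).ne') T)
  exact Integrable.lintegral_lt_top this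

/-- A Gauss–Bonnet type identity. -/
theorem lintegral_defect (h : Domain D c T) {x : Space K} (hx : x ∈ interior D) :
    ∫⁻ t in Ico 0 T, ENNReal.ofReal (|tri (c t).1 (vel c t) x.1| * (1 + quad K x.1 (c t).1) /
      gram K x.1 (c t).1 x.1 (c t).1) =
      ENNReal.ofReal (4 * Real.pi - K * (area K D).toReal) := by
  have hxD := interior_subset hx
  have hG := h.gram_interior_pos hx
  have hC := h.one_add_quad_pos hxD
  have c1 : Continuous fun t => |tri (c t).1 (vel c t) x.1| / gram K x.1 (c t).1 x.1 (c t).1 :=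
    (h.continuous_tri_point x.1).div (h.continuous_gram_point x.1) fun t => (hG t).ne'
  have c2 : Continuous fun t => |tri (c t).1 (vel c t) x.1| / (1 + quad K x.1 (c t).1) :=
    (h.continuous_tri_point x.1).div
    (continuous_const.add (h.continuous_quad_point x.1)) fun t => (hC t).ne'
  have i1 := integrableOn_Ico c1 T
  have i2 := integrableOn_Ico c2 T
  have n1 : ∀ t, 0 ≤ |tri (c t).1 (vel c t) x.1| / gram K x.1 (c t).1 x.1 (c t).1 := fun t =>
    div_nonneg (abs_nonneg _) (hG t).le
  have n2 : ∀ t, 0 ≤ |tri (c t).1 (vel c t) x.1| / (1 + quad K x.1 (c t).1) := fun t =>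
    div_nonneg (abs_nonneg _) (hC t).le
  have I1 : ∫ t in Ico 0 T, |tri (c t).1 (vel c t) x.1| / gram K x.1 (c t).1 x.1 (c t).1 =
      2 * Real.pi := by
    have := h.lintegral_angle hx
    rw [← ofReal_integral_eq_lintegral_ofReal i1 (Filter.Eventually.of_forall n1)] at this
    exact (ENNReal.ofReal_eq_ofReal_iff (integral_nonneg n1) (by positivity)).1 this
  have I2 : ∫ t in Ico 0 T, |tri (c t).1 (vel c t) x.1| / (1 + quad K x.1 (c t).1) =
      (area K D).toReal := by
    rw [h.area_eq_lintegral hxD,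
      ← ofReal_integral_eq_lintegral_ofReal i2 (Filter.Eventually.of_forall n2),
      ENNReal.toReal_ofReal (integral_nonneg n2)]
  -- With C the cosine and G = `gram`, the relation 1 − C² = K G gives K/(1 + C) = (1 − C)/G, and 2
  -- − (1 − C) = 1 + C.
  have e1 : ∀ t, |tri (c t).1 (vel c t) x.1| * (1 + quad K x.1 (c t).1) /
      gram K x.1 (c t).1 x.1 (c t).1 =
      2 * (|tri (c t).1 (vel c t) x.1| / gram K x.1 (c t).1 x.1 (c t).1) -
      K * (|tri (c t).1 (vel c t) x.1| / (1 + quad K x.1 (c t).1)) := by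
    intro t
    have hS := (hG t).ne'
    have h1C := (hC t).ne'
    have hq := quad_sq_add x.2 (c t).2
    rw [Real.sq_sqrt (hG t).le] at hq
    field_simp
    linear_combination |tri (c t).1 (vel c t) x.1| * hq
  have e2 : ∫ t in Ico 0 T, |tri (c t).1 (vel c t) x.1| * (1 + quad K x.1 (c t).1) /
      gram K x.1 (c t).1 x.1 (c t).1 = 4 * Real.pi - K * (area K D).toReal := by
    simp only [e1]
    rw [integral_sub (i1.const_mul 2) (i2.const_mul K), integral_const_mul, integral_const_mul,
      I1, I2]
    ring
  rw [← e2, ofReal_integral_eq_lintegral_ofReal]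
  · simp only [e1]
    exact (i1.const_mul 2).sub (i2.const_mul K)
  · exact Filter.Eventually.of_forall fun t => div_nonneg
      (mul_nonneg (abs_nonneg _) (hC t).le) (hG t).le

/-- The kernel whose double integral appears in the isoperimetric inequality. -/
def kernel (c : ℝ → Space K) (p : Space K × ℝ) : ENNReal :=
  ENNReal.ofReal (|tri (c p.2).1 (vel c p.2) p.1.1| * (1 + quad K p.1.1 (c p.2).1) /
    gram K p.1.1 (c p.2).1 p.1.1 (c p.2).1)

theorem measurable_kernel (h : Domain D c T) : Measurable (kernel c) := by
  have a1 : Continuous fun p : Space K × ℝ => p.1.1 := continuous_subtype_val.comp continuous_fst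
  have a2 : Continuous fun p : Space K × ℝ => (c p.2).1 := h.continuous_coe.comp continuous_snd
  have a3 : Continuous fun p : Space K × ℝ => vel c p.2 := h.continuous_vel.comp continuous_snd
  have c1 := (a2.tri a3 a1).abs
  have c2 : Continuous fun p : Space K × ℝ => 1 + quad K p.1.1 (c p.2).1 :=
    continuous_const.add (a1.quad a2)
  have c3 : Continuous fun p : Space K × ℝ => gram K p.1.1 (c p.2).1 p.1.1 (c p.2).1 :=
    a1.gram a2 a1 a2
  exact ((c1.mul c2).measurable.div c3.measurable).ennreal_ofReal

/-- On the chord from c t to c s the product separates into a factor of the chord alone and the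
radial integrand of `lintegral_chord`. -/
theorem density_mul_kernel (h : Domain D c T) {s t b : ℝ} (hb : 0 < b)
    (hS : 0 < gram K (c t).1 (c s).1 (c t).1 (c s).1) :
    ENNReal.ofReal (b * |tri (c s).1 (vel c s) (c t).1| /
      √(quad K ((c t).1 + b • (c s).1) ((c t).1 + b • (c s).1)) ^ 3) *
      kernel c (proj K ((c t).1 + b • (c s).1), t) =
    ENNReal.ofReal (|tri (c s).1 (vel c s) (c t).1| * |tri (c t).1 (vel c t) (c s).1| /
      gram K (c t).1 (c s).1 (c t).1 (c s).1) *
    ENNReal.ofReal ((rad (quad K (c t).1 (c s).1) b + (1 + quad K (c t).1 (c s).1 * b)) /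
      rad (quad K (c t).1 (c s).1) b ^ 3) := by
  set y := (c t).1 with hy
  set z := (c s).1 with hz
  set C := quad K y z with hCdef
  set S := gram K y z y z with hSdef
  have hC := quad_gt_neg_one h.convex (h.mem t) (h.mem s)
  have hN : 0 < rad C b := rad_pos hC hb.le
  have hyy : quad K y y = 1 := (c t).2.1
  have hin : InCone K (y + b • z) := by
    have := inCone_comb h.convex (h.mem t) (h.mem s) zero_le_one hb.le (by linarith)
    rwa [one_smul] at this
  have hp : (proj K (y + b • z)).1 = (rad C b)⁻¹ • (y + b • z) := by
    rw [hin.proj_eq, hy, hz, sqrt_quad_ray]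
  set N := rad C b
  have t1 : tri y (vel c t) (N⁻¹ • (y + b • z)) = N⁻¹ * (b * tri y (vel c t) z) := by
    simp [tri]; ring
  have t2 : quad K (N⁻¹ • (y + b • z)) y = N⁻¹ * (1 + C * b) := by
    have : quad K (N⁻¹ • (y + b • z)) y = N⁻¹ * (quad K y y + quad K y z * b) := by
      simp [quad]; ring
    rw [this, hyy]
  have t3 : gram K (N⁻¹ • (y + b • z)) y (N⁻¹ • (y + b • z)) y = N⁻¹ ^ 2 * (b ^ 2 * S) := by
    rw [hSdef]; simp [gram, dual, cr]; ring
  have hk : kernel c (proj K (y + b • z), t) = ENNReal.ofReal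
      (|tri y (vel c t) z| * (N + (1 + C * b)) / (b * S)) := by
    simp only [kernel]
    rw [hp, ← hy, t1, t2, t3]
    congr 1
    rw [abs_mul, abs_mul, abs_of_pos hb, abs_of_pos (inv_pos.2 hN)]
    field_simp
  rw [hk, hy, hz, sqrt_quad_ray, ← hy, ← hz, ← ENNReal.ofReal_mul (by positivity),
    ← ENNReal.ofReal_mul (by positivity)]
  congr 1
  show b * _ / N ^ 3 * _ = _
  field_simp

/-- The points x of D are swept by the chords from c t. With σ = sin_K ρ, the factor of the chord is
`jac` times σ, and the radial integral is (ρ + σ)/σ. -/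
theorem lintegral_kernel (h : Domain D c T) {t : ℝ} (ht : t ∈ Ico 0 T) :
    ∫⁻ x, kernel c (x, t) ∂((area K).restrict D) = ∫⁻ s in Ico 0 T, ENNReal.ofReal
      (jac c t s * (rho c t s + √(gram K (c t).1 (c s).1 (c t).1 (c s).1))) := by
  have hm : Measurable fun u : ℝ × ℝ => proj K ((c t).1 + u.1 • (c u.2).1) := by
    have c2 : Continuous fun u : ℝ × ℝ => (c t).1 + u.1 • (c u.2).1 :=
      continuous_const.add (continuous_fst.smul (h.continuous_coe.comp continuous_snd))
    exact (measurable_proj K).comp c2.measurable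
  have hk : Measurable fun x => kernel c (x, t) := by
    have := h.measurable_kernel.comp (measurable_prodMk_right (y := t))
    exact this
  have hden := h.measurable_ray_density (c t)
  have hkm : Measurable fun u : ℝ × ℝ => kernel c (proj K ((c t).1 + u.1 • (c u.2).1), t) := by
    have := hk.comp hm
    exact this
  rw [h.area_restrict (h.mem t), lintegral_map hk hm,
    lintegral_withDensity_eq_lintegral_mul _ hden hkm]
  refine (lintegral_ray_prod (hden.mul hkm)).trans ?_
  refine setLIntegral_congr_fun_ae measurableSet_Ico ?_
  -- The chord degenerates only at s = t.
  have hae : ∀ᵐ s : ℝ, s ≠ t := by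
    rw [ae_iff]; simp
  filter_upwards [hae] with s hst hs
  have hS := h.gram_pos ht hs hst.symm
  have hC := quad_gt_neg_one h.convex (h.mem t) (h.mem s)
  have hσ := Real.sqrt_pos.2 hS
  have e1 : ∫⁻ b in Ioi (0 : ℝ), ((fun u : ℝ × ℝ => ENNReal.ofReal
      (u.1 * |tri (c u.2).1 (vel c u.2) (c t).1| /
      √(quad K ((c t).1 + u.1 • (c u.2).1) ((c t).1 + u.1 • (c u.2).1)) ^ 3)) *
      fun u : ℝ × ℝ => kernel c (proj K ((c t).1 + u.1 • (c u.2).1), t)) (b, s) =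
      ∫⁻ b in Ioi (0 : ℝ), ENNReal.ofReal (|tri (c s).1 (vel c s) (c t).1| *
        |tri (c t).1 (vel c t) (c s).1| / gram K (c t).1 (c s).1 (c t).1 (c s).1) *
      ENNReal.ofReal ((rad (quad K (c t).1 (c s).1) b + (1 + quad K (c t).1 (c s).1 * b)) /
        rad (quad K (c t).1 (c s).1) b ^ 3) :=
    setLIntegral_congr_fun measurableSet_Ioi fun b hb => h.density_mul_kernel hb hS
  rw [e1, lintegral_const_mul' _ _ ENNReal.ofReal_ne_top,
    lintegral_chord hC (quad_sq_add (c t).2 (c s).2) (fun hK => quad_pos (c t).2 (c s).2 hK) hσ,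
    ← ENNReal.ofReal_mul (by positivity)]
  congr 1
  have hJ : jac c t s = |tri (c s).1 (vel c s) (c t).1| * |tri (c t).1 (vel c t) (c s).1| /
      √(gram K (c t).1 (c s).1 (c t).1 (c s).1) ^ 3 := by
    rw [jac, ← abs_mul, ← abs_of_nonneg (h.tri_mul_nonneg t s)]
    congr 2
    rw [show tri (c s).1 (vel c s) (c t).1 = tri (c t).1 (c s).1 (vel c s) by simp [tri]; ring]
    ring
  rw [hJ, rho, dst]
  set σ := √(gram K (c t).1 (c s).1 (c t).1 (c s).1)
  rw [show gram K (c t).1 (c s).1 (c t).1 (c s).1 = σ ^ 2 from (Real.sq_sqrt hS.le).symm]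
  field_simp

/-- Fubini for the kernel on D times the boundary: integrating first over the boundary gives the
constant of `lintegral_defect` for almost every x, the frontier being null; integrating first over D
gives `lintegral_kernel`. -/
theorem lintegral_square_eq (h : Domain D c T) :
    ENNReal.ofReal (4 * Real.pi - K * (area K D).toReal) * area K D =
      ∫⁻ t in Ico 0 T, ∫⁻ s in Ico 0 T, ENNReal.ofReal
        (jac c t s * (rho c t s + √(gram K (c t).1 (c s).1 (c t).1 (c s).1))) := by
  have : IsFiniteMeasure ((area K).restrict D) :=
    ⟨by rw [Measure.restrict_apply_univ]; exact h.area_lt_top⟩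
  have hsw := lintegral_lintegral_swap (μ := (area K).restrict D)
    (ν := (volume : Measure ℝ).restrict (Ico 0 T)) (f := fun x t => kernel c (x, t))
    h.measurable_kernel.aemeasurable
  rw [setLIntegral_congr_fun measurableSet_Ico fun t ht => h.lintegral_kernel ht] at hsw
  rw [← hsw]
  have hae : ∀ᵐ x ∂((area K).restrict D), x ∈ interior D := by
    have h1 : ∀ᵐ x ∂(area K), x ∉ frontier D := measure_eq_zero_iff_ae_notMem.1 h.area_frontier
    rw [ae_restrict_iff' h.compact.isClosed.measurableSet]
    filter_upwards [h1] with x hx hxD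
    by_contra hi
    exact hx (by rw [h.compact.isClosed.frontier_eq]; exact ⟨hxD, hi⟩)
  have e1 : ∫⁻ x, (∫⁻ t in Ico 0 T, kernel c (x, t)) ∂((area K).restrict D) =
      ∫⁻ _x, ENNReal.ofReal (4 * Real.pi - K * (area K D).toReal) ∂((area K).restrict D) := by
    refine lintegral_congr_ae ?_
    filter_upwards [hae] with x hx
    exact h.lintegral_defect hx
  rw [e1, lintegral_const, Measure.restrict_apply_univ]

/-- In terms of the angles this is cos α₁ cos α₂ + sin α₁ sin α₂ ≤ 1: Cauchy–Schwarz for (P,Q) and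
(P',Q'), whose lengths are σ times the speeds by `gram_lagrange`. -/
theorem neg_rhoD_mul_add_le (h : Domain D c T) (s t : ℝ) :
    -(rhoD c s t * rhoD c t s) + √(gram K (c s).1 (c t).1 (c s).1 (c t).1) * jac c s t ≤
      vnorm K (vel c s) * vnorm K (vel c t) := by
  have hg := gram_nonneg (c s).2 (c t).1
  -- Where `gram` vanishes, `rhoD` is 0 by division by zero and the left side is 0.
  rcases hg.eq_or_lt with h0 | hpos
  · have : √(gram K (c s).1 (c t).1 (c s).1 (c t).1) = 0 := by rw [← h0, Real.sqrt_zero]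
    rw [rhoD, this, div_zero, zero_mul, neg_zero, zero_mul, add_zero]
    exact mul_nonneg (Real.sqrt_nonneg _) (Real.sqrt_nonneg _)
  have hσ := Real.sqrt_pos.2 hpos
  have hσ2 := Real.sq_sqrt hpos.le
  have l1 := gram_lagrange K (c s).1 (vel c s) (c t).1
  have l2 := gram_lagrange K (c t).1 (vel c t) (c s).1
  rw [(c s).2.1, ← h.metric_vel, one_mul] at l1
  rw [(c t).2.1, ← h.metric_vel, one_mul, gram_swap K (c t).1 (c s).1] at l2
  have m1 := h.metric_vel_pos s
  have m2 := h.metric_vel_pos t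
  rw [vnorm, vnorm, ← Real.sqrt_mul m1.le, rhoD, rhoD, jac, gram_swap K (c t).1 (c s).1]
  set σ := √(gram K (c s).1 (c t).1 (c s).1 (c t).1)
  rw [← hσ2] at l1 l2
  refine Real.le_sqrt_of_sq_le ?_
  rw [show tri (c s).1 (c t).1 (vel c t) = tri (c t).1 (vel c t) (c s).1 by simp [tri]; ring]
  set P := gram K (c s).1 (vel c s) (c s).1 (c t).1
  set Q := tri (c s).1 (vel c s) (c t).1
  set P' := gram K (c t).1 (vel c t) (c t).1 (c s).1
  set Q' := tri (c t).1 (vel c t) (c s).1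
  have e1 : -(-P / σ * (-P' / σ)) + σ * (Q * Q' / σ ^ 3) = (-(P * P') + Q * Q') / σ ^ 2 := by
    field_simp
  have e2 : metric K (vel c s) (vel c s) * metric K (vel c t) (vel c t) =
      ((P ^ 2 + Q ^ 2) * (P' ^ 2 + Q' ^ 2)) / (σ ^ 2) ^ 2 := by
    rw [l1, l2]; field_simp
  rw [e1, e2, div_pow]
  gcongr
  nlinarith [sq_nonneg (P * Q' + Q * P')]

/-- The double integral of (ρ + σ) `jac` equals A (4π − K A) when the latter is nonnegative. The
integral of ρ `jac` is exchanged for that of −∂ρ/∂s ∂ρ/∂t by `integral_square` with f(x) = x, whose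
boundary term is 0; the pointwise bound then integrates to L². -/
theorem isoperimetric (h : Domain D c T) :
    4 * Real.pi * (area K D).toReal - K * (area K D).toReal ^ 2 ≤ curveLength c T ^ 2 := by
  have hT := h.bd.period_pos
  have hσc : Continuous fun u : ℝ × ℝ => √(gram K (c u.1).1 (c u.2).1 (c u.1).1 (c u.2).1) :=
    h.continuous_gram.sqrt
  have i1 := h.integrableOn_mul_jac continuous_id
  have i2 : IntegrableOn (fun u : ℝ × ℝ => √(gram K (c u.1).1 (c u.2).1 (c u.1).1 (c u.2).1) *
      jac c u.1 u.2) (square T) :=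
    IntegrableOn.continuousOn_mul_of_subset hσc.continuousOn
      h.integrableOn_jac (isCompact_Icc.prod isCompact_Icc) (measurableSet_square T)
      (prod_mono Ico_subset_Icc_self Ico_subset_Icc_self)
  have i3 := h.integrableOn_rhoD_mul (φ := fun _ => 1) continuous_const
  simp only [one_mul] at i3
  simp only [id] at i1
  have e0 : ∀ u : ℝ × ℝ, jac c u.1 u.2 * (rho c u.1 u.2 +
      √(gram K (c u.1).1 (c u.2).1 (c u.1).1 (c u.2).1)) = rho c u.1 u.2 * jac c u.1 u.2 +
      √(gram K (c u.1).1 (c u.2).1 (c u.1).1 (c u.2).1) * jac c u.1 u.2 := fun u => by ring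
  have hn : ∀ u : ℝ × ℝ, 0 ≤ jac c u.1 u.2 * (rho c u.1 u.2 +
      √(gram K (c u.1).1 (c u.2).1 (c u.1).1 (c u.2).1)) := fun u =>
    mul_nonneg (h.jac_nonneg _ _) (add_nonneg (rho_nonneg _ _ _) (Real.sqrt_nonneg _))
  have hint : IntegrableOn (fun u : ℝ × ℝ => jac c u.1 u.2 * (rho c u.1 u.2 +
      √(gram K (c u.1).1 (c u.2).1 (c u.1).1 (c u.2).1))) (square T) := by
    simp only [e0]; exact i1.add i2
  have hm : Measurable fun u : ℝ × ℝ => jac c u.1 u.2 * (rho c u.1 u.2 +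
      √(gram K (c u.1).1 (c u.2).1 (c u.1).1 (c u.2).1)) :=
    h.measurable_jac.mul (h.continuous_rho.add hσc).measurable
  have h1 : ENNReal.ofReal (4 * Real.pi - K * (area K D).toReal) * area K D =
      ENNReal.ofReal (∫ u in square T, jac c u.1 u.2 * (rho c u.1 u.2 +
        √(gram K (c u.1).1 (c u.2).1 (c u.1).1 (c u.2).1))) := by
    rw [ofReal_integral_eq_lintegral_ofReal hint (Filter.Eventually.of_forall hn),
      volume_restrict_square, lintegral_prod _ hm.ennreal_ofReal.aemeasurable]
    exact h.lintegral_square_eq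
  have hf := h.integral_square (f := fun x => x) contDiff_id
  simp only [deriv_id'', one_mul, zero_mul, mul_zero] at hf
  have hle : ∫ u in square T, jac c u.1 u.2 * (rho c u.1 u.2 +
      √(gram K (c u.1).1 (c u.2).1 (c u.1).1 (c u.2).1)) ≤ curveLength c T ^ 2 := by
    have hv : IntegrableOn (fun u : ℝ × ℝ => vnorm K (vel c u.1) * vnorm K (vel c u.2))
        (square T) := by
      have hvc : Continuous fun u : ℝ × ℝ => vnorm K (vel c u.1) * vnorm K (vel c u.2) :=
        (h.continuous_vnorm_vel.comp continuous_fst).mul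
          (h.continuous_vnorm_vel.comp continuous_snd)
      exact (hvc.continuousOn.integrableOn_compact (isCompact_Icc.prod isCompact_Icc)).mono_set
        (prod_mono Ico_subset_Icc_self Ico_subset_Icc_self)
    simp only [e0]
    rw [integral_add i1 i2]
    have h2 := setIntegral_mono (i3.neg.add i2) hv fun u => h.neg_rhoD_mul_add_le u.1 u.2
    have h3 : ∫ u in square T, (-(rhoD c u.1 u.2 * rhoD c u.2 u.1) +
        √(gram K (c u.1).1 (c u.2).1 (c u.1).1 (c u.2).1) * jac c u.1 u.2) =
        -(∫ u in square T, rhoD c u.1 u.2 * rhoD c u.2 u.1) + ∫ u in square T,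
        √(gram K (c u.1).1 (c u.2).1 (c u.1).1 (c u.2).1) * jac c u.1 u.2 := by
      rw [← integral_neg]
      exact integral_add i3.neg i2
    have h4 : ∫ u in square T, vnorm K (vel c u.1) * vnorm K (vel c u.2) =
        curveLength c T ^ 2 := by
      rw [volume_restrict_square, integral_prod_mul (fun s => vnorm K (vel c s))
        (fun s => vnorm K (vel c s)), integral_Ico _ hT, curveLength, sq]
    have h5 : ∫ u in square T, (-(rhoD c u.1 u.2 * rhoD c u.2 u.1) +
        √(gram K (c u.1).1 (c u.2).1 (c u.1).1 (c u.2).1) * jac c u.1 u.2) ≤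
        ∫ u in square T, vnorm K (vel c u.1) * vnorm K (vel c u.2) := h2
    linarith
  have h6 := congrArg ENNReal.toReal h1
  rw [ENNReal.toReal_mul, ENNReal.toReal_ofReal (integral_nonneg hn)] at h6
  -- `ENNReal.ofReal` truncates at 0, and only a ≤ max a 0 is needed, so the sign of 4π − K A plays
  -- no role.
  have h7 : 4 * Real.pi - K * (area K D).toReal ≤
      (ENNReal.ofReal (4 * Real.pi - K * (area K D).toReal)).toReal := by
    rw [ENNReal.toReal_ofReal']; exact le_max_left _ _
  have h8 := mul_le_mul_of_nonneg_right h7 (ENNReal.toReal_nonneg (a := area K D))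
  rw [h6] at h8
  nlinarith

end Domain

end

end XK

theorem mainTheorem8 (K : ℝ) (D : Set (XK.Space K)) (hcompact : IsCompact D)
    (hint : (interior D).Nonempty) (hconvex : GeodConvex D)
    (c : ℝ → XK.Space K) (T : ℝ) (hc : IsC1Boundary D c T) :
    (∀ f : ℝ → ℝ, ContDiff ℝ 1 f →
      IntegrableOn (fun g => f (chordLength D g)) (hitting D) (liouville K) ∧
      IntegrableOn (pleijelIntegrand D c f) (hitting D) (liouville K) ∧
      (NoBoundarySegment D →
        ∫ g in hitting D, f (chordLength D g) ∂(liouville K) =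
          ∫ g in hitting D, pleijelIntegrand D c f g ∂(liouville K) + f 0 * curveLength c T) ∧
      (Summable fun g : supporting D => ∫ x in (0 : ℝ)..chordLength D g, (f x - f 0)) ∧
      ∫ g in hitting D, f (chordLength D g) ∂(liouville K) =
        ∫ g in hitting D, pleijelIntegrand D c f g ∂(liouville K) + f 0 * curveLength c T +
          ∑' g : supporting D, ∫ x in (0 : ℝ)..chordLength D g, (f x - f 0)) ∧
    liouville K (hitting D) = ENNReal.ofReal (curveLength c T) ∧
    4 * Real.pi * (area K D).toReal - K * (area K D).toReal ^ 2 ≤ curveLength c T ^ 2 := by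
  have h : Domain D c T := ⟨hcompact, hint, hconvex, hc⟩
  refine ⟨fun f hf => ?_, h.crofton, h.isoperimetric⟩
  obtain ⟨h1, h2, h3⟩ := h.integral_formula hf
  have h4 := h.hasSum_segments hf
  have h5 : ∫ g in hitting D, f (chordLength D g) ∂(liouville K) =
      ∫ g in hitting D, pleijelIntegrand D c f g ∂(liouville K) + f 0 * curveLength c T +
        ∑' g : supporting D, ∫ x in (0 : ℝ)..chordLength D g, (f x - f 0) := by
    rw [h4.tsum_eq, h3, sub_eq_add_neg]
  refine ⟨h1, h2, fun hD => ?_, h4.summable, h5⟩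
  rw [h5]
  simp only [h.chordLength_eq_zero hD, intervalIntegral.integral_same, tsum_zero, add_zero]
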